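/- **Setting.** Let $X\neq\{0\}$ be a C*-algebra and $\mathcal F$ a norm-closed subspace of $X^*$ such that $(X,\mathcal F)$ is a dual pair: $\|x\|=\sup\{|\varphi(x)|:\varphi\in\mathcal F,\|\varphi\|\le1\}$ for $x\in X$; the convex hull of every relatively $\mathcal F$-compact subset of $X$ is relatively $\mathcal F$-compact; the convex hull of every relatively $X$-compact subset of $\mathcal F$ is relatively $X$-compact; the involution of $X$ is $\mathcal F$-continuous and its multiplication is separately $\mathcal F$-continuous. Here the $\mathcal F$-topology is $\sigma(X,\mathcal F)$ and the $X$-topology is $\sigma(\mathcal F,X)$. Let $G$ be a compact (Hausdorff) group with normalized Haar measure $dg$ and let $(X,G,\alpha)$ be an $\mathcal F$-dynamical system, that is, $\alpha$ is a homomorphism from $G$ to the group of $\mathcal F$-continuous $*$-automorphisms of $X$ such that $g\mapsto\varphi(\alpha_g(x))$ is continuous for all $x\in X$, $\varphi\in\mathcal F$. **Spectra.** Let $\widehat G$ be the set of unitary equivalence classes of irreducible unitary representations of $G$, with a fixed representative $\pi:G\to U(H_\pi)$, $\dim H_\pi=d_\pi<\infty$, in each class. Put $\chi_\pi(g)=d_\pi\sum_i\overline{\pi_{ii}(g)}$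 and $$X_1(\pi)=\Big\{x\in X:\ \int_G\chi_\pi(g)\alpha_g(x)\,dg=x\Big\},\qquad sp(\alpha)=\{\pi\in\widehat G:X_1(\pi)\neq\{0\}\},$$ the integral being taken weakly against $\mathcal F$. For an $\alpha$-invariant $\mathcal F$-closed C*-subalgebra $Y$ of $X$ let $$Y_2(\pi)=\{a\in Y\otimes B(H_\pi):(\alpha_g\otimes\iota)(a)=a(1\otimes\pi_g)\ \text{for all } g\in G\},$$ let $(Y\otimes B(H_\pi))^{\alpha\otimes ad\pi}$ be the fixed-point algebra of the action $a\mapsto(1\otimes\pi_g)\,(\alpha_g\otimes\iota)(a)\,(1\otimes\pi_{g^{-1}})$ of $G$ on $Y\otimes B(H_\pi)$, and let $Y_2(\pi)^*Y_2(\pi)$ be the linear span of the products $a^*b$ with $a,b\in Y_2(\pi)$. Write $\overline{\,\cdot\,}^{\sigma}$ for closure in the $\mathcal F$-topology, respectively in the topology of $X\otimes B(H_\pi)$ given by $\mathcal F\otimes B(H_\pi)^*$. The strong Connes spectrum $\widetilde\Gamma_{\mathcal F}(\alpha)$ is the set of all $\pi\in\widehat G$ such that $$\overline{Y_2(\pi)^*Y_2(\pi)}^{\sigma}=(Y\otimes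 B(H_\pi))^{\alpha\otimes ad\pi}$$ for every non-zero globally $\alpha$-invariant $\mathcal F$-closed hereditary C*-subalgebra $Y$ of $X$. **Simplicity.** A subalgebra $B$ of $X\otimes B(H_\pi)$ is $\mathcal F$-simple if every non-zero two-sided ideal of $B$ is dense in $B$ for the topology given by $\mathcal F\otimes B(H_\pi)^*$. $X$ is $\alpha$-simple if every non-zero $\alpha$-invariant two-sided ideal of $X$ is $\mathcal F$-dense in $X$. **Theorem 3.6.** The following are equivalent: i) $(X\otimes B(H_\pi))^{\alpha\otimes ad\pi}$ is $\mathcal F$-simple for all $\pi\in sp(\alpha)$. ii) $X$ is $\alpha$-simple and $sp(\alpha)=\widetilde\Gamma_{\mathcal F}(\alpha)$. -/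

import Mathlib

open MeasureTheory Topology Matrix

noncomputable section

namespace FDyn

/-! ### Dual pairs of Banach spaces -/

section DualPair

variable {X : Type*} [NonUnitalCStarAlgebra X]

/-- The `F`-topology of `X`: the coarsest topology making every `φ ∈ F` continuous. -/
@[reducible] def fTopology (F : Submodule ℂ (StrongDual ℂ X)) : TopologicalSpace X :=
  TopologicalSpace.induced (fun x (φ : F) => φ.1 x) inferInstance

/-- The `X`-topology of `F`: the topology of pointwise convergence on `X`. -/
@[reducible] def xTopology (F : Submodule ℂ (StrongDual ℂ X)) : TopologicalSpace F :=
  TopologicalSpace.induced (fun φ (x : X) => φ.1 x) inferInstance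

/-- `(X, F)` is a dual pair of Banach spaces and `X` is a C*-algebra whose involution is
`F`-continuous and whose multiplication is separately `F`-continuous. The norm of `F` is the one
inherited from the dual of `X`, so the formula `‖φ‖ = sup {|φ x| : ‖x‖ ≤ 1}` for `φ ∈ F` holds
by definition. A set is relatively compact if its closure is compact. -/
structure IsCStarDualPair (F : Submodule ℂ (StrongDual ℂ X)) : Prop where
  isClosed : IsClosed (F : Set (StrongDual ℂ X))
  norm_eq : ∀ x : X, IsLUB {r : ℝ | ∃ φ ∈ F, ‖φ‖ ≤ 1 ∧ r = ‖φ x‖} ‖x‖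
  convexHull_left : ∀ S : Set X, @IsCompact X (fTopology F) (closure[fTopology F] S) →
    @IsCompact X (fTopology F) (closure[fTopology F] (convexHull ℝ S))
  convexHull_right : ∀ S : Set F, @IsCompact F (xTopology F) (closure[xTopology F] S) →
    @IsCompact F (xTopology F) (closure[xTopology F] (convexHull ℝ S))
  continuous_star : Continuous[fTopology F, fTopology F] (fun x : X => star x)
  continuous_mul_left : ∀ a : X, Continuous[fTopology F, fTopology F] (fun x : X => a * x)
  continuous_mul_right : ∀ a : X, Continuous[fTopology F, fTopology F] (fun x : X => x * a)

/-- The topology of `X ⊗ B(ℂⁿ) = Mₙ(X)` given by `F ⊗ B(ℂⁿ)*`. The elements of `F ⊗ B(ℂⁿ)*` are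
the functionals `a ↦ ∑ φᵢⱼ (aᵢⱼ)` with `φᵢⱼ ∈ F`, so this is the coarsest topology making
`a ↦ φ (aᵢⱼ)` continuous for all `φ ∈ F` and all `i, j`. -/
@[reducible] def matTopology (F : Submodule ℂ (StrongDual ℂ X)) (n : ℕ) :
    TopologicalSpace (Matrix (Fin n) (Fin n) X) :=
  TopologicalSpace.induced (fun a (p : Fin n × Fin n × F) => p.2.2.1 (a p.1 p.2.1)) inferInstance

/-- `y = ∫ f dμ` in the weak sense determined by `F`. -/
def IsWeakIntegral {S : Type*} [MeasurableSpace S] (F : Submodule ℂ (StrongDual ℂ X))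
    (μ : Measure S) (f : S → X) (y : X) : Prop :=
  ∀ φ ∈ F, φ y = ∫ s, φ (f s) ∂μ

end DualPair

/-! ### The dual of a compact group -/

section GroupDual

/-- A continuous irreducible unitary representation of `G` on `ℂⁿ`, `n ≥ 1`. -/
structure IrrRep (G : Type*) [Group G] [TopologicalSpace G] where
  dim : ℕ
  dim_pos : 0 < dim
  rep : G →* unitaryGroup (Fin dim) ℂ
  continuous_rep : Continuous rep
  irreducible : ∀ W : Submodule ℂ (Fin dim → ℂ),
    (∀ g, ∀ w ∈ W, (rep g : Matrix (Fin dim) (Fin dim) ℂ) *ᵥ w ∈ W) → W = ⊥ ∨ W = ⊤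

variable {G : Type*} [Group G] [TopologicalSpace G]

/-- The matrix `π_g`. -/
def IrrRep.mat (π : IrrRep G) (g : G) : Matrix (Fin π.dim) (Fin π.dim) ℂ := π.rep g

/-- Unitary equivalence of representations. -/
def IrrRep.UnitarilyEquiv (π σ : IrrRep G) : Prop :=
  ∃ U : Matrix (Fin σ.dim) (Fin π.dim) ℂ,
    Uᴴ * U = 1 ∧ U * Uᴴ = 1 ∧ ∀ g, U * π.mat g = σ.mat g * U

instance irrRepSetoid (G : Type*) [Group G] [TopologicalSpace G] : Setoid (IrrRep G) where
  r := IrrRep.UnitarilyEquiv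
  iseqv :=
    { refl := fun π => ⟨1, by simp, by simp, by simp⟩
      symm := by
        rintro π σ ⟨U, h1, h2, h3⟩
        refine ⟨Uᴴ, by simpa using h2, by simpa using h1, fun g => ?_⟩
        calc Uᴴ * σ.mat g = Uᴴ * (σ.mat g * U) * Uᴴ := by
              rw [Matrix.mul_assoc, Matrix.mul_assoc, h2, Matrix.mul_one]
          _ = (Uᴴ * U) * π.mat g * Uᴴ := by rw [← h3]; simp only [Matrix.mul_assoc]
          _ = π.mat g * Uᴴ := by rw [h1, Matrix.one_mul]
      trans := by
        rintro π σ τ ⟨U, h1, h2, h3⟩ ⟨V, k1, k2, k3⟩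
        refine ⟨V * U, ?_, ?_, fun g => ?_⟩
        · rw [conjTranspose_mul, Matrix.mul_assoc, ← Matrix.mul_assoc Vᴴ, k1, Matrix.one_mul, h1]
        · rw [conjTranspose_mul, Matrix.mul_assoc, ← Matrix.mul_assoc U, h2, Matrix.one_mul, k2]
        · rw [Matrix.mul_assoc, h3, ← Matrix.mul_assoc, k3, Matrix.mul_assoc] }

/-- The set `Ĝ` of unitary equivalence classes of irreducible representations of `G`. -/
def DualSet (G : Type*) [Group G] [TopologicalSpace G] : Type _ := Quotient (irrRepSetoid G)

/-- The fixed representative of a class in `Ĝ`. -/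
def DualSet.rep (c : DualSet G) : IrrRep G := Quotient.out c

/-- `χ_π(g) = d_π ∑ᵢ conj (π_ii(g))`. -/
def IrrRep.chi (π : IrrRep G) (g : G) : ℂ := (π.dim : ℂ) * ∑ i, star (π.mat g i i)

end GroupDual

/-! ### Matrices over `X` multiplied by scalar matrices -/

section ScalarMul

variable {X : Type*} [NonUnitalCStarAlgebra X] {n : ℕ}

/-- `(1 ⊗ u) a` for a scalar matrix `u` and `a ∈ X ⊗ B(ℂⁿ)`. -/
def scalarMul (u : Matrix (Fin n) (Fin n) ℂ) (a : Matrix (Fin n) (Fin n) X) :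
    Matrix (Fin n) (Fin n) X := of fun i j => ∑ k, u i k • a k j

/-- `a (1 ⊗ u)` for a scalar matrix `u` and `a ∈ X ⊗ B(ℂⁿ)`. -/
def mulScalar (a : Matrix (Fin n) (Fin n) X) (u : Matrix (Fin n) (Fin n) ℂ) :
    Matrix (Fin n) (Fin n) X := of fun i j => ∑ k, u k j • a i k

variable (u v : Matrix (Fin n) (Fin n) ℂ) (a b : Matrix (Fin n) (Fin n) X)

lemma mulScalar_mul : mulScalar a u * b = a * scalarMul u b := by
  ext i j
  simp only [mulScalar, scalarMul, Matrix.mul_apply, of_apply, Finset.sum_mul, Finset.mul_sum,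
    smul_mul_assoc, mul_smul_comm]
  exact Finset.sum_comm

lemma scalarMul_mul : scalarMul u (a * b) = scalarMul u a * b := by
  ext i j
  simp only [scalarMul, Matrix.mul_apply, of_apply, Finset.sum_mul, Finset.smul_sum,
    smul_mul_assoc]
  exact Finset.sum_comm

lemma mul_mulScalar : mulScalar (a * b) u = a * mulScalar b u := by
  ext i j
  simp only [mulScalar, Matrix.mul_apply, of_apply, Finset.mul_sum, Finset.smul_sum,
    mul_smul_comm]
  exact Finset.sum_comm

lemma scalarMul_scalarMul : scalarMul u (scalarMul v a) = scalarMul (u * v) a := by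
  ext i j
  simp only [scalarMul, Matrix.mul_apply, of_apply, Finset.smul_sum, Finset.sum_smul, mul_smul]
  exact Finset.sum_comm

lemma one_scalarMul : scalarMul (1 : Matrix (Fin n) (Fin n) ℂ) a = a := by
  ext i j
  simp [scalarMul, Matrix.one_apply, ite_smul]

lemma scalarMul_mulScalar : scalarMul u (mulScalar a v) = mulScalar (scalarMul u a) v := by
  ext i j
  simp only [scalarMul, mulScalar, of_apply, Finset.smul_sum]
  rw [Finset.sum_comm]
  exact Finset.sum_congr rfl fun k _ => Finset.sum_congr rfl fun l _ => smul_comm _ _ _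

lemma conjTranspose_scalarMul : (scalarMul u a)ᴴ = mulScalar aᴴ uᴴ := by
  ext i j
  simp [scalarMul, mulScalar, conjTranspose_apply]

lemma conjTranspose_mulScalar : (mulScalar a u)ᴴ = scalarMul uᴴ aᴴ := by
  ext i j
  simp [scalarMul, mulScalar, conjTranspose_apply]

end ScalarMul

/-! ### Dynamical systems, spectral subspaces and fixed point algebras -/

section System

variable {X : Type*} [NonUnitalCStarAlgebra X] {G : Type*} [Group G] [TopologicalSpace G]

/-- `(X, G, α)` is an `F`-dynamical system: `α` is a homomorphism from `G` to the group of
`F`-continuous *-automorphisms of `X` and `g ↦ φ (α_g x)` is continuous for all `x` and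
`φ ∈ F`. -/
structure IsFDynamicalSystem (F : Submodule ℂ (StrongDual ℂ X)) (α : G →* (X ≃⋆ₐ[ℂ] X)) :
    Prop where
  continuous_aut : ∀ g, Continuous[fTopology F, fTopology F] (α g)
  continuous_orbit : ∀ x : X, ∀ φ ∈ F, Continuous fun g => φ (α g x)

/-- The action `α ⊗ ad π` on `X ⊗ B(H_π)`:
`a ↦ (1 ⊗ π_g) [α_g(aᵢⱼ)] (1 ⊗ π_{g⁻¹})`. -/
def tensorAd (α : G →* (X ≃⋆ₐ[ℂ] X)) (π : IrrRep G) (g : G)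
    (a : Matrix (Fin π.dim) (Fin π.dim) X) : Matrix (Fin π.dim) (Fin π.dim) X :=
  mulScalar (scalarMul (π.mat g) (a.map (α g))) (π.mat g⁻¹)

lemma mat_inv_mul (π : IrrRep G) (g : G) : π.mat g⁻¹ * π.mat g = 1 := by
  have h : π.rep g⁻¹ * π.rep g = 1 := by rw [← map_mul]; simp
  exact congrArg Subtype.val h

lemma mat_inv (π : IrrRep G) (g : G) : π.mat g⁻¹ = (π.mat g)ᴴ := by
  simp only [IrrRep.mat, map_inv]
  rfl

/-- The fixed point algebra `(Y ⊗ B(H_π))^{α ⊗ ad π}` of a subalgebra `Y` of `X`; the case of `X`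
itself is `Y = ⊤`. -/
def fixedAlgebra (α : G →* (X ≃⋆ₐ[ℂ] X)) (Y : NonUnitalStarSubalgebra ℂ X) (π : IrrRep G) :
    NonUnitalStarSubalgebra ℂ (Matrix (Fin π.dim) (Fin π.dim) X) where
  carrier := {a | (∀ i j, a i j ∈ Y) ∧ ∀ g, tensorAd α π g a = a}
  add_mem' := by
    rintro a b ⟨ha, ha'⟩ ⟨hb, hb'⟩
    refine ⟨fun i j => add_mem (ha i j) (hb i j), fun g => ?_⟩
    conv_rhs => rw [← ha' g, ← hb' g]
    ext i j
    simp [tensorAd, mulScalar, scalarMul, smul_add, Finset.sum_add_distrib]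
  zero_mem' := by
    refine ⟨fun i j => zero_mem Y, fun g => ?_⟩
    ext i j
    simp [tensorAd, mulScalar, scalarMul]
  smul_mem' := by
    rintro c a ⟨ha, ha'⟩
    refine ⟨fun i j => SMulMemClass.smul_mem c (ha i j), fun g => ?_⟩
    conv_rhs => rw [← ha' g]
    ext i j
    simp only [tensorAd, mulScalar, scalarMul, of_apply, map_apply, Matrix.smul_apply, map_smul,
      Finset.smul_sum]
    exact Finset.sum_congr rfl fun k _ => Finset.sum_congr rfl fun l _ => by
      rw [smul_comm c, smul_comm c]
  mul_mem' := by
    rintro a b ⟨ha, ha'⟩ ⟨hb, hb'⟩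
    refine ⟨fun i j => ?_, fun g => ?_⟩
    · rw [Matrix.mul_apply]
      exact sum_mem fun k _ => mul_mem (ha i k) (hb k j)
    · have hm : (a * b).map (α g) = a.map (α g) * b.map (α g) := by
        ext i j
        simp [Matrix.mul_apply]
      conv_rhs => rw [← ha' g, ← hb' g]
      simp only [tensorAd]
      rw [hm, mulScalar_mul, scalarMul_mulScalar, scalarMul_scalarMul, mat_inv_mul,
        one_scalarMul, scalarMul_mul, mul_mulScalar]
  star_mem' := by
    rintro a ⟨ha, ha'⟩
    refine ⟨fun i j => star_mem (ha j i), fun g => ?_⟩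
    have hm : (star a).map (α g) = (a.map (α g))ᴴ := by
      ext i j
      simp [star_eq_conjTranspose, conjTranspose_apply, map_star]
    conv_rhs => rw [← ha' g]
    simp only [tensorAd, star_eq_conjTranspose] at hm ⊢
    rw [hm, conjTranspose_mulScalar, conjTranspose_scalarMul, mat_inv, conjTranspose_conjTranspose,
      scalarMul_mulScalar]

/-- The spectral subspace `Y₂(π) = {a ∈ Y ⊗ B(H_π) : (α_g ⊗ ι)(a) = a (1 ⊗ π_g) for all g}`. -/
def spectralSubspaceTwo (α : G →* (X ≃⋆ₐ[ℂ] X)) (Y : NonUnitalStarSubalgebra ℂ X)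
    (π : IrrRep G) : Set (Matrix (Fin π.dim) (Fin π.dim) X) :=
  {a | (∀ i j, a i j ∈ Y) ∧ ∀ g, a.map (α g) = mulScalar a (π.mat g)}

/-- `Y₂(π)* Y₂(π)`, the linear span of the products `a* b` with `a, b ∈ Y₂(π)`. -/
def spectralIdeal (α : G →* (X ≃⋆ₐ[ℂ] X)) (Y : NonUnitalStarSubalgebra ℂ X)
    (π : IrrRep G) : Submodule ℂ (Matrix (Fin π.dim) (Fin π.dim) X) :=
  Submodule.span ℂ {c | ∃ a ∈ spectralSubspaceTwo α Y π, ∃ b ∈ spectralSubspaceTwo α Y π,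
    c = aᴴ * b}

/-- The strong Arveson type spectrum of the restriction of `α` to `Y`: all `π ∈ Ĝ` such that the
`F`-closure of `Y₂(π)* Y₂(π)` is `(Y ⊗ B(H_π))^{α ⊗ ad π}`. -/
def strongArvesonSpectrum (F : Submodule ℂ (StrongDual ℂ X)) (α : G →* (X ≃⋆ₐ[ℂ] X))
    (Y : NonUnitalStarSubalgebra ℂ X) : Set (DualSet G) :=
  {π | closure[matTopology F π.rep.dim]
      (spectralIdeal α Y π.rep : Set (Matrix (Fin π.rep.dim) (Fin π.rep.dim) X)) =
    fixedAlgebra α Y π.rep}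

/-- `Y` is a non-zero globally `α`-invariant `F`-closed hereditary C*-subalgebra of `X`. -/
structure IsInvariantHereditary [PartialOrder X] (F : Submodule ℂ (StrongDual ℂ X))
    (α : G →* (X ≃⋆ₐ[ℂ] X)) (Y : NonUnitalStarSubalgebra ℂ X) : Prop where
  ne_bot : ∃ y ∈ Y, y ≠ 0
  isClosed : IsClosed[fTopology F] (Y : Set X)
  invariant : ∀ g, ∀ y ∈ Y, α g y ∈ Y
  hereditary : ∀ x y : X, 0 ≤ x → x ≤ y → y ∈ Y → x ∈ Y

/-- The strong Connes spectrum `Γ̃_F(α)`. -/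
def strongConnesSpectrum [PartialOrder X] (F : Submodule ℂ (StrongDual ℂ X))
    (α : G →* (X ≃⋆ₐ[ℂ] X)) : Set (DualSet G) :=
  {π | ∀ Y, IsInvariantHereditary F α Y → π ∈ strongArvesonSpectrum F α Y}

/-- `X` is `α`-simple: every non-zero `α`-invariant two-sided ideal is `F`-dense in `X`. -/
def IsAlphaSimple (F : Submodule ℂ (StrongDual ℂ X)) (α : G →* (X ≃⋆ₐ[ℂ] X)) : Prop :=
  ∀ I : Submodule ℂ X, I ≠ ⊥ → (∀ x ∈ I, ∀ b, b * x ∈ I ∧ x * b ∈ I) →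
    (∀ g, ∀ x ∈ I, α g x ∈ I) → closure[fTopology F] (I : Set X) = Set.univ

/-- A subalgebra `B` of `X ⊗ B(ℂⁿ)` is `F`-simple: every non-zero two-sided ideal of `B` is
dense in `B` for the topology given by `F ⊗ B(ℂⁿ)*`. -/
def IsFSimple (F : Submodule ℂ (StrongDual ℂ X)) {n : ℕ}
    (B : NonUnitalStarSubalgebra ℂ (Matrix (Fin n) (Fin n) X)) : Prop :=
  ∀ I : Submodule ℂ (Matrix (Fin n) (Fin n) X), I ≠ ⊥ → (∀ x ∈ I, x ∈ B) →
    (∀ x ∈ I, ∀ b ∈ B, b * x ∈ I ∧ x * b ∈ I) →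
    (B : Set (Matrix (Fin n) (Fin n) X)) ⊆ closure[matTopology F n] (I : Set _)

variable [IsTopologicalGroup G] [CompactSpace G] [MeasurableSpace G] [BorelSpace G]

/-- The spectral subspace `X₁(π) = {x : P_α(π)(x) = x}`, where
`P_α(π)(x) = ∫ χ_π(g) α_g(x) dg` is a weak integral for the normalized Haar measure of `G`. -/
def spectralSubspaceOne (F : Submodule ℂ (StrongDual ℂ X)) (α : G →* (X ≃⋆ₐ[ℂ] X))
    (π : IrrRep G) : Set X :=
  {x | IsWeakIntegral F (Measure.haarMeasure (⊤ : TopologicalSpace.PositiveCompacts G))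
    (fun g => π.chi g • α g x) x}

/-- `sp(α) = {π ∈ Ĝ : X₁(π) ≠ {0}}`. -/
def spectrumOf (F : Submodule ℂ (StrongDual ℂ X)) (α : G →* (X ≃⋆ₐ[ℂ] X)) : Set (DualSet G) :=
  {π | spectralSubspaceOne F α π.rep ≠ {0}}

end System

end FDyn

end

/-! Everything is reduced to the fixed point algebra `fixedPts α`, written X^α. A row is a tuple a =
(a_k) with α_g(a_k) = ∑ π(g)_mk a_m; these are exactly the rows of the matrices in X₂(π). For rows
a, b of π the matrix a* b lies in (X ⊗ B(H_π))^{α ⊗ ad π}, while a b* = ∑ a_k b_k* lies in X^α.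
Ideals are carried between the two algebras along these products, as in a Morita equivalence. Two
facts make this work. By Peter–Weyl the entries of rows are weakly total (`mem_wcl_of_rows`). Since
∑ a_k a_k* is in X^α, functional calculus gives u in X^α with u a_k close to a_k
(`exists_approx_family`).

From i) to ii). The trivial class is always in sp(α), so X^α is F-simple (`FixSimple.of_isFSimple`).
A non-zero closed invariant ideal contains some ∑ a_k a_k* ≠ 0, hence X^α, hence every row, hence X
(`FixSimple.isAlphaSimple`). For π in sp(α) and Y hereditary, the matrices (ua)*(vb) with u, v in
Y^α span a non-zero ideal of the fixed algebra of X ⊗ B(H_π). It is dense, and compressing by Y^α on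
both sides turns this density into that of Y₂(π)* Y₂(π) (`FixSimple.mem_strongConnesSpectrum`). The
inclusion of the strong Connes spectrum in sp(α) needs no simplicity.

From ii) to i). Given a non-zero ideal J of X^α, take Y to be the closure of J X J*. By α-simplicity
X Y^α X is dense in X, so its average over G is dense in X^α. That average reduces to elements ∑ a_k
w b_k* with w in Y^α. As π is in the strong Connes spectrum, w ⊗ 1 is a limit of sums of p* q with
rows p, q in Y, and (a p*)(q b*) is in the closure of J (`sum_mul_mul_star_mem_wcl`). So X^α is
F-simple. An ideal of the fixed algebra for π is then sent to an ideal a J b* of X^α and recovered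
from it (`FixSimple.isFSimple`). -/

noncomputable section

namespace FDyn

set_option linter.unusedSectionVars false

/-! ### Unitarity of the matrix coefficients. -/

section Representations

variable {G : Type*} [Group G] [TopologicalSpace G]

lemma mat_mul (π : IrrRep G) (g h : G) : π.mat (g * h) = π.mat g * π.mat h := by
  simp [IrrRep.mat]

lemma continuous_mat (π : IrrRep G) (i j : Fin π.dim) : Continuous fun g => π.mat g i j :=
  (continuous_subtype_val.comp π.continuous_rep).matrix_elem i j

lemma mat_conjTranspose_mul (π : IrrRep G) (g : G) : (π.mat g)ᴴ * π.mat g = 1 := by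
  rw [← mat_inv, mat_inv_mul]

lemma mat_mul_conjTranspose (π : IrrRep G) (g : G) : π.mat g * (π.mat g)ᴴ = 1 :=
  mul_eq_one_comm.1 (mat_conjTranspose_mul π g)

lemma sum_star_mat_mul_mat (π : IrrRep G) (g : G) (k l : Fin π.dim) :
    ∑ m, star (π.mat g m k) * π.mat g m l = if k = l then 1 else 0 := by
  have := congrFun (congrFun (mat_conjTranspose_mul π g) k) l
  simpa [Matrix.mul_apply, Matrix.one_apply] using this

lemma sum_mat_mul_star_mat (π : IrrRep G) (g : G) (k l : Fin π.dim) :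
    ∑ m, π.mat g k m * star (π.mat g l m) = if k = l then 1 else 0 := by
  have := congrFun (congrFun (mat_mul_conjTranspose π g) k) l
  simpa [Matrix.mul_apply, Matrix.one_apply] using this

end Representations

/-! ### Peter–Weyl: convolution operators, irreducible spaces of functions, separation by
coefficients. -/

section PeterWeyl

open scoped InnerProductSpace

variable {G : Type*} [Group G] [TopologicalSpace G] [IsTopologicalGroup G] [CompactSpace G]
  [MeasurableSpace G] [BorelSpace G]

/-- The normalized Haar measure of a compact group. -/
abbrev haar (G : Type*) [Group G] [TopologicalSpace G] [IsTopologicalGroup G] [CompactSpace G]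
    [MeasurableSpace G] [BorelSpace G] : Measure G :=
  Measure.haarMeasure (⊤ : TopologicalSpace.PositiveCompacts G)

instance : IsProbabilityMeasure (haar G) :=
  ⟨by simpa using Measure.haarMeasure_self (K₀ := (⊤ : TopologicalSpace.PositiveCompacts G))⟩

lemma integrable_of_continuous {E : Type*} [NormedAddCommGroup E] {f : G → E}
    (hf : Continuous f) : Integrable f (haar G) :=
  hf.integrable_of_hasCompactSupport (HasCompactSupport.of_compactSpace f)

/-- Left translation of continuous functions. -/
def translate (h : G) : C(G, ℂ) →ₗ[ℂ] C(G, ℂ) where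
  toFun f := ⟨fun x => f (h⁻¹ * x), by fun_prop⟩
  map_add' _ _ := rfl
  map_smul' _ _ := rfl

@[simp] lemma translate_apply (h : G) (f : C(G, ℂ)) (x : G) : translate h f x = f (h⁻¹ * x) := rfl

lemma translate_mul (g h : G) (f : C(G, ℂ)) :
    translate (g * h) f = translate g (translate h f) := by
  ext x; simp [mul_assoc]

/-- The space of square integrable functions. -/
abbrev LTwo (G : Type*) [Group G] [TopologicalSpace G] [IsTopologicalGroup G] [CompactSpace G]
    [MeasurableSpace G] [BorelSpace G] := Lp ℂ 2 (haar G)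

/-- The embedding of the continuous functions in `L²`. -/
def toLTwo : C(G, ℂ) →L[ℂ] LTwo G := ContinuousMap.toLp 2 (haar G) ℂ

lemma inner_toLTwo_left (u : C(G, ℂ)) (f : LTwo G) :
    ⟪toLTwo u, f⟫_ℂ = ∫ y, star (u y) * f y ∂(haar G) := by
  rw [L2.inner_def]
  refine integral_congr_ae ?_
  filter_upwards [ContinuousMap.coeFn_toLp (p := 2) (𝕜 := ℂ) (haar G) u] with y hy
  simp only [toLTwo, hy, RCLike.inner_apply]
  exact mul_comm _ _

lemma inner_toLTwo (u v : C(G, ℂ)) :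
    ⟪toLTwo u, toLTwo v⟫_ℂ = ∫ y, star (u y) * v y ∂(haar G) := by
  rw [inner_toLTwo_left]
  refine integral_congr_ae ?_
  filter_upwards [ContinuousMap.coeFn_toLp (p := 2) (𝕜 := ℂ) (haar G) v] with y hy
  simp only [toLTwo, hy]

lemma toLTwo_injective : Function.Injective (toLTwo : C(G, ℂ) →L[ℂ] LTwo G) :=
  ContinuousMap.toLp_injective (p := 2) (𝕜 := ℂ) (haar G)

lemma denseRange_toLTwo [T2Space G] : DenseRange (toLTwo : C(G, ℂ) →L[ℂ] LTwo G) :=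
  ContinuousMap.toLp_denseRange ℂ (haar G) ℂ (by simp)

lemma inner_translate (h : G) (u v : C(G, ℂ)) :
    ⟪toLTwo (translate h u), toLTwo (translate h v)⟫_ℂ = ⟪toLTwo u, toLTwo v⟫_ℂ := by
  simp only [inner_toLTwo, translate_apply]
  exact integral_mul_left_eq_self (fun y => star (u y) * v y) h⁻¹

/-- The convolution kernel `(x, y) ↦ conj (k (x⁻¹ y))` as a continuous map to `L²`. -/
def convKernel (k : C(G, ℂ)) : C(G, LTwo G) :=
  (⟨toLTwo, toLTwo.continuous⟩ : C(C(G, ℂ), LTwo G)).comp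
    (ContinuousMap.curry ⟨fun p : G × G => star (k (p.1⁻¹ * p.2)), by fun_prop⟩)

/-- Convolution with `k` as an operator from `L²` to the continuous functions. -/
def convC (k : C(G, ℂ)) : LTwo G →L[ℂ] C(G, ℂ) :=
  LinearMap.mkContinuous
    { toFun := fun f => ⟨fun x => ⟪convKernel k x, f⟫_ℂ, by fun_prop⟩
      map_add' := fun f g => by ext x; simp [inner_add_right]
      map_smul' := fun c f => by ext x; simp [inner_smul_right] } ‖convKernel k‖ (by
    intro f
    rw [ContinuousMap.norm_le _ (by positivity)]
    intro x
    exact (norm_inner_le_norm _ _).trans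
      (mul_le_mul_of_nonneg_right ((convKernel k).norm_coe_le_norm x) (norm_nonneg f)))

lemma convC_toLTwo (k u : C(G, ℂ)) (x : G) :
    convC k (toLTwo u) x = ∫ y, k (x⁻¹ * y) * u y ∂(haar G) := by
  change ⟪toLTwo _, toLTwo u⟫_ℂ = _
  rw [inner_toLTwo]
  simp

/-- Arzelà–Ascoli: the image of the unit ball is bounded by the operator norm, and it is
equicontinuous because `convKernel k` is continuous from G to L². -/
lemma isCompactOperator_convC (k : C(G, ℂ)) : IsCompactOperator (convC k) := by
  let L := ContinuousMap.linearIsometryBoundedOfCompact G ℂ ℂ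
  have h : IsCompactOperator (fun f => L (convC k f)) := by
    have := (isCompactOperator_iff_isCompact_closure_image_ball (𝕜₁ := ℂ)
      (L.toLinearEquiv.toLinearMap ∘ₗ (convC k).toLinearMap)
      (r := 1) one_pos).2 ?_
    · exact this
    refine BoundedContinuousFunction.arzela_ascoli (Metric.closedBall 0 ‖convC k‖)
      (isCompact_closedBall _ _) _ ?_ ?_
    · rintro _ x ⟨f, hf, rfl⟩
      simp only [Metric.mem_ball, dist_zero_right, Metric.mem_closedBall] at hf ⊢
      calc ‖convC k f x‖ ≤ ‖convC k f‖ := (convC k f).norm_coe_le_norm x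
        _ ≤ ‖convC k‖ * ‖f‖ := (convC k).le_opNorm f
        _ ≤ ‖convC k‖ * 1 := by gcongr
        _ = _ := mul_one _
    · intro x
      rw [Metric.equicontinuousAt_iff_right]
      intro ε hε
      have hc := (convKernel k).continuous.continuousAt (x := x)
      filter_upwards [Metric.tendsto_nhds.1 hc ε hε] with y hy
      rintro ⟨_, f, hf, rfl⟩
      simp only [Metric.mem_ball, dist_zero_right] at hf
      change dist (⟪convKernel k x, f⟫_ℂ) (⟪convKernel k y, f⟫_ℂ) < ε
      rw [dist_eq_norm, ← inner_sub_left]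
      refine (norm_inner_le_norm _ _).trans_lt ?_
      rw [← dist_eq_norm, dist_comm]
      nlinarith [dist_nonneg (x := convKernel k y) (y := convKernel k x), norm_nonneg f]
  have h' := h.continuous_comp L.symm.continuous
  simpa [Function.comp_def] using h'

end PeterWeyl

section PeterWeyl

open scoped InnerProductSpace

variable {G : Type*} [Group G] [TopologicalSpace G] [IsTopologicalGroup G] [CompactSpace G]
  [MeasurableSpace G] [BorelSpace G]

/-- Convolution with `k` as an operator on `L²`. -/
def conv (k : C(G, ℂ)) : LTwo G →L[ℂ] LTwo G := toLTwo ∘L convC k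

lemma isCompactOperator_conv (k : C(G, ℂ)) : IsCompactOperator (conv k) :=
  (isCompactOperator_convC k).clm_comp toLTwo

/-- For continuous functions this is Fubini together with the symmetry of the kernel; density
extends it to L². -/
lemma isSymmetric_conv [T2Space G] (k : C(G, ℂ)) (hk : ∀ g, star (k g) = k g⁻¹) :
    (conv k : LTwo G →ₗ[ℂ] LTwo G).IsSymmetric := by
  intro f h
  refine denseRange_toLTwo.induction_on₂
    (p := fun f h => ⟪conv k f, h⟫_ℂ = ⟪f, conv k h⟫_ℂ) ?_ ?_ f h
  · exact isClosed_eq (by fun_prop) (by fun_prop)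
  · intro u v
    simp only [conv, ContinuousLinearMap.comp_apply, inner_toLTwo, convC_toLTwo]
    have h1 : ∀ x, star (∫ y, k (x⁻¹ * y) * u y ∂(haar G)) * v x =
        ∫ y, star (u y) * (k (y⁻¹ * x) * v x) ∂(haar G) := by
      intro x
      rw [RCLike.star_def, ← integral_conj, ← integral_mul_const]
      refine integral_congr_ae (.of_forall fun y => ?_)
      simp only [map_mul]
      have := hk (x⁻¹ * y)
      simp only [RCLike.star_def, _root_.mul_inv_rev, inv_inv] at this
      rw [this]; ring
    simp only [h1, ← integral_const_mul]
    exact integral_integral_swap_of_hasCompactSupport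
      (f := fun x y => star (u y) * (k (y⁻¹ * x) * v x)) (by fun_prop)
      (HasCompactSupport.of_compactSpace _)

lemma convC_translate (k f : C(G, ℂ)) (h : G) :
    convC k (toLTwo (translate h f)) = translate h (convC k (toLTwo f)) := by
  ext x
  simp only [convC_toLTwo, translate_apply]
  rw [← integral_mul_left_eq_self _ h]
  simp [mul_assoc]

/-- The complex conjugate of a matrix coefficient. -/
def conjCoeff (π : IrrRep G) (i j : Fin π.dim) : C(G, ℂ) where
  toFun g := star (π.mat g i j)
  continuous_toFun := (continuous_mat π i j).star

/-- Substituting y ↦ xy and expanding π(xy) = π(x)π(y) shows that convolution only mixes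
coefficients within one row. Hence `coeffSpan` is invariant and, for a symmetric kernel, so is its
orthogonal complement. -/
lemma convC_conjCoeff (k : C(G, ℂ)) (π : IrrRep G) (i j : Fin π.dim) :
    convC k (toLTwo (conjCoeff π i j)) =
      ∑ l, (∫ y, k y * star (π.mat y l j) ∂(haar G)) • conjCoeff π i l := by
  ext x
  rw [convC_toLTwo, ← integral_mul_left_eq_self _ x]
  simp only [conjCoeff, ContinuousMap.coe_mk, inv_mul_cancel_left, mat_mul, Matrix.mul_apply,
    ContinuousMap.coe_sum, Finset.sum_apply, ContinuousMap.coe_smul, Pi.smul_apply, smul_eq_mul]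
  simp only [star_sum, star_mul', Finset.mul_sum]
  rw [integral_finsetSum]
  · refine Finset.sum_congr rfl fun l _ => ?_
    rw [← integral_mul_const]
    refine integral_congr_ae (.of_forall fun y => ?_)
    ring
  · intro l _
    have h1 := continuous_mat π l j
    exact integrable_of_continuous (by fun_prop)

/-- The span of the conjugates of matrix coefficients in `L²`. -/
def coeffSpan (G : Type*) [Group G] [TopologicalSpace G] [IsTopologicalGroup G] [CompactSpace G]
    [MeasurableSpace G] [BorelSpace G] : Submodule ℂ (LTwo G) :=
  Submodule.span ℂ {f | ∃ (π : IrrRep G) (i j : Fin π.dim), f = toLTwo (conjCoeff π i j)}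

lemma conv_mem_coeffSpan (k : C(G, ℂ)) {f : LTwo G} (hf : f ∈ coeffSpan G) :
    conv k f ∈ coeffSpan G := by
  induction hf using Submodule.span_induction with
  | mem f hf =>
    obtain ⟨π, i, j, rfl⟩ := hf
    simp only [conv, ContinuousLinearMap.comp_apply, convC_conjCoeff, map_sum, map_smul]
    exact sum_mem fun l _ => Submodule.smul_mem _ _ (Submodule.subset_span ⟨π, i, l, rfl⟩)
  | zero => simp
  | add f g _ _ hf hg => simpa using add_mem hf hg
  | smul c f _ hf => simpa using Submodule.smul_mem _ c hf

lemma conv_mem_orthogonal [T2Space G] (k : C(G, ℂ)) (hk : ∀ g, star (k g) = k g⁻¹) {f : LTwo G}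
    (hf : f ∈ (coeffSpan G)ᗮ) : conv k f ∈ (coeffSpan G)ᗮ := by
  rw [Submodule.mem_orthogonal] at hf ⊢
  intro m hm
  have := isSymmetric_conv k hk m f
  simp only [ContinuousLinearMap.coe_coe] at this
  rw [← this]
  exact hf _ (conv_mem_coeffSpan k hm)

/-- A finite-dimensional nonzero space with a nonzero invariant subspace has a minimal one. -/
lemma exists_minimal_submodule {V : Type*} [AddCommGroup V] [Module ℂ V] (E : Submodule ℂ V)
    [FiniteDimensional ℂ E] (P : Submodule ℂ V → Prop) (hE : P E) (hne : E ≠ ⊥) :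
    ∃ W ≤ E, W ≠ ⊥ ∧ P W ∧ ∀ W' ≤ W, P W' → W' = ⊥ ∨ W' = W := by
  have hex : ∃ n, ∃ W ≤ E, W ≠ ⊥ ∧ P W ∧ Module.finrank ℂ W = n := ⟨_, E, le_rfl, hne, hE, rfl⟩
  classical
  obtain ⟨W, hWE, hW, hPW, hn⟩ := Nat.find_spec hex
  refine ⟨W, hWE, hW, hPW, fun W' hW' hP => ?_⟩
  by_contra! hcon
  have hlt : W' < W := lt_of_le_of_ne hW' hcon.2
  have : FiniteDimensional ℂ W := Submodule.finiteDimensional_of_le hWE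
  have := Submodule.finrank_lt_finrank_of_lt hlt
  exact Nat.find_min hex (this.trans_eq hn) ⟨W', hW'.trans hWE, hcon.1, hP, rfl⟩

/-- The basis is chosen in the image of W in L² and pulled back, so that its members are genuine
continuous functions which can be evaluated at points. -/
lemma exists_orthonormal_basis (W : Submodule ℂ C(G, ℂ)) [FiniteDimensional ℂ W] :
    ∃ (n : ℕ) (w : Fin n → C(G, ℂ)), (∀ i, w i ∈ W) ∧
      Orthonormal ℂ (fun i => toLTwo (w i)) ∧ W ≤ Submodule.span ℂ (Set.range w) := by
  let b := stdOrthonormalBasis ℂ (W.map (toLTwo : C(G, ℂ) →L[ℂ] LTwo G).toLinearMap)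
  have hb : ∀ i, ∃ f ∈ W, toLTwo f = (b i : LTwo G) := fun i => by
    obtain ⟨f, hf, hf'⟩ := (b i).2
    exact ⟨f, hf, hf'⟩
  choose w hw hwb using hb
  refine ⟨_, w, hw, ?_, fun f hf => ?_⟩
  · simp only [hwb]
    exact b.orthonormal.comp_linearIsometry (Submodule.subtypeₗᵢ _)
  · have h1 := b.sum_repr ⟨toLTwo f, Submodule.mem_map_of_mem hf⟩
    have h2 : toLTwo f =
        toLTwo (∑ i, b.repr ⟨toLTwo f, Submodule.mem_map_of_mem hf⟩ i • w i) := by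
      rw [map_sum]
      simp only [map_smul, hwb]
      have := congrArg Subtype.val h1
      simpa using this.symm
    rw [toLTwo_injective h2]
    exact sum_mem fun i _ => Submodule.smul_mem _ _ (Submodule.subset_span ⟨i, rfl⟩)

/-- The matrix of the translation by `h` with respect to an orthonormal family. -/
def translateMat {n : ℕ} (w : Fin n → C(G, ℂ)) (h : G) : Matrix (Fin n) (Fin n) ℂ :=
  of fun k l => ⟪toLTwo (w k), toLTwo (translate h (w l))⟫_ℂ

lemma continuous_translateMat {n : ℕ} (w : Fin n → C(G, ℂ)) : Continuous (translateMat w) := by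
  refine continuous_matrix fun k l => ?_
  have h : Continuous fun h : G => translate h (w l) :=
    (ContinuousMap.curry ⟨fun p : G × G => w l (p.1⁻¹ * p.2), by fun_prop⟩).continuous
  exact continuous_const.inner (toLTwo.continuous.comp h)

section Minimal

variable {n : ℕ} {w : Fin n → C(G, ℂ)}

lemma sum_smul_injective (hon : Orthonormal ℂ (fun i => toLTwo (w i))) :
    Function.Injective (Fintype.linearCombination ℂ w) := by
  have h : LinearIndependent ℂ w :=
    LinearIndependent.of_comp (toLTwo : C(G, ℂ) →L[ℂ] LTwo G).toLinearMap hon.linearIndependent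
  exact LinearIndependent.fintypeLinearCombination_injective h

lemma translate_eq_sum (hon : Orthonormal ℂ (fun i => toLTwo (w i))) (h : G) (i : Fin n)
    (hw : translate h (w i) ∈ Submodule.span ℂ (Set.range w)) :
    translate h (w i) = ∑ k, translateMat w h k i • w k := by
  obtain ⟨c, hc⟩ := (Submodule.mem_span_range_iff_exists_fun ℂ).1 hw
  rw [← hc]
  refine Finset.sum_congr rfl fun k _ => ?_
  congr 1
  simp only [translateMat, of_apply]
  rw [← hc, map_sum]
  simp only [map_smul]
  exact (hon.inner_right_fintype c k).symm

lemma translateMat_one (hon : Orthonormal ℂ (fun i => toLTwo (w i))) :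
    translateMat w 1 = 1 := by
  ext k l
  have : translate 1 (w l) = w l := by ext; simp
  rw [translateMat, of_apply, this, orthonormal_iff_ite.1 hon k l, Matrix.one_apply]

lemma linearCombination_mulVec (hr : ∀ h i, translate h (w i) = ∑ k, translateMat w h k i • w k)
    (h : G) (v : Fin n → ℂ) : Fintype.linearCombination ℂ w (translateMat w h *ᵥ v) =
      translate h (Fintype.linearCombination ℂ w v) := by
  simp only [Fintype.linearCombination_apply, map_sum, map_smul, Matrix.mulVec, dotProduct]
  simp only [hr, Finset.smul_sum, Finset.sum_smul, smul_smul]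
  rw [Finset.sum_comm]
  simp only [mul_comm]

lemma translateMat_mul (hon : Orthonormal ℂ (fun i => toLTwo (w i)))
    (hr : ∀ h i, translate h (w i) = ∑ k, translateMat w h k i • w k)
    (g h : G) : translateMat w (g * h) = translateMat w g * translateMat w h := by
  refine Matrix.ext_of_mulVec_single fun l => sum_smul_injective hon ?_
  rw [← Matrix.mulVec_mulVec, linearCombination_mulVec hr, linearCombination_mulVec hr,
    linearCombination_mulVec hr, translate_mul]

lemma translateMat_mem_unitaryGroup (hon : Orthonormal ℂ (fun i => toLTwo (w i)))
    (hr : ∀ h i, translate h (w i) = ∑ k, translateMat w h k i • w k) (h : G) :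
    translateMat w h ∈ unitaryGroup (Fin n) ℂ := by
  rw [mem_unitaryGroup_iff']
  ext k l
  have h1 : ⟪toLTwo (translate h (w k)), toLTwo (translate h (w l))⟫_ℂ = if k = l then 1 else 0 :=
    (inner_translate h _ _).trans (orthonormal_iff_ite.1 hon k l)
  rw [hr, hr, map_sum, map_sum] at h1
  simp only [map_smul] at h1
  rw [hon.inner_sum] at h1
  simpa [Matrix.mul_apply, star_eq_conjTranspose, conjTranspose_apply, Matrix.one_apply] using h1

end Minimal

/-- A minimal finite-dimensional translation invariant space of continuous functions has an
orthonormal basis, on which translation acts by an irreducible representation. -/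
lemma exists_irrRep_of_minimal (W : Submodule ℂ C(G, ℂ)) [FiniteDimensional ℂ W]
    (hW : W ≠ ⊥) (hinv : ∀ h, ∀ f ∈ W, translate h f ∈ W)
    (hmin : ∀ W' ≤ W, (∀ h, ∀ f ∈ W', translate h f ∈ W') → W' = ⊥ ∨ W' = W) :
    ∃ (π : IrrRep G) (w : Fin π.dim → C(G, ℂ)), (∀ i, w i ∈ W) ∧ (∀ i, w i ≠ 0) ∧
      ∀ h i, translate h (w i) = ∑ k, π.mat h k i • w k := by
  obtain ⟨n, w, hwW, hon, hspan⟩ := exists_orthonormal_basis W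
  have hr h i := translate_eq_sum hon h i (hspan (hinv h _ (hwW i)))
  have hinj := sum_smul_injective hon
  have hn : 0 < n := by
    rcases Nat.eq_zero_or_pos n with rfl | h
    · exact absurd (by simpa using hspan) hW
    · exact h
  have hmem : ∀ v, Fintype.linearCombination ℂ w v ∈ W := fun v => by
    rw [Fintype.linearCombination_apply]
    exact sum_mem fun k _ => Submodule.smul_mem _ _ (hwW k)
  refine ⟨⟨n, hn, ⟨⟨fun h => ⟨translateMat w h, translateMat_mem_unitaryGroup hon hr h⟩,
    Subtype.ext (translateMat_one hon)⟩, fun g h => Subtype.ext (translateMat_mul hon hr g h)⟩,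
    (continuous_translateMat w).subtype_mk _, fun U hU => ?_⟩, w, hwW, fun i hi => ?_, hr⟩
  · have h1 : U.map (Fintype.linearCombination ℂ w) ≤ W := by
      rintro _ ⟨v, -, rfl⟩
      exact hmem v
    have h2 : ∀ h, ∀ f ∈ U.map (Fintype.linearCombination ℂ w),
        translate h f ∈ U.map (Fintype.linearCombination ℂ w) := by
      rintro h _ ⟨v, hv, rfl⟩
      exact ⟨_, hU h v hv, linearCombination_mulVec hr h v⟩
    rcases hmin _ h1 h2 with h | h
    · left
      exact Submodule.map_injective_of_injective hinj (by rw [h, Submodule.map_bot])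
    · refine .inr (eq_top_iff.2 fun v _ => ?_)
      have : Fintype.linearCombination ℂ w v ∈ U.map (Fintype.linearCombination ℂ w) :=
        h ▸ hmem v
      obtain ⟨v', hv', h'⟩ := this
      exact hinj h' ▸ hv'
  · simpa [hi] using hon.1 i

end PeterWeyl

section PeterWeyl

open scoped InnerProductSpace

variable {G : Type*} [Group G] [TopologicalSpace G] [IsTopologicalGroup G] [CompactSpace G]
  [MeasurableSpace G] [BorelSpace G]

/-- Translation preserves inner products, and each conjugated coefficient is itself a translate of
an element of the coefficient span. -/
lemma translate_mem_orthogonal (h : G) (f : C(G, ℂ)) (hf : toLTwo f ∈ (coeffSpan G)ᗮ) :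
    toLTwo (translate h f) ∈ (coeffSpan G)ᗮ := by
  rw [coeffSpan, Submodule.mem_orthogonal] at hf ⊢
  intro m hm
  induction hm using Submodule.span_induction with
  | mem f hf =>
    obtain ⟨π, i, j, rfl⟩ := hf
    have h1 : conjCoeff π i j = translate h
        (∑ l, star (π.mat h i l) • conjCoeff π l j) := by
      ext x
      simp only [conjCoeff, ContinuousMap.coe_mk, translate_apply, ContinuousMap.coe_sum,
        Finset.sum_apply, ContinuousMap.coe_smul, Pi.smul_apply, smul_eq_mul]
      simp only [← star_mul', ← star_sum, ← Matrix.mul_apply, ← mat_mul, mul_inv_cancel_left]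
    rw [h1, inner_translate]
    refine hf _ ?_
    rw [map_sum]
    simp only [map_smul]
    exact sum_mem fun l _ => Submodule.smul_mem _ _ (Submodule.subset_span ⟨π, l, j, rfl⟩)
  | zero => simp
  | add f g _ _ hf hg => rw [inner_add_left, hf, hg, add_zero]
  | smul c f _ hf => rw [inner_smul_left, hf, mul_zero]

variable [T2Space G]

/-- A symmetric convolution operator vanishes on the orthogonal complement of the matrix
coefficients. -/
lemma conv_eq_zero_of_mem_orthogonal (k : C(G, ℂ)) (hk : ∀ g, star (k g) = k g⁻¹) {f : LTwo G}
    (hf : f ∈ (coeffSpan G)ᗮ) : conv k f = 0 := by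
  let N := (coeffSpan G)ᗮ
  have hN : ∀ f ∈ N, conv k f ∈ N := fun f hf => conv_mem_orthogonal k hk hf
  let S : N →L[ℂ] N := (conv k).restrict hN
  have hScomp : IsCompactOperator S := (isCompactOperator_conv k).restrict' hN
  have hSsymm : S.IsSymmetric := (isSymmetric_conv k hk).restrict_invariant hN
  suffices S = 0 by
    have h := congrArg (fun T : N →L[ℂ] N => ((T ⟨f, hf⟩ : N) : LTwo G)) this
    simpa [S] using h
  rw [← ContinuousLinearMap.eq_zero_of_forall_hasEigenvalue_eq_zero hScomp hSsymm]
  intro c hc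
  by_contra hc0
  obtain ⟨v, hv⟩ := hc.exists_hasEigenvector
  have hv1 : conv k (v : LTwo G) = c • (v : LTwo G) := congrArg Subtype.val hv.apply_eq_smul
  have hfin := ContinuousLinearMap.finite_dimensional_eigenspace (isCompactOperator_conv k) c hc0
  -- The eigenspace is realised by continuous functions: for c ≠ 0 an eigenvector is c⁻¹ times its
  -- own convolution, and that is continuous. Compactness makes E finite-dimensional, and E is
  -- translation invariant, so it contains a minimal invariant subspace.
  let E : Submodule ℂ C(G, ℂ) := N.comap (toLTwo : C(G, ℂ) →L[ℂ] LTwo G).toLinearMap ⊓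
    LinearMap.ker ((convC k ∘L toLTwo - c • ContinuousLinearMap.id ℂ _ :
      C(G, ℂ) →L[ℂ] C(G, ℂ)) : C(G, ℂ) →ₗ[ℂ] C(G, ℂ))
  have hE : ∀ f, f ∈ E ↔ toLTwo f ∈ N ∧ convC k (toLTwo f) = c • f := fun f => by
    simp [E, sub_eq_zero]
  have hEfin : FiniteDimensional ℂ E := by
    have hE1 : ∀ f : E, toLTwo (f : C(G, ℂ)) ∈ Module.End.eigenspace (conv k).toLinearMap c := by
      intro f
      rw [Module.End.mem_eigenspace_iff]
      have := ((hE f).1 f.2).2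
      simp [conv, this]
    refine Module.Finite.of_injective (LinearMap.codRestrict _
      ((toLTwo : C(G, ℂ) →L[ℂ] LTwo G).toLinearMap ∘ₗ E.subtype) hE1) ?_
    intro f g hfg
    exact Subtype.ext (toLTwo_injective (congrArg Subtype.val hfg))
  have hEne : E ≠ ⊥ := by
    have h1 : toLTwo (c⁻¹ • convC k (v : LTwo G)) = (v : LTwo G) := by
      rw [map_smul, ← ContinuousLinearMap.comp_apply, ← conv, hv1, smul_smul,
        inv_mul_cancel₀ hc0, one_smul]
    refine (Submodule.ne_bot_iff _).2 ⟨c⁻¹ • convC k (v : LTwo G), (hE _).2 ⟨?_, ?_⟩, fun h => ?_⟩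
    · rw [h1]; exact v.2
    · rw [h1, smul_smul, mul_inv_cancel₀ hc0, one_smul]
    · rw [h, map_zero] at h1
      exact hv.2 (Subtype.ext h1.symm)
  obtain ⟨W, hWE, hW, hinv, hmin⟩ := exists_minimal_submodule E
    (fun W => ∀ h, ∀ f ∈ W, translate h f ∈ W) (fun h f hf => by
      rw [hE] at hf ⊢
      exact ⟨translate_mem_orthogonal h f hf.1, by rw [convC_translate, hf.2, map_smul]⟩) hEne
  have := Submodule.finiteDimensional_of_le hWE
  obtain ⟨π, w, hwW, hw0, hw⟩ := exists_irrRep_of_minimal W hW hinv hmin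
  let i : Fin π.dim := ⟨0, π.dim_pos⟩
  -- The value w_i(h) is the value at 1 of the translate of w_i by h⁻¹. So w_i is a combination of
  -- matrix coefficients, yet it is orthogonal to all of them.
  have h1 : w i = ∑ l, w l 1 • conjCoeff π i l := by
    ext h
    have := congrArg (fun f : C(G, ℂ) => f 1) (hw h⁻¹ i)
    simp only [translate_apply, inv_inv, mul_one, ContinuousMap.coe_sum, Finset.sum_apply,
      ContinuousMap.coe_smul, Pi.smul_apply, smul_eq_mul, mat_inv, conjTranspose_apply] at this ⊢
    rw [this]
    exact Finset.sum_congr rfl fun l _ => mul_comm _ _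
  have h2 : toLTwo (w i) ∈ coeffSpan G := by
    rw [h1, map_sum]
    simp only [map_smul]
    exact sum_mem fun l _ => Submodule.smul_mem _ _ (Submodule.subset_span ⟨π, i, l, rfl⟩)
  have h3 : ⟪toLTwo (w i), toLTwo (w i)⟫_ℂ = 0 :=
    (Submodule.mem_orthogonal _ _).1 ((hE _).1 (hWE (hwW i))).1 _ h2
  exact hw0 i (toLTwo_injective (by rw [inner_self_eq_zero.1 h3, map_zero]))

/-- There are symmetric kernels which detect the value of a continuous function at `1`. -/
lemma exists_symmetric_kernel (f : C(G, ℂ)) (hf : f 1 ≠ 0) :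
    ∃ k : C(G, ℂ), (∀ g, star (k g) = k g⁻¹) ∧ ∫ y, k y * f y ∂(haar G) ≠ 0 := by
  -- p is positive near 1. The kernel is a Urysohn bump supported where both p(y) and p(y⁻¹) are
  -- positive, symmetrised under y ↦ y⁻¹; being real, it satisfies the required symmetry.
  let p : G → ℝ := fun y => (star (f 1) * f y).re
  have hp : Continuous p := by fun_prop
  have hp1 : 0 < p 1 := by
    simp only [p, RCLike.star_def, ← Complex.normSq_eq_conj_mul_self, Complex.ofReal_re]
    exact Complex.normSq_pos.2 hf
  let U : Set G := {y | 0 < p y} ∩ {y | 0 < p y⁻¹}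
  have hU : IsOpen U := (isOpen_lt continuous_const hp).inter
    (isOpen_lt continuous_const (hp.comp continuous_inv))
  obtain ⟨u, hu0, hu1, hu⟩ := exists_continuous_zero_one_of_isClosed (X := G) hU.isClosed_compl
    (isClosed_singleton (x := (1 : G))) (by
      rw [Set.disjoint_singleton_right, Set.mem_compl_iff, not_not]
      exact ⟨hp1, by simpa using hp1⟩)
  have hu1' : u 1 = 1 := hu1 rfl
  let q : G → ℝ := fun y => u y + u y⁻¹
  have hq : Continuous q := by fun_prop
  have hpos : 0 < ∫ y, q y * p y ∂(haar G) := by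
    refine Continuous.integral_pos_of_hasCompactSupport_nonneg_nonzero (x := 1) (hq.mul hp)
      (HasCompactSupport.of_compactSpace _) (fun y => ?_) ?_
    · by_cases hy : y ∈ U
      · exact mul_nonneg (add_nonneg (hu _).1 (hu _).1) hy.1.le
      · have hy' : y⁻¹ ∉ U := fun h => hy ⟨by simpa using h.2, h.1⟩
        have e1 : u y = 0 := hu0 hy
        have e2 : u y⁻¹ = 0 := hu0 hy'
        simp [q, e1, e2]
    · simp only [q, inv_one, hu1']
      positivity
  refine ⟨⟨fun y => (q y : ℂ), by fun_prop⟩, fun g => ?_, fun h => ?_⟩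
  · simp [q, add_comm]
  · have h1 : ∫ y, (star (f 1) * ((q y : ℂ) * f y)) ∂(haar G) = 0 := by
      rw [integral_const_mul]
      simpa using Or.inr h
    have h2 := congrArg Complex.re h1
    rw [← RCLike.re_eq_complex_re, ← integral_re] at h2
    · refine hpos.ne' (Eq.trans (integral_congr_ae (.of_forall fun y => ?_)) h2)
      simp only [p, RCLike.re_eq_complex_re]
      rw [mul_left_comm, Complex.re_ofReal_mul]
    · exact integrable_of_continuous (by fun_prop)

/-- The conjugate of f is orthogonal to all conjugated coefficients, so every symmetric convolution
kills it. If f(1) ≠ 0, some symmetric kernel gives a convolution with non-zero value at 1. -/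
lemma eq_zero_of_integral_conjCoeff (f : G → ℂ) (hf : Continuous f)
    (h : ∀ (π : IrrRep G) (i j : Fin π.dim), ∫ g, star (π.mat g i j) * f g ∂(haar G) = 0) :
    f 1 = 0 := by
  by_contra hne
  let F : C(G, ℂ) := ⟨fun g => star (f g), hf.star⟩
  have hF : toLTwo F ∈ (coeffSpan G)ᗮ := by
    rw [coeffSpan, Submodule.mem_orthogonal]
    intro m hm
    induction hm using Submodule.span_induction with
    | mem m hm =>
      obtain ⟨π, i, j, rfl⟩ := hm
      rw [inner_toLTwo, ← star_eq_zero, RCLike.star_def, ← integral_conj, ← h π i j]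
      simp [conjCoeff, F]
    | zero => simp
    | add f g _ _ hf hg => rw [inner_add_left, hf, hg, add_zero]
    | smul c f _ hf => rw [inner_smul_left, hf, mul_zero]
  obtain ⟨k, hk, hkF⟩ := exists_symmetric_kernel F (by simpa [F] using hne)
  have h1 := conv_eq_zero_of_mem_orthogonal k hk hF
  have h2 : convC k (toLTwo F) = 0 := toLTwo_injective (by rw [map_zero]; exact h1)
  apply hkF
  have h3 := convC_toLTwo k F 1
  rw [h2] at h3
  simpa using h3.symm

/-- The weak form of the Peter-Weyl theorem: a continuous function which is orthogonal to the
matrix coefficients of all irreducible representations vanishes at `1`. -/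
lemma eq_zero_of_integral_dualSet (f : G → ℂ) (hf : Continuous f)
    (h : ∀ (c : DualSet G) (i j : Fin c.rep.dim),
      ∫ g, star (c.rep.mat g i j) * f g ∂(haar G) = 0) : f 1 = 0 := by
  refine eq_zero_of_integral_conjCoeff f hf fun π i j => ?_
  -- The coefficients of π are linear combinations of those of the chosen representative of its
  -- class.
  let c : DualSet G := Quotient.mk _ π
  obtain ⟨U, hU1, hU2, hU⟩ : IrrRep.UnitarilyEquiv π c.rep :=
    Setoid.symm (Quotient.exact (Quotient.out_eq c))
  have h1 : ∀ g, π.mat g = Uᴴ * c.rep.mat g * U := fun g => by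
    rw [Matrix.mul_assoc, ← hU, ← Matrix.mul_assoc, hU1, Matrix.one_mul]
  have h2 : ∀ g, star (π.mat g i j) * f g =
      ∑ l, ∑ k, star (Uᴴ i k * U l j) * (star (c.rep.mat g k l) * f g) := fun g => by
    rw [h1, Matrix.mul_apply, star_sum, Finset.sum_mul]
    refine Finset.sum_congr rfl fun l _ => ?_
    rw [Matrix.mul_apply, Finset.sum_mul, star_sum, Finset.sum_mul]
    refine Finset.sum_congr rfl fun k _ => ?_
    simp only [star_mul']
    ring
  have h3 := continuous_mat c.rep
  simp only [h2]
  rw [integral_finsetSum]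
  · refine Finset.sum_eq_zero fun l _ => ?_
    rw [integral_finsetSum]
    · exact Finset.sum_eq_zero fun k _ => by rw [integral_const_mul, h, mul_zero]
    · exact fun k _ => integrable_of_continuous (by have := h3 k l; fun_prop)
  · exact fun l _ => integrable_of_continuous (by
      refine continuous_finsetSum _ fun k _ => ?_
      have := h3 k l
      fun_prop)

end PeterWeyl

/-! ### Schur's lemma and orthogonality relations. -/

section Schur

variable {G : Type*} [Group G] [TopologicalSpace G]

/-- **Schur's lemma**. -/
lemma IrrRep.eq_smul_one_of_commute (π : IrrRep G) (M : Matrix (Fin π.dim) (Fin π.dim) ℂ)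
    (hM : ∀ g, M * π.mat g = π.mat g * M) : ∃ c : ℂ, M = c • (1 : Matrix _ _ ℂ) := by
  have : Nonempty (Fin π.dim) := ⟨⟨0, π.dim_pos⟩⟩
  obtain ⟨c, hc⟩ := Module.End.exists_eigenvalue (Matrix.toLin' M)
  refine ⟨c, ?_⟩
  have h := π.irreducible (Module.End.eigenspace (Matrix.toLin' M) c) (fun g w hw => by
    rw [Module.End.mem_eigenspace_iff, toLin'_apply] at hw ⊢
    change M *ᵥ (π.mat g *ᵥ w) = c • (π.mat g *ᵥ w)
    rw [mulVec_mulVec, hM, ← mulVec_mulVec, hw, mulVec_smul])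
  have htop := h.resolve_left hc
  refine Matrix.toLin'.injective (LinearMap.ext fun v => ?_)
  have hv : v ∈ Module.End.eigenspace (Matrix.toLin' M) c := htop ▸ Submodule.mem_top
  rw [Module.End.mem_eigenspace_iff] at hv
  rw [hv]
  simp

variable [IsTopologicalGroup G] [CompactSpace G] [MeasurableSpace G] [BorelSpace G]

/-- The Schur orthogonality relations for a single representation. -/
lemma integral_star_mat_mul_mat (π : IrrRep G) (i j k l : Fin π.dim) :
    (π.dim : ℂ) * ∫ g, star (π.mat g i j) * π.mat g k l ∂(haar G) =
      if i = k ∧ j = l then 1 else 0 := by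
  -- With j and l fixed, invariance of Haar measure makes M commute with π, so M is a scalar c. Its
  -- trace, computed from unitarity, determines c.
  let M : Matrix (Fin π.dim) (Fin π.dim) ℂ :=
    of fun k i => ∫ g, star (π.mat g i j) * π.mat g k l ∂(haar G)
  have hMa : ∀ k i, M k i = ∫ g, star (π.mat g i j) * π.mat g k l ∂(haar G) := fun _ _ => rfl
  have hcont := continuous_mat π
  have hint : ∀ p q r s, Integrable (fun g => star (π.mat g p q) * π.mat g r s) (haar G) :=
    fun p q r s => integrable_of_continuous (by
      have := hcont p q
      have := hcont r s
      fun_prop)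
  have hM : ∀ h, M * π.mat h = π.mat h * M := by
    intro h
    have h1 : π.mat h * M * (π.mat h)ᴴ = M := by
      ext p q
      have hi : ∀ s r, Integrable (fun g => π.mat h p r * (star (π.mat g s j) * π.mat g r l) *
          star (π.mat h q s)) (haar G) := fun s r => ((hint s j r l).const_mul _).mul_const _
      have h2 : M p q = ∫ g, ∑ s, ∑ r, π.mat h p r * (star (π.mat g s j) * π.mat g r l) *
          star (π.mat h q s) ∂(haar G) := by
        rw [hMa, ← integral_mul_left_eq_self _ h]
        refine integral_congr_ae (.of_forall fun g => ?_)
        simp only [mat_mul, Matrix.mul_apply, star_sum, star_mul', Finset.sum_mul, Finset.mul_sum]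
        rw [Finset.sum_comm]
        exact Finset.sum_congr rfl fun s _ => Finset.sum_congr rfl fun r _ => by ring
      rw [h2, integral_finsetSum _ fun s _ => integrable_finsetSum _ fun r _ => hi s r,
        Matrix.mul_apply]
      refine Finset.sum_congr rfl fun s _ => ?_
      rw [integral_finsetSum _ fun r _ => hi s r, Matrix.mul_apply, Finset.sum_mul]
      refine Finset.sum_congr rfl fun r _ => ?_
      rw [integral_mul_const, integral_const_mul, hMa, conjTranspose_apply]
    conv_lhs => rw [← h1]
    rw [Matrix.mul_assoc, mat_conjTranspose_mul, Matrix.mul_one]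
  obtain ⟨c, hc⟩ := π.eq_smul_one_of_commute M hM
  have htr : (π.dim : ℂ) * c = if j = l then 1 else 0 := by
    have h1 : M.trace = (π.dim : ℂ) * c := by simp [hc, mul_comm]
    rw [← h1, Matrix.trace]
    simp only [diag_apply, M, of_apply]
    rw [← integral_finsetSum _ fun r _ => hint r j r l]
    simp only [sum_star_mat_mul_mat]
    simp
  have h3 : ∫ g, star (π.mat g i j) * π.mat g k l ∂(haar G) = c * if i = k then 1 else 0 := by
    have : M k i = _ := congrFun (congrFun hc k) i
    simpa [M, Matrix.one_apply, eq_comm] using this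
  rw [h3, ← mul_assoc, htr]
  split_ifs <;> simp_all

end Schur

/-! ### Weak closures described by annihilating functionals. -/

section WeakClosure

variable {V W U : Type*} [AddCommGroup V] [Module ℂ V] [AddCommGroup W] [Module ℂ W]
  [AddCommGroup U] [Module ℂ U]

/-- The closure of a subspace in the weak topology given by a space `D` of functionals. -/
def wcl (D : Submodule ℂ (V →ₗ[ℂ] ℂ)) (S : Submodule ℂ V) : Submodule ℂ V where
  carrier := {v | ∀ φ ∈ D, (∀ s ∈ S, φ s = 0) → φ v = 0}
  add_mem' ha hb φ hφ h := by rw [map_add, ha φ hφ h, hb φ hφ h, add_zero]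
  zero_mem' φ _ _ := map_zero φ
  smul_mem' c v hv φ hφ h := by rw [map_smul, hv φ hφ h, smul_zero]

lemma le_wcl (D : Submodule ℂ (V →ₗ[ℂ] ℂ)) (S : Submodule ℂ V) : S ≤ wcl D S :=
  fun _ hs _ _ h => h _ hs

lemma wcl_le_wcl {D : Submodule ℂ (V →ₗ[ℂ] ℂ)} {S T : Submodule ℂ V} (h : S ≤ wcl D T) :
    wcl D S ≤ wcl D T :=
  fun _ hv φ hφ hT => hv φ hφ fun _ hs => h hs φ hφ hT

lemma wcl_idem (D : Submodule ℂ (V →ₗ[ℂ] ℂ)) (S : Submodule ℂ V) :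
    wcl D (wcl D S) ≤ wcl D S := wcl_le_wcl le_rfl

/-- The closure of a subspace in an initial topology given by linear functionals. -/
lemma closure_induced_eq_wcl {ι : Type*} (f : ι → V →ₗ[ℂ] ℂ) (S : Submodule ℂ V) :
    closure[TopologicalSpace.induced (fun v i => f i v) inferInstance] (S : Set V) =
      wcl (Submodule.span ℂ (Set.range f)) S := by
  let _ : TopologicalSpace V := TopologicalSpace.induced (fun v i => f i v) inferInstance
  have hc : Continuous (fun v i => f i v) := continuous_induced_dom
  refine subset_antisymm ?_ ?_
  · intro v hv φ hφ hS
    have hφc : Continuous φ := by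
      clear hS
      induction hφ using Submodule.span_induction with
      | mem φ h => obtain ⟨i, rfl⟩ := h; exact (continuous_apply i).comp hc
      | zero => exact continuous_const
      | add φ ψ _ _ h1 h2 => exact h1.add h2
      | smul c φ _ h => exact h.const_smul c
    exact closure_minimal (t := {v | φ v = 0}) hS (isClosed_eq hφc continuous_const) hv
  · intro v hv
    rw [mem_closure_iff]
    rintro o ho hvo
    obtain ⟨o', ho', rfl⟩ := isOpen_induced_iff.1 ho
    obtain ⟨I, u, hu, hIu⟩ := isOpen_pi_iff.1 ho' _ hvo
    classical
    -- A basic neighbourhood of v involves only finitely many functionals. If it misses S, then Φ v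
    -- is outside the subspace Φ(S) of a finite-dimensional space, and a linear functional separates
    -- them.
    let Φ : V →ₗ[ℂ] (I → ℂ) := LinearMap.pi fun i => f i
    by_contra hcon
    have hΦ : Φ v ∉ S.map Φ := by
      rintro ⟨s, hs, hsv⟩
      refine hcon ⟨s, hIu fun i hi => ?_, hs⟩
      have : f i s = f i v := congrFun hsv ⟨i, hi⟩
      change f i s ∈ u i
      rw [this]
      exact (hu i hi).2
    obtain ⟨l, hl, hker⟩ := Submodule.exists_le_ker_of_notMem hΦ
    refine hl (hv (l ∘ₗ Φ) ?_ fun s hs => hker (Submodule.mem_map_of_mem hs))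
    have : l ∘ₗ Φ = ∑ i, l (Pi.single i 1) • f i := by
      ext w
      rw [LinearMap.comp_apply, LinearMap.pi_apply_eq_sum_univ]
      simp only [LinearMap.sum_apply, LinearMap.smul_apply, smul_eq_mul, Φ, LinearMap.pi_apply]
      refine Finset.sum_congr rfl fun i _ => ?_
      rw [mul_comm]
      congr 2
      ext j
      simp [Pi.single_apply, eq_comm]
    rw [this]
    exact sum_mem fun i _ => Submodule.smul_mem _ _ (Submodule.subset_span ⟨i, rfl⟩)

/-- `T` pulls back the functionals of `E` to functionals of `D`. -/
def WeakCont (D : Submodule ℂ (V →ₗ[ℂ] ℂ)) (E : Submodule ℂ (W →ₗ[ℂ] ℂ)) (T : V → W) : Prop :=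
  ∀ φ ∈ E, ∃ ψ ∈ D, ∀ v, ψ v = φ (T v)

variable {D : Submodule ℂ (V →ₗ[ℂ] ℂ)} {E : Submodule ℂ (W →ₗ[ℂ] ℂ)}
  {D' : Submodule ℂ (U →ₗ[ℂ] ℂ)} {T : V → W}

lemma WeakCont.map_mem (hT : WeakCont D E T) {S : Submodule ℂ V} {R : Submodule ℂ W}
    (h : ∀ s ∈ S, T s ∈ wcl E R) {v : V} (hv : v ∈ wcl D S) : T v ∈ wcl E R := by
  intro φ hφ hR
  obtain ⟨ψ, hψ, hψT⟩ := hT φ hφ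
  rw [← hψT]
  exact hv ψ hψ fun s hs => by rw [hψT]; exact h s hs φ hφ hR

lemma WeakCont.comp {T' : U → V} (hT : WeakCont D E T) (hT' : WeakCont D' D T') :
    WeakCont D' E (fun u => T (T' u)) := by
  intro φ hφ
  obtain ⟨ψ, hψ, h⟩ := hT φ hφ
  obtain ⟨χ, hχ, h'⟩ := hT' ψ hψ
  exact ⟨χ, hχ, fun u => by rw [h', h]⟩

lemma weakCont_id : WeakCont D D (fun v => v) := fun φ hφ => ⟨φ, hφ, fun _ => rfl⟩

lemma WeakCont.sum {ι : Type*} {s : Finset ι} {T : ι → V → W}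
    (h : ∀ i ∈ s, WeakCont D E (T i)) : WeakCont D E (fun v => ∑ i ∈ s, T i v) := by
  intro φ hφ
  choose! ψ hψ hψT using fun i hi => h i hi φ hφ
  refine ⟨∑ i ∈ s, ψ i, sum_mem hψ, fun v => ?_⟩
  rw [map_sum, LinearMap.sum_apply]
  exact Finset.sum_congr rfl fun i hi => hψT i hi v

lemma WeakCont.smul (c : ℂ) (hT : WeakCont D E T) : WeakCont D E (fun v => c • T v) := by
  intro φ hφ
  obtain ⟨ψ, hψ, h⟩ := hT φ hφ
  exact ⟨c • ψ, Submodule.smul_mem _ _ hψ, fun v => by simp [h]⟩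

lemma WeakCont.of_range {ι : Type*} {f : ι → W →ₗ[ℂ] ℂ}
    (h : ∀ i, ∃ ψ ∈ D, ∀ v, ψ v = f i (T v)) :
    WeakCont D (Submodule.span ℂ (Set.range f)) T := by
  intro φ hφ
  induction hφ using Submodule.span_induction with
  | mem φ hφ => obtain ⟨i, rfl⟩ := hφ; exact h i
  | zero => exact ⟨0, zero_mem _, fun _ => rfl⟩
  | add φ χ _ _ h1 h2 =>
    obtain ⟨ψ, hψ, h1⟩ := h1
    obtain ⟨ψ', hψ', h2⟩ := h2
    exact ⟨ψ + ψ', add_mem hψ hψ', fun v => by simp [h1, h2]⟩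
  | smul c φ _ h =>
    obtain ⟨ψ, hψ, h⟩ := h
    exact ⟨c • ψ, Submodule.smul_mem _ _ hψ, fun v => by simp [h]⟩

end WeakClosure

/-! ### The functionals of F and of F ⊗ B(ℂⁿ)*, and their continuity properties. -/

section Functionals

variable {X : Type*} [NonUnitalCStarAlgebra X] (F : Submodule ℂ (StrongDual ℂ X))

/-- The elements of `F` as linear functionals. -/
def xDual : Submodule ℂ (X →ₗ[ℂ] ℂ) :=
  Submodule.span ℂ (Set.range fun φ : F => (φ.1 : X →ₗ[ℂ] ℂ))

/-- The elements of `F ⊗ B(ℂⁿ)*` as linear functionals. -/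
def matDual (n : ℕ) : Submodule ℂ (Matrix (Fin n) (Fin n) X →ₗ[ℂ] ℂ) :=
  Submodule.span ℂ (Set.range fun p : Fin n × Fin n × F =>
    (p.2.2.1 : X →ₗ[ℂ] ℂ) ∘ₗ Matrix.entryLinearMap ℂ X p.1 p.2.1)

variable {F}

lemma mem_xDual {ψ : X →ₗ[ℂ] ℂ} : ψ ∈ xDual F ↔ ∃ φ ∈ F, ∀ x, φ x = ψ x := by
  constructor
  · intro h
    induction h using Submodule.span_induction with
    | mem φ h => obtain ⟨φ, rfl⟩ := h; exact ⟨φ.1, φ.2, fun _ => rfl⟩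
    | zero => exact ⟨0, zero_mem _, fun _ => rfl⟩
    | add φ χ _ _ h1 h2 =>
      obtain ⟨ψ, hψ, h1⟩ := h1
      obtain ⟨ψ', hψ', h2⟩ := h2
      exact ⟨ψ + ψ', add_mem hψ hψ', fun v => by simp [h1, h2]⟩
    | smul c φ _ h =>
      obtain ⟨ψ, hψ, h⟩ := h
      exact ⟨c • ψ, Submodule.smul_mem _ _ hψ, fun v => by simp [h]⟩
  · rintro ⟨φ, hφ, h⟩
    exact Submodule.subset_span ⟨⟨φ, hφ⟩, LinearMap.ext h⟩

lemma coe_mem_xDual {φ : StrongDual ℂ X} (hφ : φ ∈ F) : (φ : X →ₗ[ℂ] ℂ) ∈ xDual F :=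
  mem_xDual.2 ⟨φ, hφ, fun _ => rfl⟩

lemma mem_wcl_xDual {S : Submodule ℂ X} {x : X} :
    x ∈ wcl (xDual F) S ↔ ∀ φ ∈ F, (∀ s ∈ S, φ s = 0) → φ x = 0 := by
  refine ⟨fun h φ hφ hS => h φ (coe_mem_xDual hφ) hS, fun h φ hφ hS => ?_⟩
  obtain ⟨ψ, hψ, hψφ⟩ := mem_xDual.1 hφ
  rw [← hψφ]
  exact h ψ hψ fun s hs => (hψφ s).trans (hS s hs)

lemma closure_fTopology (S : Submodule ℂ X) :
    closure[fTopology F] (S : Set X) = wcl (xDual F) S :=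
  closure_induced_eq_wcl (fun φ : F => (φ.1 : X →ₗ[ℂ] ℂ)) S

lemma closure_matTopology {n : ℕ} (S : Submodule ℂ (Matrix (Fin n) (Fin n) X)) :
    closure[matTopology F n] (S : Set (Matrix (Fin n) (Fin n) X)) = wcl (matDual F n) S :=
  closure_induced_eq_wcl (fun p : Fin n × Fin n × F =>
    (p.2.2.1 : X →ₗ[ℂ] ℂ) ∘ₗ Matrix.entryLinearMap ℂ X p.1 p.2.1) S

lemma isClosed_fTopology_iff (S : Submodule ℂ X) :
    IsClosed[fTopology F] (S : Set X) ↔ wcl (xDual F) S ≤ S := by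
  rw [← @closure_subset_iff_isClosed _ (fTopology F), closure_fTopology]
  rfl

lemma weakCont_entry {n : ℕ} (i j : Fin n) :
    WeakCont (matDual F n) (xDual F) (fun a : Matrix (Fin n) (Fin n) X => a i j) :=
  WeakCont.of_range fun φ => ⟨_, Submodule.subset_span ⟨(i, j, φ), rfl⟩, fun _ => rfl⟩

lemma WeakCont.of_entries {V : Type*} [AddCommGroup V] [Module ℂ V]
    {D : Submodule ℂ (V →ₗ[ℂ] ℂ)} {n : ℕ} {T : V → Matrix (Fin n) (Fin n) X}
    (h : ∀ i j, WeakCont D (xDual F) (fun v => T v i j)) : WeakCont D (matDual F n) T :=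
  WeakCont.of_range fun p => h p.1 p.2.1 _ (coe_mem_xDual p.2.2.2)

/-- An `F`-continuous linear map is weakly continuous. -/
lemma weakCont_of_continuous (T : X →ₗ[ℂ] X) (hT : Continuous[fTopology F, fTopology F] T) :
    WeakCont (xDual F) (xDual F) T := by
  refine WeakCont.of_range fun φ => ⟨(φ.1 : X →ₗ[ℂ] ℂ) ∘ₗ T, ?_, fun _ => rfl⟩
  -- A linear functional lies in the span of a family exactly when it is continuous for the initial
  -- topology of that family.
  rw [xDual, LinearMap.mem_span_iff_continuous]
  have h1 : (⨅ φ : F, TopologicalSpace.induced (φ.1 : X →ₗ[ℂ] ℂ) inferInstance) = fTopology F :=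
    (induced_to_pi (fun x (φ : F) => φ.1 x)).symm
  rw [h1]
  have h2 : Continuous[fTopology F, inferInstance] (φ.1 : X → ℂ) := by
    let _ := fTopology F
    exact (continuous_apply φ).comp (continuous_induced_dom (f := fun x (φ : F) => φ.1 x))
  let _ := fTopology F
  exact h2.comp hT

lemma mem_wcl_of_norm_approx {S : Submodule ℂ X} {x : X}
    (h : ∀ ε > 0, ∃ s ∈ S, ‖x - s‖ ≤ ε) : x ∈ wcl (xDual F) S := by
  rw [mem_wcl_xDual]
  intro φ _ hS
  have : x ∈ closure (S : Set X) := Metric.mem_closure_iff.2 fun ε hε => by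
    obtain ⟨s, hs, hs'⟩ := h (ε / 2) (half_pos hε)
    exact ⟨s, hs, by rw [dist_eq_norm]; linarith⟩
  exact closure_minimal (t := {v | φ v = 0}) hS (isClosed_eq φ.continuous continuous_const) this

lemma isClosed_of_wcl_le {S : Submodule ℂ X} (h : wcl (xDual F) S ≤ S) :
    IsClosed (S : Set X) := by
  refine isClosed_of_closure_subset fun x hx => h (mem_wcl_of_norm_approx fun ε hε => ?_)
  obtain ⟨s, hs, h'⟩ := Metric.mem_closure_iff.1 hx ε hε
  exact ⟨s, hs, by rw [← dist_eq_norm]; exact h'.le⟩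

lemma mem_wcl_matDual_of_norm_approx {n : ℕ} {S : Submodule ℂ (Matrix (Fin n) (Fin n) X)}
    {a : Matrix (Fin n) (Fin n) X} (h : ∀ ε > 0, ∃ s ∈ S, ∀ i j, ‖a i j - s i j‖ ≤ ε) :
    a ∈ wcl (matDual F n) S := by
  intro φ hφ hS
  have hb : ∃ C : ℝ, ∀ δ : ℝ, ∀ b : Matrix (Fin n) (Fin n) X, (∀ i j, ‖b i j‖ ≤ δ) →
      ‖φ b‖ ≤ C * δ := by
    clear hS
    induction hφ using Submodule.span_induction with
    | mem φ h =>
      obtain ⟨p, rfl⟩ := h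
      exact ⟨‖p.2.2.1‖, fun δ b hb => (p.2.2.1.le_opNorm _).trans
        (mul_le_mul_of_nonneg_left (hb _ _) (norm_nonneg _))⟩
    | zero => exact ⟨0, fun δ b _ => by simp⟩
    | add φ χ _ _ h1 h2 =>
      obtain ⟨C, h1⟩ := h1
      obtain ⟨C', h2⟩ := h2
      exact ⟨C + C', fun δ b hb => (norm_add_le _ _).trans
        (by rw [add_mul]; exact add_le_add (h1 δ b hb) (h2 δ b hb))⟩
    | smul c φ _ h =>
      obtain ⟨C, h⟩ := h
      exact ⟨‖c‖ * C, fun δ b hb => by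
        rw [LinearMap.smul_apply, norm_smul, mul_assoc]
        exact mul_le_mul_of_nonneg_left (h δ b hb) (norm_nonneg _)⟩
  obtain ⟨C, hC⟩ := hb
  rw [← norm_le_zero_iff]
  refine le_of_forall_pos_le_add fun ε hε => ?_
  obtain ⟨s, hs, hs'⟩ := h (ε / (|C| + 1)) (by positivity)
  have h1 := hC _ (a - s) hs'
  rw [map_sub, hS s hs, sub_zero] at h1
  refine h1.trans ?_
  rw [zero_add, mul_div_assoc', div_le_iff₀ (by positivity)]
  nlinarith [le_abs_self C]

end Functionals

/-! ### Approximate units from functional calculus. -/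

section CStar

variable {X : Type*} [NonUnitalCStarAlgebra X] [PartialOrder X] [StarOrderedRing X]

/-- This is ‖(1 - u)a‖² = ‖(1 - u)aa*(1 - u)‖ ≤ ‖(1 - u)s(1 - u)‖, multiplied out because X need not
have a unit. -/
lemma norm_sub_mul_sq_le {u a s : X} (hu : IsSelfAdjoint u) (h : a * star a ≤ s) :
    ‖a - u * a‖ ^ 2 ≤ ‖s - u * s - s * u + u * s * u‖ := by
  obtain ⟨c, hc⟩ := CStarAlgebra.nonneg_iff_eq_mul_star_self.1 (sub_nonneg.2 h)
  have h1 : ∀ b : X, (b - u * b) * star (b - u * b) =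
      b * star b - u * (b * star b) - (b * star b) * u + u * (b * star b) * u := fun b => by
    rw [star_sub, star_mul, hu.star_eq]
    noncomm_ring
  rw [sq, ← CStarRing.norm_self_mul_star]
  refine CStarAlgebra.norm_le_norm_of_nonneg_of_le (mul_star_self_nonneg _) ?_
  rw [h1, ← sub_nonneg]
  have h2 : s = a * star a + c * star c := by rw [← hc]; abel
  have h3 : s - u * s - s * u + u * s * u -
      (a * star a - u * (a * star a) - (a * star a) * u + u * (a * star a) * u) =
      (c - u * c) * star (c - u * c) := by
    rw [h1, h2]
    noncomm_ring
  rw [h3]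
  exact mul_star_self_nonneg _

/-- Approximate units: elements dominated by a positive element `s` of a closed subalgebra are
approximated by their products with elements of this subalgebra. -/
lemma exists_approx_unit (S : NonUnitalStarSubalgebra ℂ X) (hS : IsClosed (S : Set X)) {s : X}
    (hs : 0 ≤ s) (hsS : s ∈ S) {ε : ℝ} (hε : 0 < ε) :
    ∃ u ∈ S, IsSelfAdjoint u ∧ ∀ a, a * star a ≤ s → ‖a - u * a‖ ≤ ε := by
  let δ := ε ^ 2
  have hδ : 0 < δ := by positivity
  -- With u = f(s), the bound is the supremum of t(1 - f(t))² = tδ²/(t + δ)² on the spectrum. It is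
  -- at most δ = ε².
  let f : ℝ → ℝ := fun t => t / (t + δ)
  have hsa : IsSelfAdjoint s := .of_nonneg hs
  have hσ : ∀ t ∈ quasispectrum ℝ s, 0 ≤ t := fun t ht => quasispectrum_nonneg_of_nonneg s hs t ht
  have hf : ContinuousOn f (quasispectrum ℝ s) :=
    continuousOn_id.div (by fun_prop) fun t ht => by have := hσ t ht; positivity
  have hf0 : f 0 = 0 := by simp [f]
  have hu : IsSelfAdjoint (cfcₙ f s) := cfcₙ_predicate f s
  have : IsClosed (S : Set X) := hS
  refine ⟨cfcₙ f s, cfcₙ_mem f hsS, hu, fun a ha => ?_⟩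
  refine le_of_sq_le_sq ?_ hε.le
  refine (norm_sub_mul_sq_le hu ha).trans ?_
  have h1 : s - cfcₙ f s * s - s * cfcₙ f s + cfcₙ f s * s * cfcₙ f s =
      cfcₙ (fun t => t - f t * t - t * f t + f t * t * f t) s := by
    have hi : ContinuousOn (fun t : ℝ => t) (quasispectrum ℝ s) := continuousOn_id
    have e0 : cfcₙ (fun t : ℝ => t) s = s := cfcₙ_id' ℝ s
    have e1 := cfcₙ_mul f (fun t => t) s hf hf0 hi rfl
    have e2 := cfcₙ_mul (fun t => t) f s hi rfl hf hf0
    have e3 := cfcₙ_mul (fun t => f t * t) f s (hf.mul hi) (by simp) hf hf0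
    have e4 := cfcₙ_sub (fun t => t) (fun t => f t * t) s hi rfl (hf.mul hi) (by simp)
    have e5 := cfcₙ_sub (fun t => t - f t * t) (fun t => t * f t) s (hi.sub (hf.mul hi))
      (by simp) (hi.mul hf) (by simp)
    have e6 := cfcₙ_add (fun t => t - f t * t - t * f t) (fun t => f t * t * f t) s
      ((hi.sub (hf.mul hi)).sub (hi.mul hf)) (by simp) ((hf.mul hi).mul hf) (by simp [hf0])
    rw [e6, e5, e4, e3, e2, e1, e0]
  rw [h1]
  refine norm_cfcₙ_le fun t ht => ?_
  have ht0 := hσ t ht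
  have h2 : t - f t * t - t * f t + f t * t * f t = t * δ ^ 2 / (t + δ) ^ 2 := by
    simp only [f]
    field_simp
    ring
  rw [h2, Real.norm_of_nonneg (by positivity), div_le_iff₀ (by positivity)]
  change t * δ ^ 2 ≤ δ * (t + δ) ^ 2
  nlinarith [mul_nonneg hδ.le ht0, mul_pos hδ hδ, mul_nonneg hδ.le (sq_nonneg t), mul_nonneg ht0 (mul_pos hδ hδ).le, pow_pos hδ 3]

end CStar

/-! ### Weak integrals over a compact group. -/

section Barycenter

variable {G : Type*} [Group G] [TopologicalSpace G] [IsTopologicalGroup G] [CompactSpace G]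
  [MeasurableSpace G] [BorelSpace G]

/-- Existence of weak integrals over a compact group, provided that the convex combinations of the
values belong to a set which is compact for the initial topology given by the functionals `f i`. -/
lemma exists_weak_integral {V ι : Type*} [AddCommMonoid V] [Module ℂ V] (f : ι → V →ₗ[ℂ] ℂ)
    (c : G → V) (hc : ∀ i, Continuous fun g => f i (c g)) (K : Set V)
    (hK : @IsCompact V (.induced (fun v i => f i v) inferInstance) K)
    (hcK : ∀ (κ : Type) (t : Finset κ) (w : κ → ℝ) (g : κ → G), (∀ k ∈ t, 0 ≤ w k) →
      ∑ k ∈ t, w k = 1 → ∑ k ∈ t, (w k : ℂ) • c (g k) ∈ K) :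
    ∃ v, ∀ i, f i v = ∫ g, f i (c g) ∂(haar G) := by
  let _ : TopologicalSpace V := .induced (fun v i => f i v) inferInstance
  have hind : IsInducing (fun (v : V) i => f i v) := ⟨rfl⟩
  have hcc : Continuous c := hind.continuous_iff.2 (continuous_pi hc)
  have hfc : ∀ i, Continuous (f i) := fun i => (continuous_apply i).comp hind.continuous
  -- By compactness of K finitely many functionals suffice. For these the integral is taken in a
  -- finite-dimensional space and lies in the closed convex hull of the values, which is contained
  -- in the compact image of K.
  have hfin : ∀ s : Finset ι, (K ∩ ⋂ i ∈ s, {v | f i v = ∫ g, f i (c g) ∂(haar G)}).Nonempty := by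
    intro s
    let Φ : V →ₗ[ℂ] (s → ℂ) := LinearMap.pi fun i => f i
    have hΦc : Continuous Φ := continuous_pi fun i => hfc i
    have hΦK : IsClosed (Φ '' K) := (hK.image hΦc).isClosed
    have hint : Integrable (fun g => Φ (c g)) (haar G) :=
      integrable_of_continuous (hΦc.comp hcc)
    have h1 : ∫ g, Φ (c g) ∂(haar G) ∈ closure (convexHull ℝ (Set.range fun g => Φ (c g))) :=
      (convex_convexHull ℝ _).closure.integral_mem isClosed_closure
        (.of_forall fun g => subset_closure (subset_convexHull ℝ _ ⟨g, rfl⟩)) hint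
    have h2 : closure (convexHull ℝ (Set.range fun g => Φ (c g))) ⊆ Φ '' K := by
      refine closure_minimal ?_ hΦK
      rw [convexHull_eq]
      rintro _ ⟨κ, t, w, z, hw0, hw1, hz, rfl⟩
      choose! g hg using hz
      refine ⟨_, hcK κ t w g hw0 hw1, ?_⟩
      rw [Finset.centerMass_eq_of_sum_1 _ _ hw1, map_sum]
      refine Finset.sum_congr rfl fun k hk => ?_
      rw [map_smul, ← hg k hk]
      rfl
    obtain ⟨v, hv, hvΦ⟩ := h2 h1
    refine ⟨v, hv, Set.mem_iInter₂.2 fun i hi => ?_⟩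
    have h3 := congrFun hvΦ ⟨i, hi⟩
    exact h3.trans (eval_integral (f := fun g => Φ (c g))
      (fun j => integrable_of_continuous ((hfc j).comp hcc)) _)
  obtain ⟨v, -, hv⟩ := hK.inter_iInter_nonempty
    (fun i => {v | f i v = ∫ g, f i (c g) ∂(haar G)})
    (fun i => isClosed_eq (hfc i) continuous_const) hfin
  exact ⟨v, fun i => Set.mem_iInter.1 hv i⟩

/-- Convex combinations belong to the convex hull. -/
lemma sum_smul_mem_convexHull {V κ G : Type*} [AddCommMonoid V] [Module ℝ V] (c : G → V)
    (t : Finset κ) (w : κ → ℝ) (g : κ → G) (hw0 : ∀ k ∈ t, 0 ≤ w k) (hw1 : ∑ k ∈ t, w k = 1) :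
    ∑ k ∈ t, w k • c (g k) ∈ convexHull ℝ (Set.range c) := by
  rw [mem_convexHull_iff]
  intro S hS hconv
  -- Partial sums are renormalised so that they remain convex combinations during the induction.
  have key : ∀ s : Finset κ, s ⊆ t → 0 < ∑ k ∈ s, w k →
      (∑ k ∈ s, w k)⁻¹ • ∑ k ∈ s, w k • c (g k) ∈ S := by
    classical
    intro s
    induction s using Finset.induction_on with
    | empty => intro _ h; simp at h
    | insert a s ha ih =>
      intro hst hpos
      have hs : s ⊆ t := (Finset.subset_insert a s).trans hst
      have ha0 : 0 ≤ w a := hw0 a (hst (Finset.mem_insert_self a s))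
      have hs0 : ∀ k ∈ s, 0 ≤ w k := fun k hk => hw0 k (hs hk)
      rw [Finset.sum_insert ha] at hpos ⊢
      rw [Finset.sum_insert ha]
      rcases (Finset.sum_nonneg hs0).eq_or_lt with h0 | h0
      · have hz : ∑ k ∈ s, w k • c (g k) = 0 := Finset.sum_eq_zero fun k hk => by
          rw [(Finset.sum_eq_zero_iff_of_nonneg hs0).1 h0.symm k hk, zero_smul]
        rw [← h0, add_zero] at hpos
        rw [hz, ← h0, add_zero, add_zero, smul_smul, inv_mul_cancel₀ hpos.ne', one_smul]
        exact hS ⟨g a, rfl⟩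
      · have h1 := hconv (hS ⟨g a, rfl⟩) (ih hs h0) (a := (w a + ∑ k ∈ s, w k)⁻¹ * w a)
          (b := (w a + ∑ k ∈ s, w k)⁻¹ * ∑ k ∈ s, w k) (by positivity) (by positivity)
          (by rw [← mul_add, inv_mul_cancel₀ hpos.ne'])
        rwa [smul_smul, mul_assoc, mul_inv_cancel₀ h0.ne', mul_one, mul_smul, ← smul_add] at h1
  have := key t subset_rfl (by rw [hw1]; exact one_pos)
  rwa [hw1, inv_one, one_smul] at this

/-- The closure of the range of a weakly continuous map is compact. -/
lemma isCompact_closure_range {V ι : Type*} (f : ι → V → ℂ) (c : G → V)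
    (hc : ∀ i, Continuous fun g => f i (c g)) :
    @IsCompact V (.induced (fun v i => f i v) inferInstance)
      (closure[.induced (fun v i => f i v) inferInstance] (Set.range c)) := by
  let _ : TopologicalSpace V := .induced (fun v i => f i v) inferInstance
  have hind : IsInducing (fun (v : V) i => f i v) := ⟨rfl⟩
  have : R1Space V := hind.r1Space
  exact (isCompact_range (hind.continuous_iff.2 (continuous_pi hc))).closure

end Barycenter

/-! ### Averages of orbits against continuous functions on G. -/

section Average

variable {X : Type*} [NonUnitalCStarAlgebra X]
  {G : Type*} [Group G] [TopologicalSpace G] [IsTopologicalGroup G] [CompactSpace G]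
  [MeasurableSpace G] [BorelSpace G]
  {F : Submodule ℂ (StrongDual ℂ X)} {α : G →* (X ≃⋆ₐ[ℂ] X)}

lemma IsCStarDualPair.eq_zero (hF : IsCStarDualPair F) {x : X} (h : ∀ φ ∈ F, φ x = 0) : x = 0 := by
  rw [← norm_le_zero_iff]
  refine (hF.norm_eq x).2 ?_
  rintro _ ⟨φ, hφ, -, rfl⟩
  simp [h φ hφ]

lemma IsCStarDualPair.ext (hF : IsCStarDualPair F) {x y : X} (h : ∀ φ ∈ F, φ x = φ y) : x = y :=
  sub_eq_zero.1 (hF.eq_zero fun φ hφ => by rw [map_sub, h φ hφ, sub_self])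

lemma IsCStarDualPair.weakCont_mul_left (hF : IsCStarDualPair F) (a : X) :
    WeakCont (xDual F) (xDual F) (fun x => a * x) :=
  weakCont_of_continuous (LinearMap.mulLeft ℂ a) (hF.continuous_mul_left a)

lemma IsCStarDualPair.weakCont_mul_right (hF : IsCStarDualPair F) (a : X) :
    WeakCont (xDual F) (xDual F) (fun x => x * a) :=
  weakCont_of_continuous (LinearMap.mulRight ℂ a) (hF.continuous_mul_right a)

lemma IsFDynamicalSystem.weakCont (hα : IsFDynamicalSystem F α) (g : G) :
    WeakCont (xDual F) (xDual F) (α g) :=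
  weakCont_of_continuous
    ({ toFun := α g, map_add' := map_add _, map_smul' := map_smul _ } : X →ₗ[ℂ] X)
    (hα.continuous_aut g)

/-- The functionals `x ↦ conj (φ (x*))` belong to `F`. -/
lemma IsCStarDualPair.exists_star (hF : IsCStarDualPair F) {φ : StrongDual ℂ X} (hφ : φ ∈ F) :
    ∃ ψ ∈ F, ∀ x, ψ x = star (φ (star x)) := by
  let ψ : X →ₗ[ℂ] ℂ :=
    { toFun := fun x => star (φ (star x))
      map_add' := fun x y => by simp
      map_smul' := fun c x => by simp }
  suffices ψ ∈ xDual F from mem_xDual.1 this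
  rw [xDual, LinearMap.mem_span_iff_continuous]
  have h1 : (⨅ φ : F, TopologicalSpace.induced (φ.1 : X →ₗ[ℂ] ℂ) inferInstance) = fTopology F :=
    (induced_to_pi (fun x (φ : F) => φ.1 x)).symm
  rw [h1]
  have h2 : Continuous[fTopology F, inferInstance] (φ : X → ℂ) := by
    let _ := fTopology F
    exact (continuous_apply (⟨φ, hφ⟩ : F)).comp
      (continuous_induced_dom (f := fun x (φ : F) => φ.1 x))
  let _ := fTopology F
  exact (h2.comp hF.continuous_star).star

/-- The weak integral `∫ f(g) α_g(x) dg`. -/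
def avg (F : Submodule ℂ (StrongDual ℂ X)) (α : G →* (X ≃⋆ₐ[ℂ] X)) (f : G → ℂ) (x : X) : X :=
  -- For continuous f the weak integral exists, so the default value 0 is then not taken.
  open Classical in
  if h : ∃ y, IsWeakIntegral F (haar G) (fun g => f g • α g x) y then h.choose else 0

/-- The weighted orbit is a continuous image of G, hence relatively F-compact, and the convex hull
axiom on X supplies the compact set in which the barycentre lives. -/
lemma exists_isWeakIntegral (hF : IsCStarDualPair F) (hα : IsFDynamicalSystem F α) {f : G → ℂ}
    (hf : Continuous f) (x : X) :
    ∃ y, IsWeakIntegral F (haar G) (fun g => f g • α g x) y := by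
  have hc : ∀ φ : F, Continuous fun g => φ.1 (f g • α g x) := fun φ => by
    have := hα.continuous_orbit x φ.1 φ.2
    simp only [map_smul, smul_eq_mul]
    exact hf.mul this
  obtain ⟨v, hv⟩ := exists_weak_integral (fun φ : F => (φ.1 : X →ₗ[ℂ] ℂ)) (fun g => f g • α g x) hc
    _ (hF.convexHull_left _ (isCompact_closure_range _ _ hc)) fun κ t w g hw0 hw1 =>
      @subset_closure _ (fTopology F) _ _ (sum_smul_mem_convexHull _ t w g hw0 hw1)
  exact ⟨v, fun φ hφ => hv ⟨φ, hφ⟩⟩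

lemma avg_spec (hF : IsCStarDualPair F) (hα : IsFDynamicalSystem F α) {f : G → ℂ}
    (hf : Continuous f) (x : X) {φ : StrongDual ℂ X} (hφ : φ ∈ F) :
    φ (avg F α f x) = ∫ g, f g * φ (α g x) ∂(haar G) := by
  have h := exists_isWeakIntegral hF hα hf x
  rw [avg, dif_pos h]
  simpa using h.choose_spec φ hφ

lemma avg_eq (hF : IsCStarDualPair F) (hα : IsFDynamicalSystem F α) {f : G → ℂ}
    (hf : Continuous f) {x y : X} (h : ∀ φ ∈ F, φ y = ∫ g, f g * φ (α g x) ∂(haar G)) :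
    avg F α f x = y :=
  hF.ext fun φ hφ => by rw [avg_spec hF hα hf x hφ, h φ hφ]

end Average

section Average

variable {X : Type*} [NonUnitalCStarAlgebra X]
  {G : Type*} [Group G] [TopologicalSpace G] [IsTopologicalGroup G] [CompactSpace G]
  [MeasurableSpace G] [BorelSpace G]
  {F : Submodule ℂ (StrongDual ℂ X)} {α : G →* (X ≃⋆ₐ[ℂ] X)}

/-- Evaluation at `x` as a functional on `F`. -/
def evalDual (F : Submodule ℂ (StrongDual ℂ X)) (x : X) : F →ₗ[ℂ] ℂ where
  toFun φ := φ.1 x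
  map_add' _ _ := rfl
  map_smul' _ _ := rfl

lemma IsCStarDualPair.exists_dual_integral (hF : IsCStarDualPair F) (c : G → F)
    (hc : ∀ x, Continuous fun g => evalDual F x (c g)) :
    ∃ ψ : F, ∀ x, evalDual F x ψ = ∫ g, evalDual F x (c g) ∂(haar G) := by
  have hK := hF.convexHull_right _ (isCompact_closure_range (fun x (φ : F) => φ.1 x) c hc)
  refine exists_weak_integral (evalDual F) c hc _ hK fun κ t w g hw0 hw1 => ?_
  exact @subset_closure _ (xTopology F) _ _ (sum_smul_mem_convexHull c t w g hw0 hw1)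

/-- The composite of φ with the average is the weak integral of the functionals f(g) φ ∘ α_g. The
convex hull axiom on F keeps this integral inside F. -/
lemma weakCont_avg (hF : IsCStarDualPair F) (hα : IsFDynamicalSystem F α) {f : G → ℂ}
    (hf : Continuous f) : WeakCont (xDual F) (xDual F) (avg F α f) := by
  intro φ hφ
  obtain ⟨φ', hφ', hφφ'⟩ := mem_xDual.1 hφ
  have h1 : ∀ g, ∃ ψ : F, ∀ x, evalDual F x ψ = f g * φ (α g x) := fun g => by
    obtain ⟨ψ, hψ, h⟩ := (hα.weakCont g).smul (f g) φ hφ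
    obtain ⟨ψ', hψ', h'⟩ := mem_xDual.1 hψ
    exact ⟨⟨ψ', hψ'⟩, fun x => by rw [← smul_eq_mul, ← map_smul, ← h, ← h']; rfl⟩
  choose c hc using h1
  obtain ⟨ψ, hψ⟩ := hF.exists_dual_integral c fun x => by
    simp only [hc, ← hφφ']
    exact hf.mul (hα.continuous_orbit x φ' hφ')
  refine ⟨_, coe_mem_xDual ψ.2, fun x => ?_⟩
  rw [← hφφ', avg_spec hF hα hf x hφ']
  refine (hψ x).trans (integral_congr_ae (.of_forall fun g => ?_))
  simp only [hc, hφφ']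

lemma avg_mem (hF : IsCStarDualPair F) (hα : IsFDynamicalSystem F α) {f : G → ℂ}
    (hf : Continuous f) {S : Submodule ℂ X} (hS : wcl (xDual F) S ≤ S) {x : X}
    (hx : ∀ g, α g x ∈ S) : avg F α f x ∈ S := by
  refine hS (mem_wcl_xDual.2 fun φ hφ h => ?_)
  rw [avg_spec hF hα hf x hφ]
  simp [h _ (hx _)]

lemma map_avg (hF : IsCStarDualPair F) (hα : IsFDynamicalSystem F α) {f : G → ℂ}
    (hf : Continuous f) (h : G) (x : X) :
    α h (avg F α f x) = avg F α (fun g => f (h⁻¹ * g)) x := by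
  refine (avg_eq hF hα (by fun_prop) fun φ hφ => ?_).symm
  obtain ⟨ψ, hψ, hψφ⟩ := hα.weakCont h φ (coe_mem_xDual hφ)
  obtain ⟨ψ', hψ', h'⟩ := mem_xDual.1 hψ
  have h2 : ∀ x, φ (α h x) = ψ' x := fun x => by rw [h', hψφ]; rfl
  rw [h2, avg_spec hF hα hf x hψ',
    ← integral_mul_left_eq_self (fun g => f (h⁻¹ * g) * φ (α g x)) h]
  refine integral_congr_ae (.of_forall fun g => ?_)
  simp only [inv_mul_cancel_left, map_mul, ← h2]
  rfl

lemma avg_sum_smul (hF : IsCStarDualPair F) (hα : IsFDynamicalSystem F α) {ι : Type*}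
    (s : Finset ι) (c : ι → ℂ) (f : ι → G → ℂ) (hf : ∀ i, Continuous (f i)) (x : X) :
    avg F α (fun g => ∑ i ∈ s, c i * f i g) x = ∑ i ∈ s, c i • avg F α (f i) x := by
  refine avg_eq hF hα (by fun_prop) fun φ hφ => ?_
  have ho := hα.continuous_orbit x φ hφ
  simp only [map_sum, map_smul, smul_eq_mul, avg_spec hF hα (hf _) x hφ, Finset.sum_mul]
  rw [integral_finsetSum]
  · refine Finset.sum_congr rfl fun i _ => ?_
    rw [← integral_const_mul]
    simp only [mul_assoc]
  · intro i _
    exact integrable_of_continuous ((continuous_const.mul (hf i)).mul ho)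

/-- The average of an element whose orbit is contained in a finite-dimensional space, on the left
of an arbitrary element. -/
lemma avg_eq_sum (hF : IsCStarDualPair F) (hα : IsFDynamicalSystem F α) {f : G → ℂ}
    (hf : Continuous f) {ι : Type*} [Fintype ι] {x : X} {m : ι → G → ℂ} (hm : ∀ i, Continuous (m i))
    {a : ι → X} (hx : ∀ g, α g x = ∑ i, m i g • a i) :
    avg F α f x = ∑ i, (∫ g, f g * m i g ∂(haar G)) • a i := by
  refine avg_eq hF hα hf fun φ hφ => ?_
  simp only [hx, map_sum, map_smul, smul_eq_mul, Finset.mul_sum]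
  rw [integral_finsetSum]
  · refine Finset.sum_congr rfl fun i _ => ?_
    rw [← integral_mul_const]
    simp only [mul_assoc]
  · intro i _
    have := hm i
    exact integrable_of_continuous (by fun_prop)

lemma mul_avg (hF : IsCStarDualPair F) (hα : IsFDynamicalSystem F α) {f : G → ℂ}
    (hf : Continuous f) {y : X} (hy : ∀ g, α g y = y) (x : X) :
    avg F α f (y * x) = y * avg F α f x := by
  refine avg_eq hF hα hf fun φ hφ => ?_
  obtain ⟨ψ, hψ, hψφ⟩ := hF.weakCont_mul_left y φ (coe_mem_xDual hφ)
  obtain ⟨ψ', hψ', h'⟩ := mem_xDual.1 hψ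
  have h2 : ∀ x, φ (y * x) = ψ' x := fun x => by rw [h', hψφ]; rfl
  rw [h2, avg_spec hF hα hf x hψ']
  simp only [map_mul, hy, h2]

lemma star_avg (hF : IsCStarDualPair F) (hα : IsFDynamicalSystem F α) {f : G → ℂ}
    (hf : Continuous f) (x : X) :
    star (avg F α f x) = avg F α (fun g => star (f g)) (star x) := by
  refine (avg_eq hF hα hf.star fun φ hφ => ?_).symm
  obtain ⟨ψ, hψ, hψφ⟩ := hF.exists_star hφ
  have h2 : ∀ x, φ (star x) = star (ψ x) := fun x => by rw [hψφ, star_star]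
  rw [h2, avg_spec hF hα hf x hψ, RCLike.star_def, ← integral_conj]
  refine integral_congr_ae (.of_forall fun g => ?_)
  simp [map_star, h2]

lemma avg_mul (hF : IsCStarDualPair F) (hα : IsFDynamicalSystem F α) {f : G → ℂ}
    (hf : Continuous f) {y : X} (hy : ∀ g, α g y = y) (x : X) :
    avg F α f (x * y) = avg F α f x * y := by
  refine avg_eq hF hα hf fun φ hφ => ?_
  obtain ⟨ψ, hψ, hψφ⟩ := hF.weakCont_mul_right y φ (coe_mem_xDual hφ)
  obtain ⟨ψ', hψ', h'⟩ := mem_xDual.1 hψ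
  have h2 : ∀ x, φ (x * y) = ψ' x := fun x => by rw [h', hψφ]; rfl
  rw [h2, avg_spec hF hα hf x hψ']
  simp only [map_mul, hy, h2]

end Average

/-! ### Rows of X₂(π) and their products a* b and a b*. -/

section Rows

variable {X : Type*} [NonUnitalCStarAlgebra X]
  {G : Type*} [Group G] [TopologicalSpace G]
  {α : G →* (X ≃⋆ₐ[ℂ] X)} {π : IrrRep G}

/-- The rows of the elements of `X₂(π)`. -/
def IsRow (α : G →* (X ≃⋆ₐ[ℂ] X)) (π : IrrRep G) (a : Fin π.dim → X) : Prop :=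
  ∀ g k, α g (a k) = ∑ m, π.mat g m k • a m

/-- The fixed point algebra of `α`. -/
def fixedPts (α : G →* (X ≃⋆ₐ[ℂ] X)) : NonUnitalStarSubalgebra ℂ X where
  carrier := {x | ∀ g, α g x = x}
  add_mem' ha hb g := by rw [map_add, ha g, hb g]
  zero_mem' g := map_zero _
  smul_mem' c x hx g := by rw [map_smul, hx g]
  mul_mem' ha hb g := by rw [map_mul, ha g, hb g]
  star_mem' ha g := by rw [map_star, ha g]

lemma mem_fixedPts {x : X} : x ∈ fixedPts α ↔ ∀ g, α g x = x := Iff.rfl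

lemma mem_spectralSubspaceTwo {Y : NonUnitalStarSubalgebra ℂ X}
    {a : Matrix (Fin π.dim) (Fin π.dim) X} :
    a ∈ spectralSubspaceTwo α Y π ↔ ∀ i, IsRow α π (a i) ∧ ∀ j, a i j ∈ Y := by
  have h : ∀ g, a.map (α g) = mulScalar a (π.mat g) ↔
      ∀ i k, α g (a i k) = ∑ m, π.mat g m k • a i m := fun g =>
    ⟨fun h i k => congrFun (congrFun h i) k, fun h => by ext i k; exact h i k⟩
  simp only [spectralSubspaceTwo, Set.mem_ofPred_eq, h, IsRow]
  exact ⟨fun h i => ⟨fun g k => h.2 g i k, h.1 i⟩, fun h => ⟨fun i => (h i).2, fun g i => (h i).1 g⟩⟩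

lemma mulScalar_mulScalar {n : ℕ} (a : Matrix (Fin n) (Fin n) X) (u v : Matrix (Fin n) (Fin n) ℂ) :
    mulScalar (mulScalar a u) v = mulScalar a (u * v) := by
  ext i j
  simp only [mulScalar, Matrix.mul_apply, of_apply, Finset.smul_sum, Finset.sum_smul, smul_smul]
  rw [Finset.sum_comm]
  simp only [mul_comm]

lemma mulScalar_one {n : ℕ} (a : Matrix (Fin n) (Fin n) X) :
    mulScalar a (1 : Matrix (Fin n) (Fin n) ℂ) = a := by
  ext i j
  simp [mulScalar, Matrix.one_apply, ite_smul]

lemma tensorAd_eq_iff_map {g : G} {c : Matrix (Fin π.dim) (Fin π.dim) X} :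
    tensorAd α π g c = c ↔
      c.map (α g) = mulScalar (scalarMul (π.mat g)ᴴ c) (π.mat g) := by
  constructor
  · intro h
    conv_rhs => rw [← h]
    rw [tensorAd, scalarMul_mulScalar, scalarMul_scalarMul, mulScalar_mulScalar, mat_inv_mul,
      ← mat_inv, mat_inv_mul, mulScalar_one, one_scalarMul]
  · intro h
    rw [tensorAd, h, scalarMul_mulScalar, scalarMul_scalarMul, mulScalar_mulScalar, mat_inv,
      mat_mul_conjTranspose, mulScalar_one, one_scalarMul]

lemma tensorAd_eq_iff {g : G} {c : Matrix (Fin π.dim) (Fin π.dim) X} :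
    tensorAd α π g c = c ↔
      ∀ i j, α g (c i j) = ∑ p, ∑ q, (star (π.mat g p i) * π.mat g q j) • c p q := by
  rw [tensorAd_eq_iff_map]
  have h2 : ∀ i j, mulScalar (scalarMul (π.mat g)ᴴ c) (π.mat g) i j =
      ∑ p, ∑ q, (star (π.mat g p i) * π.mat g q j) • c p q := fun i j => by
    simp only [mulScalar, scalarMul, of_apply, conjTranspose_apply, Finset.smul_sum, smul_smul]
    rw [Finset.sum_comm]
    simp only [mul_comm]
  exact ⟨fun h i j => (congrFun (congrFun h i) j).trans (h2 i j), fun h => by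
    ext i j
    exact (h i j).trans (h2 i j).symm⟩

lemma mem_fixedAlgebra {Y : NonUnitalStarSubalgebra ℂ X} {c : Matrix (Fin π.dim) (Fin π.dim) X} :
    c ∈ fixedAlgebra α Y π ↔ (∀ i j, c i j ∈ Y) ∧ ∀ g i j,
      α g (c i j) = ∑ p, ∑ q, (star (π.mat g p i) * π.mat g q j) • c p q := by
  simp only [← tensorAd_eq_iff]
  rfl

/-- The matrix all of whose rows are `a`. -/
def rowMat {n : ℕ} (a : Fin n → X) : Matrix (Fin n) (Fin n) X := of fun _ k => a k

/-- Turns the row relation into a matrix identity, so that the covariance of a b* and of a c follows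
by cancelling π(g) against its adjoint. -/
lemma isRow_iff_map {a : Fin π.dim → X} :
    IsRow α π a ↔ ∀ g, (rowMat a).map (α g) = mulScalar (rowMat a) (π.mat g) :=
  ⟨fun h g => by ext i k; exact h g k, fun h g k => congrFun (congrFun (h g) k) k⟩

lemma matrix_map_mul {n : ℕ} (g : G) (a b : Matrix (Fin n) (Fin n) X) :
    (a * b).map (α g) = a.map (α g) * b.map (α g) := by
  ext i j
  simp [Matrix.mul_apply]

lemma matrix_map_conjTranspose {n : ℕ} (g : G) (a : Matrix (Fin n) (Fin n) X) :
    aᴴ.map (α g) = (a.map (α g))ᴴ := by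
  ext i j
  simp [map_star]

/-- The matrix `a* b` for rows `a` and `b`. -/
def outer {n : ℕ} (a b : Fin n → X) : Matrix (Fin n) (Fin n) X := of fun k l => star (a k) * b l

lemma IsRow.outer_mem {a b : Fin π.dim → X} (ha : IsRow α π a) (hb : IsRow α π b)
    {Y : NonUnitalStarSubalgebra ℂ X} (haY : ∀ k, a k ∈ Y) (hbY : ∀ k, b k ∈ Y) :
    outer a b ∈ fixedAlgebra α Y π := by
  refine mem_fixedAlgebra.2 ⟨fun i j => mul_mem (star_mem (haY i)) (hbY j), fun g i j => ?_⟩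
  simp only [outer, of_apply, map_mul, map_star, ha g i, hb g j, star_sum, star_smul,
    Finset.sum_mul, Finset.mul_sum, smul_mul_assoc, mul_smul_comm, Finset.smul_sum, smul_smul]
  rw [Finset.sum_comm]
  exact Finset.sum_congr rfl fun p _ => Finset.sum_congr rfl fun q _ => by rw [mul_comm]

lemma IsRow.sum_mul_star_mem {a b : Fin π.dim → X} (ha : IsRow α π a) (hb : IsRow α π b) :
    ∑ k, a k * star (b k) ∈ fixedPts α := by
  intro g
  let i₀ : Fin π.dim := ⟨0, π.dim_pos⟩
  have h : (rowMat a * (rowMat b)ᴴ).map (α g) = rowMat a * (rowMat b)ᴴ := by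
    rw [matrix_map_mul, matrix_map_conjTranspose, isRow_iff_map.1 ha, isRow_iff_map.1 hb,
      conjTranspose_mulScalar, mulScalar_mul, scalarMul_scalarMul, mat_mul_conjTranspose,
      one_scalarMul]
  simpa [Matrix.mul_apply, rowMat] using congrFun (congrFun h i₀) i₀

lemma IsRow.vecMul {a : Fin π.dim → X} (ha : IsRow α π a) {Y : NonUnitalStarSubalgebra ℂ X}
    {c : Matrix (Fin π.dim) (Fin π.dim) X} (hc : c ∈ fixedAlgebra α Y π) :
    IsRow α π (a ᵥ* c) := by
  refine isRow_iff_map.2 fun g => ?_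
  have h : rowMat (a ᵥ* c) = rowMat a * c := rfl
  rw [h, matrix_map_mul, isRow_iff_map.1 ha, tensorAd_eq_iff_map.1 (hc.2 g), mulScalar_mul,
    scalarMul_mulScalar, scalarMul_scalarMul, mat_mul_conjTranspose, one_scalarMul,
    mul_mulScalar]

lemma IsRow.mul_left {a : Fin π.dim → X} (ha : IsRow α π a) {y : X} (hy : y ∈ fixedPts α) :
    IsRow α π (fun k => y * a k) := by
  intro g k
  simp only [map_mul, hy g, ha g k, Finset.mul_sum, mul_smul_comm]

lemma IsRow.mul_right {a : Fin π.dim → X} (ha : IsRow α π a) {y : X} (hy : y ∈ fixedPts α) :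
    IsRow α π (fun k => a k * y) := by
  intro g k
  simp only [map_mul, hy g, ha g k, Finset.sum_mul, smul_mul_assoc]

lemma outer_mul {n : ℕ} (a b : Fin n → X) (c : Matrix (Fin n) (Fin n) X) :
    outer a b * c = outer a (b ᵥ* c) := by
  ext i j
  simp [outer, Matrix.mul_apply, Matrix.vecMul, dotProduct, Finset.mul_sum, mul_assoc]

lemma mul_outer {n : ℕ} (a b : Fin n → X) (c : Matrix (Fin n) (Fin n) X) :
    c * outer a b = outer (a ᵥ* cᴴ) b := by
  ext i j
  simp [outer, Matrix.mul_apply, Matrix.vecMul, dotProduct, Finset.sum_mul, mul_assoc]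

/-- `Y₂(π)* Y₂(π)` is spanned by the matrices `a* b` with rows `a`, `b`. -/
lemma spectralIdeal_eq_span (Y : NonUnitalStarSubalgebra ℂ X) :
    spectralIdeal α Y π = Submodule.span ℂ {c | ∃ a b : Fin π.dim → X, IsRow α π a ∧
      IsRow α π b ∧ (∀ k, a k ∈ Y) ∧ (∀ k, b k ∈ Y) ∧ c = outer a b} := by
  refine le_antisymm (Submodule.span_le.2 ?_) (Submodule.span_le.2 ?_)
  · rintro _ ⟨a, ha, b, hb, rfl⟩
    rw [mem_spectralSubspaceTwo] at ha hb
    have : aᴴ * b = ∑ i, outer (a i) (b i) := by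
      ext k l
      simp [Matrix.mul_apply, outer, Matrix.sum_apply]
    rw [this]
    exact sum_mem fun i _ => Submodule.subset_span
      ⟨a i, b i, (ha i).1, (hb i).1, (ha i).2, (hb i).2, rfl⟩
  · rintro _ ⟨a, b, ha, hb, haY, hbY, rfl⟩
    -- A single row becomes an element of Y₂(π) when placed in row `i₀` with zeros elsewhere.
    let i₀ : Fin π.dim := ⟨0, π.dim_pos⟩
    have h : ∀ a : Fin π.dim → X, IsRow α π a → (∀ k, a k ∈ Y) →
        of (fun i k => if i = i₀ then a k else 0) ∈ spectralSubspaceTwo α Y π := by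
      intro a ha haY
      refine mem_spectralSubspaceTwo.2 fun i => ?_
      by_cases hi : i = i₀
      · exact ⟨fun g k => by simpa [hi] using ha g k, fun k => by simpa [hi] using haY k⟩
      · exact ⟨fun g k => by simp [hi], fun k => by simp [hi]⟩
    refine Submodule.subset_span ⟨_, h a ha haY, _, h b hb hbY, ?_⟩
    ext k l
    simp [Matrix.mul_apply, outer]

end Rows

/-! ### Rows and fixed matrices obtained by averaging; description of the spectrum. -/

section RowAverages

variable {X : Type*} [NonUnitalCStarAlgebra X]
  {G : Type*} [Group G] [TopologicalSpace G] [IsTopologicalGroup G] [CompactSpace G]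
  [MeasurableSpace G] [BorelSpace G]
  {F : Submodule ℂ (StrongDual ℂ X)} {α : G →* (X ≃⋆ₐ[ℂ] X)}

/-- The averages of `x` against the conjugated `j`-th column of `π` form a row. -/
lemma isRow_avg (hF : IsCStarDualPair F) (hα : IsFDynamicalSystem F α) (π : IrrRep G)
    (j : Fin π.dim) (x : X) : IsRow α π (fun k => avg F α (fun g => star (π.mat g k j)) x) := by
  intro h k
  have hc : ∀ m, Continuous fun g => star (π.mat g m j) := fun m => (continuous_mat π m j).star
  rw [map_avg hF hα (hc k), ← avg_sum_smul hF hα _ _ _ hc]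
  congr 1
  ext g
  simp only [mat_mul, Matrix.mul_apply, star_sum, star_mul', mat_inv, conjTranspose_apply,
    star_star]

/-- Every element of a closed invariant subspace is approximated by entries of rows. -/
lemma mem_wcl_of_rows [T2Space G] (hF : IsCStarDualPair F) (hα : IsFDynamicalSystem F α)
    {Y R : Submodule ℂ X} (hY : wcl (xDual F) Y ≤ Y) (hinv : ∀ g, ∀ y ∈ Y, α g y ∈ Y)
    (hR : ∀ (c : DualSet G) (a : Fin c.rep.dim → X), IsRow α c.rep a → (∀ k, a k ∈ Y) →
      ∀ k, a k ∈ wcl (xDual F) R) {x : X} (hx : x ∈ Y) : x ∈ wcl (xDual F) R := by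
  refine mem_wcl_xDual.2 fun φ hφ hφR => ?_
  -- The integrals of g ↦ φ(α_g x) against conjugated coefficients are values of φ at entries of
  -- rows, so they vanish; Peter–Weyl at g = 1 gives φ(x) = 0.
  have h := eq_zero_of_integral_dualSet (fun g => φ (α g x)) (hα.continuous_orbit x φ hφ)
    fun c i j => by
      have hc : ∀ k, Continuous fun g => star (c.rep.mat g k j) :=
        fun k => (continuous_mat c.rep k j).star
      rw [← avg_spec hF hα (hc i) x hφ]
      exact mem_wcl_xDual.1 (hR c _ (isRow_avg hF hα c.rep j x)
        (fun k => avg_mem hF hα (hc k) hY fun g => hinv g x hx) i) φ hφ hφR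
  simpa using h

lemma exists_row_ne_zero [T2Space G] (hF : IsCStarDualPair F) (hα : IsFDynamicalSystem F α)
    {Y : Submodule ℂ X} (hY : wcl (xDual F) Y ≤ Y) (hinv : ∀ g, ∀ y ∈ Y, α g y ∈ Y)
    (hne : ∃ y ∈ Y, y ≠ 0) : ∃ (c : DualSet G) (a : Fin c.rep.dim → X), IsRow α c.rep a ∧
      (∀ k, a k ∈ Y) ∧ ∃ k, a k ≠ 0 := by
  by_contra! hcon
  obtain ⟨y, hy, hy0⟩ := hne
  have h := mem_wcl_of_rows hF hα (R := ⊥) hY hinv (fun c a ha haY k => by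
    rw [hcon c a ha haY k]
    exact zero_mem _) hy
  exact hy0 (hF.eq_zero fun φ hφ => mem_wcl_xDual.1 h φ hφ (by simp))

lemma wcl_bot (hF : IsCStarDualPair F) : wcl (xDual F) (⊥ : Submodule ℂ X) = ⊥ :=
  eq_bot_iff.2 fun _ hx => (Submodule.mem_bot ℂ).2
    (hF.eq_zero fun φ hφ => mem_wcl_xDual.1 hx φ hφ (by simp))

lemma wcl_matDual_bot (hF : IsCStarDualPair F) (n : ℕ) :
    wcl (matDual F n) (⊥ : Submodule ℂ (Matrix (Fin n) (Fin n) X)) = ⊥ := by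
  refine eq_bot_iff.2 fun a ha => (Submodule.mem_bot ℂ).2 ?_
  ext i j
  have := (weakCont_entry (F := F) i j).map_mem (R := ⊥) (fun s hs => by
    rw [(Submodule.mem_bot ℂ).1 hs]
    exact zero_mem _) ha
  rw [wcl_bot hF] at this
  exact (Submodule.mem_bot ℂ).1 this

/-- By Schur orthogonality, integrating χ_π against the coefficients occurring in α_g(a_k) leaves
only a_k. -/
lemma IsRow.mem_spectralSubspaceOne (hF : IsCStarDualPair F) (hα : IsFDynamicalSystem F α)
    {π : IrrRep G} {a : Fin π.dim → X} (ha : IsRow α π a) (k : Fin π.dim) :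
    a k ∈ spectralSubspaceOne F α π := by
  have hc := continuous_mat π
  have hchi : Continuous π.chi := by
    unfold IrrRep.chi
    exact continuous_const.mul (continuous_finsetSum _ fun i _ => (hc i i).star)
  have h1 : avg F α π.chi (a k) = a k := by
    rw [avg_eq_sum hF hα hchi (m := fun m g => π.mat g m k) (fun m => hc m k) (fun g => ha g k)]
    have h2 : ∀ m, ∫ g, π.chi g * π.mat g m k ∂(haar G) = if m = k then 1 else 0 := fun m => by
      simp only [IrrRep.chi, Finset.mul_sum, Finset.sum_mul, mul_assoc]
      rw [integral_finsetSum]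
      · simp only [integral_const_mul, integral_star_mat_mul_mat]
        by_cases h : m = k
        · simp [h]
        · rw [if_neg h]
          refine Finset.sum_eq_zero fun i _ => if_neg ?_
          rintro ⟨rfl, h'⟩
          exact h h'
      · intro i _
        exact integrable_of_continuous (continuous_const.mul ((hc i i).star.mul (hc m k)))
    simp [h2, ite_smul]
  intro φ hφ
  conv_lhs => rw [← h1]
  rw [avg_spec hF hα hchi _ hφ]
  simp

/-- The character is a sum of conjugated diagonal coefficients, so the projection onto X₁(π) is a
multiple of a sum of entries of averaged rows. If all rows vanish, so does X₁(π). -/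
lemma mem_spectrumOf_iff (hF : IsCStarDualPair F) (hα : IsFDynamicalSystem F α) {c : DualSet G} :
    c ∈ spectrumOf F α ↔ ∃ a : Fin c.rep.dim → X, IsRow α c.rep a ∧ ∃ k, a k ≠ 0 := by
  constructor
  · intro h
    by_contra! hcon
    refine h (Set.eq_singleton_iff_unique_mem.2 ⟨fun φ _ => by simp, fun x hx => ?_⟩)
    refine hF.eq_zero fun φ hφ => ?_
    have hc : ∀ i, Continuous fun g => star (c.rep.mat g i i) :=
      fun i => (continuous_mat c.rep i i).star
    have ho := hα.continuous_orbit x φ hφ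
    have h1 := hx φ hφ
    simp only [map_smul, smul_eq_mul, IrrRep.chi, Finset.mul_sum, Finset.sum_mul, mul_assoc] at h1
    rw [h1, integral_finsetSum]
    · refine Finset.sum_eq_zero fun i _ => ?_
      rw [integral_const_mul]
      have h2 := avg_spec hF hα (hc i) x hφ
      rw [hcon _ (isRow_avg hF hα c.rep i x) i, map_zero] at h2
      rw [← h2, mul_zero]
    · intro i _
      exact integrable_of_continuous (continuous_const.mul ((hc i).mul ho))
  · rintro ⟨a, ha, k, hk⟩ h
    have h1 := ha.mem_spectralSubspaceOne hF hα k
    rw [h] at h1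
    exact hk h1

lemma wcl_fixedPts_le (hF : IsCStarDualPair F) (hα : IsFDynamicalSystem F α) :
    wcl (xDual F) (fixedPts α).toSubmodule ≤ (fixedPts α).toSubmodule := by
  intro x hx g
  refine hF.ext fun φ hφ => ?_
  obtain ⟨ψ, hψ, h⟩ := hα.weakCont g φ (coe_mem_xDual hφ)
  have h1 := hx (ψ - φ) (sub_mem hψ (coe_mem_xDual hφ)) fun s hs => by
    rw [LinearMap.sub_apply, h, (show α g s = s from hs g), sub_self]
  rw [LinearMap.sub_apply, h, sub_eq_zero] at h1
  exact h1

/-- The component maps of the projection onto the fixed point algebra of `α ⊗ ad π`. -/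
def proj (F : Submodule ℂ (StrongDual ℂ X)) (α : G →* (X ≃⋆ₐ[ℂ] X)) (π : IrrRep G)
    (k l : Fin π.dim) (x : X) : Matrix (Fin π.dim) (Fin π.dim) X :=
  of fun i j => avg F α (fun g => π.mat g i k * star (π.mat g j l)) x

lemma continuous_mat_mul_star_mat (π : IrrRep G) (i k j l : Fin π.dim) :
    Continuous fun g => π.mat g i k * star (π.mat g j l) :=
  (continuous_mat π i k).mul (continuous_mat π j l).star

lemma proj_mem (hF : IsCStarDualPair F) (hα : IsFDynamicalSystem F α) (π : IrrRep G)
    (k l : Fin π.dim) (x : X) : proj F α π k l x ∈ fixedAlgebra α ⊤ π := by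
  refine mem_fixedAlgebra.2 ⟨fun _ _ => trivial, fun h i j => ?_⟩
  have hc := continuous_mat_mul_star_mat π
  simp only [proj, of_apply]
  rw [map_avg hF hα (hc _ _ _ _), ← Fintype.sum_prod_type',
    ← avg_sum_smul hF hα _ (fun p : Fin π.dim × Fin π.dim => star (π.mat h p.1 i) * π.mat h p.2 j)
      _ (fun p => hc _ _ _ _)]
  congr 1
  ext g
  simp only [mat_mul, Matrix.mul_apply, star_sum, star_mul', mat_inv, conjTranspose_apply,
    star_star, Finset.sum_mul, Finset.mul_sum, Fintype.sum_prod_type]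
  rw [Finset.sum_comm]
  exact Finset.sum_congr rfl fun p _ => Finset.sum_congr rfl fun q _ => by ring

/-- A fixed matrix is the average of its constant orbit under α ⊗ ad π; `proj` is this average with
the entries of the matrix separated. This lets approximations of single entries be pushed into the
fixed algebra. -/
lemma sum_proj (hF : IsCStarDualPair F) (hα : IsFDynamicalSystem F α) {π : IrrRep G}
    {Y : NonUnitalStarSubalgebra ℂ X} {c : Matrix (Fin π.dim) (Fin π.dim) X}
    (hc : c ∈ fixedAlgebra α Y π) : ∑ k, ∑ l, proj F α π k l (c k l) = c := by
  have hcont := continuous_mat_mul_star_mat π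
  ext i j
  refine hF.ext fun φ hφ => ?_
  have h1 : ∀ g, φ (c i j) =
      ∑ k, ∑ l, π.mat g i k * star (π.mat g j l) * φ (α g (c k l)) := fun g => by
    conv_lhs => rw [← hc.2 g]
    simp only [tensorAd, mulScalar, scalarMul, of_apply, map_sum, map_smul, mat_inv,
      conjTranspose_apply, smul_eq_mul, Finset.mul_sum, Matrix.map_apply]
    rw [Finset.sum_comm]
    exact Finset.sum_congr rfl fun p _ => Finset.sum_congr rfl fun q _ => by ring
  have hint : ∀ k l, Integrable
      (fun g => π.mat g i k * star (π.mat g j l) * φ (α g (c k l))) (haar G) := fun k l =>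
    integrable_of_continuous ((hcont i k j l).mul (hα.continuous_orbit _ φ hφ))
  calc φ ((∑ k, ∑ l, proj F α π k l (c k l)) i j)
      = ∑ k, ∑ l, ∫ g, π.mat g i k * star (π.mat g j l) * φ (α g (c k l)) ∂(haar G) := by
        simp only [Matrix.sum_apply, map_sum, proj, of_apply, avg_spec hF hα (hcont _ _ _ _) _ hφ]
    _ = ∫ g, ∑ k, ∑ l, π.mat g i k * star (π.mat g j l) * φ (α g (c k l)) ∂(haar G) := by
        rw [integral_finsetSum _ fun k _ => integrable_finsetSum _ fun l _ => hint k l]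
        exact Finset.sum_congr rfl fun k _ => (integral_finsetSum _ fun l _ => hint k l).symm
    _ = φ (c i j) := by simp only [← h1]; simp

lemma weakCont_proj (hF : IsCStarDualPair F) (hα : IsFDynamicalSystem F α) (π : IrrRep G)
    (k l : Fin π.dim) : WeakCont (xDual F) (matDual F π.dim) (proj F α π k l) :=
  WeakCont.of_entries fun _ _ => weakCont_avg hF hα (continuous_mat_mul_star_mat π _ _ _ _)

/-- A row is recovered from the averages of its entries. -/
lemma IsRow.sum_avg (hF : IsCStarDualPair F) (hα : IsFDynamicalSystem F α) {π : IrrRep G}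
    {a : Fin π.dim → X} (ha : IsRow α π a) (j : Fin π.dim) :
    ∑ k, avg F α (fun g => star (π.mat g j k)) (a k) = a j := by
  have hc : ∀ k, Continuous fun g => star (π.mat g j k) := fun k => (continuous_mat π j k).star
  refine hF.ext fun φ hφ => ?_
  have h1 : ∀ g, φ (a j) = ∑ k, star (π.mat g j k) * φ (α g (a k)) := fun g => by
    simp only [ha g _, map_sum, map_smul, smul_eq_mul, Finset.mul_sum]
    rw [Finset.sum_comm]
    simp only [← mul_assoc, ← Finset.sum_mul]
    have h2 : ∀ m, ∑ k, star (π.mat g j k) * π.mat g m k = if m = j then 1 else 0 := fun m => by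
      rw [← sum_mat_mul_star_mat π g m j]
      exact Finset.sum_congr rfl fun k _ => mul_comm _ _
    simp only [h2, ite_mul, one_mul, zero_mul, Finset.sum_ite_eq', Finset.mem_univ, if_true]
  have hint : ∀ k, Integrable (fun g => star (π.mat g j k) * φ (α g (a k))) (haar G) := fun k =>
    integrable_of_continuous ((hc k).mul (hα.continuous_orbit _ φ hφ))
  simp only [map_sum, avg_spec hF hα (hc _) _ hφ]
  rw [← integral_finsetSum _ fun k _ => hint k]
  simp only [← h1]
  simp

variable [PartialOrder X] [StarOrderedRing X]

/-- Finite families are approximated by their products with elements of a closed subalgebra. -/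
lemma exists_approx_family {S : NonUnitalStarSubalgebra ℂ X} (hS : IsClosed (S : Set X))
    {ι : Type*} [Fintype ι] {a : ι → X} (ha : ∑ i, a i * star (a i) ∈ S) {ε : ℝ} (hε : 0 < ε) :
    ∃ u ∈ S, IsSelfAdjoint u ∧ ∀ i, ‖a i - u * a i‖ ≤ ε := by
  obtain ⟨u, hu, husa, h⟩ := exists_approx_unit S hS
    (Finset.sum_nonneg fun i _ => mul_star_self_nonneg (a i)) ha hε
  exact ⟨u, hu, husa, fun i => h _ (Finset.single_le_sum
    (f := fun i => a i * star (a i)) (fun i _ => mul_star_self_nonneg (a i)) (Finset.mem_univ i))⟩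

lemma sum_mul_star_ne_zero {ι : Type*} [Fintype ι] {a : ι → X} {k : ι} (hk : a k ≠ 0) :
    ∑ i, a i * star (a i) ≠ 0 := by
  intro h
  have := (Finset.sum_eq_zero_iff_of_nonneg fun i _ => mul_star_self_nonneg (a i)).1 h k
    (Finset.mem_univ k)
  exact hk (CStarRing.mul_star_self_eq_zero_iff _ |>.1 this)

end RowAverages

/-! ### Passing to weak closures from generators. -/

section Density

variable {X : Type*} [NonUnitalCStarAlgebra X] {F : Submodule ℂ (StrongDual ℂ X)}

/-- The condition is checked on generators only, even though T is not assumed linear: each φ ∘ T is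
given by a linear ψ. -/
lemma WeakCont.map_span_mem {V W : Type*} [AddCommGroup V] [Module ℂ V] [AddCommGroup W]
    [Module ℂ W] {D : Submodule ℂ (V →ₗ[ℂ] ℂ)} {E : Submodule ℂ (W →ₗ[ℂ] ℂ)} {T : V → W}
    (hT : WeakCont D E T) {A : Set V} {R : Submodule ℂ W} (h : ∀ s ∈ A, T s ∈ wcl E R) {v : V}
    (hv : v ∈ wcl D (Submodule.span ℂ A)) : T v ∈ wcl E R := by
  intro φ hφ hR
  obtain ⟨ψ, hψ, hψT⟩ := hT φ hφ
  rw [← hψT]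
  have : Submodule.span ℂ A ≤ LinearMap.ker ψ := Submodule.span_le.2 fun s hs => by
    simpa [hψT] using h s hs φ hφ hR
  exact hv ψ hψ fun s hs => this hs

/-- The involution is conjugate-linear and so not covered by `WeakCont`; the functional x ↦ conj
φ(x*) takes the place of φ ∘ star. -/
lemma IsCStarDualPair.star_mem_wcl_span (hF : IsCStarDualPair F) {A : Set X} {R : Submodule ℂ X}
    (h : ∀ s ∈ A, star s ∈ wcl (xDual F) R) {x : X}
    (hx : x ∈ wcl (xDual F) (Submodule.span ℂ A)) : star x ∈ wcl (xDual F) R := by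
  refine mem_wcl_xDual.2 fun φ hφ hR => ?_
  obtain ⟨ψ, hψ, hψφ⟩ := hF.exists_star hφ
  have h1 : Submodule.span ℂ A ≤ LinearMap.ker (ψ : X →ₗ[ℂ] ℂ) := Submodule.span_le.2 fun s hs => by
    simpa [hψφ] using mem_wcl_xDual.1 (h s hs) φ hφ hR
  have h2 := mem_wcl_xDual.1 hx ψ hψ fun s hs => h1 hs
  rwa [hψφ, star_eq_zero] at h2

lemma IsCStarDualPair.eqOn_wcl (hF : IsCStarDualPair F) {V : Type*} [AddCommGroup V] [Module ℂ V]
    {D : Submodule ℂ (V →ₗ[ℂ] ℂ)} {T₁ T₂ : V → X} (h₁ : WeakCont D (xDual F) T₁)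
    (h₂ : WeakCont D (xDual F) T₂) {S : Submodule ℂ V} (h : ∀ s ∈ S, T₁ s = T₂ s) {v : V}
    (hv : v ∈ wcl D S) : T₁ v = T₂ v := by
  refine hF.ext fun φ hφ => ?_
  obtain ⟨ψ₁, hψ₁, e₁⟩ := h₁ φ (coe_mem_xDual hφ)
  obtain ⟨ψ₂, hψ₂, e₂⟩ := h₂ φ (coe_mem_xDual hφ)
  have := hv (ψ₁ - ψ₂) (sub_mem hψ₁ hψ₂) fun s hs => by
    rw [LinearMap.sub_apply, e₁, e₂, h s hs, sub_self]
  rw [LinearMap.sub_apply, e₁, e₂, sub_eq_zero] at this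
  exact this

/-- The closure of an ideal is an ideal. -/
lemma IsCStarDualPair.wcl_ideal (hF : IsCStarDualPair F) {I : Submodule ℂ X} {B : Set X}
    (hI : ∀ x ∈ I, ∀ b ∈ B, b * x ∈ I ∧ x * b ∈ I) :
    ∀ x ∈ wcl (xDual F) I, ∀ b ∈ B, b * x ∈ wcl (xDual F) I ∧ x * b ∈ wcl (xDual F) I :=
  fun _ hx b hb => ⟨(hF.weakCont_mul_left b).map_mem (fun s hs => le_wcl _ _ (hI s hs b hb).1) hx,
    (hF.weakCont_mul_right b).map_mem (fun s hs => le_wcl _ _ (hI s hs b hb).2) hx⟩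

end Density

/-! ### Hereditary subalgebras, the trivial class, closedness of fixed algebras. -/

section Hereditary

variable {X : Type*} [NonUnitalCStarAlgebra X] [PartialOrder X] [StarOrderedRing X]

/-- A hereditary subalgebra `Y` satisfies `Y X Y ⊆ Y`. -/
lemma mul_mul_mem_of_hereditary {Y : NonUnitalStarSubalgebra ℂ X}
    (hY : ∀ x y : X, 0 ≤ x → x ≤ y → y ∈ Y → x ∈ Y) {y z : X} (hy : y ∈ Y) (x : X) (hz : z ∈ Y) :
    y * x * z ∈ Y := by
  have hx : x ∈ Submodule.span ℂ {a : X | 0 ≤ a} := by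
    rw [CStarAlgebra.span_nonneg]
    trivial
  induction hx using Submodule.span_induction with
  | mem x hx =>
    -- For x ≥ 0, y x y* is dominated by ‖x‖ y y*. Polarisation then yields y x w*.
    have h : ∀ y ∈ Y, y * x * star y ∈ Y := fun y hy => by
      refine hY _ (‖x‖ • (y * star y)) (star_right_conjugate_nonneg hx y)
        (CStarAlgebra.star_right_conjugate_le_norm_smul (.of_nonneg hx)) ?_
      rw [← Complex.coe_smul]
      exact SMulMemClass.smul_mem _ (mul_mem hy (star_mem hy))
    have hw := star_mem hz
    set w := star z with hwz
    have hzw : z = star w := by rw [hwz, star_star]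
    rw [hzw]
    have e : y * x * star w = (4⁻¹ : ℂ) • (((y + w) * x * star (y + w) -
        (y - w) * x * star (y - w)) + Complex.I • ((y + Complex.I • w) * x *
        star (y + Complex.I • w) - (y - Complex.I • w) * x * star (y - Complex.I • w))) := by
      simp only [star_add, star_sub, star_smul, mul_add, add_mul, mul_sub, sub_mul,
        smul_mul_assoc, mul_smul_comm, smul_add, smul_sub, smul_smul, RCLike.star_def,
        Complex.conj_I]
      match_scalars <;> ring_nf <;> simp; norm_num
    rw [e]
    have hIw : Complex.I • w ∈ Y := SMulMemClass.smul_mem _ hw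
    exact SMulMemClass.smul_mem _ (add_mem (sub_mem (h _ (add_mem hy hw)) (h _ (sub_mem hy hw)))
      (SMulMemClass.smul_mem _ (sub_mem (h _ (add_mem hy hIw)) (h _ (sub_mem hy hIw)))))
  | zero => simp
  | add a b _ _ ha hb => rw [mul_add, add_mul]; exact add_mem ha hb
  | smul c a _ ha => rw [mul_smul_comm, smul_mul_assoc]; exact SMulMemClass.smul_mem _ ha

end Hereditary

section TrivialClass

/-- The class of the trivial representation. -/
lemma exists_trivial_class (G : Type*) [Group G] [TopologicalSpace G] :
    ∃ c : DualSet G, ∀ g, c.rep.mat g = 1 := by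
  let π₀ : IrrRep G :=
    { dim := 1
      dim_pos := one_pos
      rep := 1
      continuous_rep := continuous_const
      irreducible := fun W _ => by
        have := is_simple_module_of_finrank_eq_one (K := ℂ) (A := ℂ) (V := Fin 1 → ℂ) (by simp)
        exact eq_bot_or_eq_top W }
  refine ⟨Quotient.mk _ π₀, fun g => ?_⟩
  obtain ⟨U, h1, -, h3⟩ : IrrRep.UnitarilyEquiv (DualSet.rep (Quotient.mk _ π₀)) π₀ :=
    Quotient.mk_out (s := irrRepSetoid G) π₀
  have h4 : π₀.mat g = 1 := rfl
  have h5 := h3 g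
  rw [h4, Matrix.one_mul] at h5
  rw [← Matrix.one_mul (IrrRep.mat _ g), ← h1, Matrix.mul_assoc, h5, h1]

end TrivialClass

section Closed

variable {X : Type*} [NonUnitalCStarAlgebra X]
  {G : Type*} [Group G] [TopologicalSpace G] [IsTopologicalGroup G] [CompactSpace G]
  [MeasurableSpace G] [BorelSpace G]
  {F : Submodule ℂ (StrongDual ℂ X)} {α : G →* (X ≃⋆ₐ[ℂ] X)}

lemma wcl_fixedAlgebra_le (hF : IsCStarDualPair F) (hα : IsFDynamicalSystem F α)
    {Y : NonUnitalStarSubalgebra ℂ X} (hY : wcl (xDual F) Y.toSubmodule ≤ Y.toSubmodule)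
    (π : IrrRep G) : wcl (matDual F π.dim) (fixedAlgebra α Y π).toSubmodule ≤
      (fixedAlgebra α Y π).toSubmodule := by
  intro c hc
  refine mem_fixedAlgebra.2 ⟨fun i j => hY ?_, fun g i j => ?_⟩
  · exact (weakCont_entry i j).map_mem (fun s hs => le_wcl _ _ ((mem_fixedAlgebra.1 hs).1 i j)) hc
  · exact hF.eqOn_wcl ((hα.weakCont g).comp (weakCont_entry i j))
      (WeakCont.sum fun p _ => WeakCont.sum fun q _ => (weakCont_entry p q).smul _)
      (fun s hs => (mem_fixedAlgebra.1 hs).2 g i j) hc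

lemma spectralIdeal_le {Y : NonUnitalStarSubalgebra ℂ X} (π : IrrRep G) :
    spectralIdeal α Y π ≤ (fixedAlgebra α Y π).toSubmodule := by
  rw [spectralIdeal_eq_span, Submodule.span_le]
  rintro _ ⟨a, b, ha, hb, haY, hbY, rfl⟩
  exact ha.outer_mem hb haY hbY

/-- The other inclusion is automatic: Y₂(π)* Y₂(π) is contained in the fixed algebra, which is
weakly closed when Y is. -/
lemma mem_strongArvesonSpectrum_iff (hF : IsCStarDualPair F) (hα : IsFDynamicalSystem F α)
    {Y : NonUnitalStarSubalgebra ℂ X} (hY : wcl (xDual F) Y.toSubmodule ≤ Y.toSubmodule)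
    {c : DualSet G} : c ∈ strongArvesonSpectrum F α Y ↔
      (fixedAlgebra α Y c.rep).toSubmodule ≤ wcl (matDual F _) (spectralIdeal α Y c.rep) := by
  rw [strongArvesonSpectrum, Set.mem_ofPred_eq, closure_matTopology]
  refine ⟨fun h => fun x hx => h.ge hx, fun h => subset_antisymm ?_ h⟩
  exact (wcl_le_wcl ((spectralIdeal_le _).trans (le_wcl _ _))).trans (wcl_fixedAlgebra_le hF hα hY _)

end Closed

/-! ### Simplicity of X^α and α-simplicity. -/

section Simplicity

variable {X : Type*} [NonUnitalCStarAlgebra X]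
  {G : Type*} [Group G] [TopologicalSpace G] [IsTopologicalGroup G] [CompactSpace G] [T2Space G]
  [MeasurableSpace G] [BorelSpace G]
  {F : Submodule ℂ (StrongDual ℂ X)} {α : G →* (X ≃⋆ₐ[ℂ] X)}

/-- `F`-simplicity of the fixed point algebra of `α`. -/
def FixSimple (F : Submodule ℂ (StrongDual ℂ X)) (α : G →* (X ≃⋆ₐ[ℂ] X)) : Prop :=
  ∀ I : Submodule ℂ X, I ≠ ⊥ → I ≤ (fixedPts α).toSubmodule →
    (∀ x ∈ I, ∀ b ∈ fixedPts α, b * x ∈ I ∧ x * b ∈ I) →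
    (fixedPts α).toSubmodule ≤ wcl (xDual F) I

lemma wcl_top_le : wcl (xDual F) (⊤ : NonUnitalStarSubalgebra ℂ X).toSubmodule ≤
    (⊤ : NonUnitalStarSubalgebra ℂ X).toSubmodule := fun _ _ => trivial

lemma wcl_inf_le {A B : NonUnitalStarSubalgebra ℂ X}
    (hA : wcl (xDual F) A.toSubmodule ≤ A.toSubmodule)
    (hB : wcl (xDual F) B.toSubmodule ≤ B.toSubmodule) :
    wcl (xDual F) (A ⊓ B).toSubmodule ≤ (A ⊓ B).toSubmodule := fun _ hx =>
  ⟨hA (wcl_le_wcl (S := (A ⊓ B).toSubmodule) (fun _ hs => le_wcl _ _ hs.1) hx),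
    hB (wcl_le_wcl (S := (A ⊓ B).toSubmodule) (fun _ hs => le_wcl _ _ hs.2) hx)⟩

lemma isRow_const {π : IrrRep G} (hπ : ∀ g, π.mat g = 1) {s : X} (hs : s ∈ fixedPts α) :
    IsRow α π (fun _ => s) := by
  intro g k
  simp [hπ, hs g, Matrix.one_apply, ite_smul]

lemma mem_fixedAlgebra_of_mat_eq_one {π : IrrRep G} (hπ : ∀ g, π.mat g = 1)
    {c : Matrix (Fin π.dim) (Fin π.dim) X} :
    c ∈ fixedAlgebra α ⊤ π ↔ ∀ i j, c i j ∈ fixedPts α := by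
  rw [mem_fixedAlgebra]
  simp only [hπ, Matrix.one_apply, mem_fixedPts]
  constructor
  · intro h i j g
    simpa [ite_and] using h.2 g i j
  · intro h
    exact ⟨fun _ _ => trivial, fun g i j => by simpa [ite_and] using h i j g⟩

/-- For trivial π the fixed algebra consists of all matrices over X^α, and an ideal I of X^α gives
the ideal of matrices over I. -/
lemma FixSimple.of_isFSimple {π : IrrRep G} (hπ : ∀ g, π.mat g = 1)
    (h : IsFSimple F (fixedAlgebra α ⊤ π)) : FixSimple F α := by
  intro I hI hIfix hmul x hx
  let M : Submodule ℂ (Matrix (Fin π.dim) (Fin π.dim) X) :=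
    { carrier := {a | ∀ i j, a i j ∈ I}
      add_mem' := fun ha hb i j => add_mem (ha i j) (hb i j)
      zero_mem' := fun i j => zero_mem I
      smul_mem' := fun c a ha i j => I.smul_mem c (ha i j) }
  let i₀ : Fin π.dim := ⟨0, π.dim_pos⟩
  have hM : M ≠ ⊥ := by
    obtain ⟨y, hy, hy0⟩ := Submodule.exists_mem_ne_zero_of_ne_bot hI
    intro hbot
    have : (of fun _ _ => y : Matrix (Fin π.dim) (Fin π.dim) X) ∈ M := fun _ _ => hy
    rw [hbot, Submodule.mem_bot] at this
    exact hy0 (congrFun (congrFun this i₀) i₀)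
  have h1 := h M hM
    (fun a ha => (mem_fixedAlgebra_of_mat_eq_one hπ).2 fun i j => hIfix (ha i j))
    (fun a ha b hb => by
      rw [mem_fixedAlgebra_of_mat_eq_one hπ] at hb
      exact ⟨fun i j => by
          rw [Matrix.mul_apply]
          exact sum_mem fun k _ => (hmul _ (ha k j) _ (hb i k)).1, fun i j => by
          rw [Matrix.mul_apply]
          exact sum_mem fun k _ => (hmul _ (ha i k) _ (hb k j)).2⟩)
  rw [closure_matTopology] at h1
  have h2 := h1 (a := of fun _ _ => x) ((mem_fixedAlgebra_of_mat_eq_one hπ).2 fun _ _ => hx)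
  exact (weakCont_entry i₀ i₀).map_mem (S := M) (fun s hs => le_wcl _ _ (hs i₀ i₀)) h2

variable [PartialOrder X] [StarOrderedRing X]

/-- A finite family `a` with `∑ aₖ aₖ* ∈ S` lies in the closure of `S a`. -/
lemma mem_wcl_of_sum_mul_star_mem {S : NonUnitalStarSubalgebra ℂ X}
    (hS : wcl (xDual F) S.toSubmodule ≤ S.toSubmodule) {ι : Type*} [Fintype ι] {a : ι → X}
    (ha : ∑ i, a i * star (a i) ∈ S) {R : Submodule ℂ X} {k : ι} (h : ∀ u ∈ S, u * a k ∈ R) :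
    a k ∈ wcl (xDual F) R :=
  mem_wcl_of_norm_approx fun _ hε => by
    obtain ⟨u, hu, -, h'⟩ := exists_approx_family (isClosed_of_wcl_le hS) ha hε
    exact ⟨_, h u hu, h' k⟩

/-- Peter–Weyl yields a non-zero row in Y, and ∑ a_k a_k* is invariant and, as a sum of positive
elements, non-zero. -/
lemma exists_fixedPts_ne_zero (hF : IsCStarDualPair F) (hα : IsFDynamicalSystem F α)
    {Y : Submodule ℂ X} (hY : wcl (xDual F) Y ≤ Y) (hinv : ∀ g, ∀ y ∈ Y, α g y ∈ Y)
    (hmul : ∀ x ∈ Y, ∀ y ∈ Y, x * star y ∈ Y) (hne : ∃ y ∈ Y, y ≠ 0) :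
    ∃ s ∈ Y, s ∈ fixedPts α ∧ s ≠ 0 := by
  obtain ⟨c, a, ha, haY, k, hk⟩ := exists_row_ne_zero hF hα hY hinv hne
  exact ⟨_, sum_mem fun k _ => hmul _ (haY k) _ (haY k), ha.sum_mul_star_mem ha,
    sum_mul_star_ne_zero hk⟩

/-- A closed invariant subalgebra `Y` is the closure of `Y^α Y`. -/
lemma le_wcl_fixedPts_mul (hF : IsCStarDualPair F) (hα : IsFDynamicalSystem F α)
    {Y : NonUnitalStarSubalgebra ℂ X} (hY : wcl (xDual F) Y.toSubmodule ≤ Y.toSubmodule)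
    (hinv : ∀ g, ∀ y ∈ Y, α g y ∈ Y) : Y.toSubmodule ≤
      wcl (xDual F) (Submodule.span ℂ {z | ∃ u ∈ Y ⊓ fixedPts α, ∃ x ∈ Y, z = u * x}) := by
  intro x hx
  refine mem_wcl_of_rows hF hα hY hinv (fun c a ha haY k => ?_) hx
  exact mem_wcl_of_sum_mul_star_mem (wcl_inf_le hY (wcl_fixedPts_le hF hα))
    ⟨sum_mem fun k _ => mul_mem (haY k) (star_mem (haY k)), ha.sum_mul_star_mem ha⟩
    fun u hu => Submodule.subset_span ⟨u, hu, _, haY k, rfl⟩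

/-- A closed invariant subalgebra `Y` is contained in the closure of `Y^α X Y^α`. -/
lemma le_wcl_fixedPts_mul_mul (hF : IsCStarDualPair F) (hα : IsFDynamicalSystem F α)
    {Y : NonUnitalStarSubalgebra ℂ X} (hY : wcl (xDual F) Y.toSubmodule ≤ Y.toSubmodule)
    (hinv : ∀ g, ∀ y ∈ Y, α g y ∈ Y) : Y.toSubmodule ≤
      wcl (xDual F) (Submodule.span ℂ
        {z | ∃ u ∈ Y ⊓ fixedPts α, ∃ v ∈ Y ⊓ fixedPts α, ∃ x, z = u * x * v}) := by
  have h := le_wcl_fixedPts_mul hF hα hY hinv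
  refine h.trans (wcl_le_wcl (Submodule.span_le.2 ?_))
  rintro _ ⟨u, hu, x, hx, rfl⟩
  have h1 : star (star x) ∈ wcl (xDual F)
      (Submodule.span ℂ {z | ∃ v ∈ Y ⊓ fixedPts α, ∃ x, z = x * v}) := by
    refine hF.star_mem_wcl_span ?_ (h (star_mem hx : star x ∈ Y))
    rintro _ ⟨v, hv, y, -, rfl⟩
    exact le_wcl _ _ (Submodule.subset_span ⟨star v, star_mem hv, star y, star_mul _ _⟩)
  rw [star_star] at h1
  refine (hF.weakCont_mul_left u).map_span_mem ?_ h1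
  rintro _ ⟨v, hv, y, rfl⟩
  exact le_wcl _ _ (Submodule.subset_span ⟨u, hu, v, hv, y, (mul_assoc _ _ _).symm⟩)

/-- Simplicity of the fixed point algebra implies `α`-simplicity. -/
lemma FixSimple.isAlphaSimple (hF : IsCStarDualPair F) (hα : IsFDynamicalSystem F α)
    (h : FixSimple F α) : IsAlphaSimple F α := by
  intro I hI hmul hinv
  rw [closure_fTopology]
  set J := wcl (xDual F) I with hJ
  have hJcl : wcl (xDual F) J ≤ J := wcl_idem _ _
  have hJmul := hF.wcl_ideal (B := Set.univ) (I := I) fun x hx b _ => hmul x hx b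
  have hJinv : ∀ g, ∀ y ∈ J, α g y ∈ J := fun g y hy =>
    (hα.weakCont g).map_mem (fun s hs => le_wcl _ _ (hinv g s hs)) hy
  obtain ⟨y, hy, hy0⟩ := Submodule.exists_mem_ne_zero_of_ne_bot hI
  obtain ⟨s, hsJ, hsfix, hs0⟩ := exists_fixedPts_ne_zero hF hα hJcl hJinv
    (fun x hx y _ => (hJmul x hx _ trivial).2) ⟨y, le_wcl _ _ hy, hy0⟩
  have h1 : (fixedPts α).toSubmodule ≤ J := by
    refine (h (J ⊓ (fixedPts α).toSubmodule) ?_ inf_le_right ?_).trans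
      ((wcl_le_wcl (inf_le_left.trans (le_wcl _ _))).trans hJcl)
    · exact fun hbot => hs0 ((Submodule.mem_bot ℂ).1 (hbot ▸ ⟨hsJ, hsfix⟩))
    · exact fun x hx b hb => ⟨⟨(hJmul x hx.1 b trivial).1, (fixedPts α).mul_mem hb hx.2⟩,
        ⟨(hJmul x hx.1 b trivial).2, (fixedPts α).mul_mem hx.2 hb⟩⟩
  -- Once J contains X^α, it contains u a_k for every row a and every u in X^α, hence in the limit
  -- a_k itself.
  refine Set.eq_univ_of_forall fun x => hJcl ?_
  refine mem_wcl_of_rows hF hα (wcl_top_le (X := X)) (fun _ _ _ => trivial)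
    (fun c a ha _ k => ?_) (x := x) trivial
  exact mem_wcl_of_sum_mul_star_mem (wcl_fixedPts_le hF hα) (ha.sum_mul_star_mem ha)
    fun u hu => (hJmul u (h1 hu) _ trivial).2

lemma isInvariantHereditary_top [Nontrivial X] : IsInvariantHereditary F α ⊤ where
  ne_bot := (exists_ne (0 : X)).imp fun _ h => ⟨trivial, h⟩
  isClosed := (isClosed_fTopology_iff (⊤ : NonUnitalStarSubalgebra ℂ X).toSubmodule).2 wcl_top_le
  invariant _ _ _ := trivial
  hereditary _ _ _ _ _ := trivial

lemma IsInvariantHereditary.wcl_le {Y : NonUnitalStarSubalgebra ℂ X}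
    (hY : IsInvariantHereditary F α Y) : wcl (xDual F) Y.toSubmodule ≤ Y.toSubmodule :=
  (isClosed_fTopology_iff Y.toSubmodule).1 hY.isClosed

lemma IsInvariantHereditary.exists_fixedPts_ne_zero (hF : IsCStarDualPair F)
    (hα : IsFDynamicalSystem F α) {Y : NonUnitalStarSubalgebra ℂ X}
    (hY : IsInvariantHereditary F α Y) : ∃ s ∈ Y ⊓ fixedPts α, s ≠ 0 := by
  obtain ⟨s, h1, h2, h3⟩ := FDyn.exists_fixedPts_ne_zero hF hα hY.wcl_le hY.invariant
    (fun _ hx _ hy => Y.mul_mem hx (star_mem (s := Y) hy)) hY.ne_bot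
  exact ⟨s, ⟨h1, h2⟩, h3⟩

lemma diagonal_mem_fixedAlgebra {Y : NonUnitalStarSubalgebra ℂ X} {s : X}
    (hs : s ∈ Y ⊓ fixedPts α) (π : IrrRep G) : Matrix.diagonal (fun _ => s) ∈ fixedAlgebra α Y π := by
  refine mem_fixedAlgebra.2 ⟨fun i j => ?_, fun g i j => ?_⟩
  · rw [Matrix.diagonal_apply]
    split_ifs
    exacts [hs.1, zero_mem Y]
  · have h := sum_star_mat_mul_mat π g i j
    simp only [Matrix.diagonal_apply, smul_ite, smul_zero, Finset.sum_ite_eq, Finset.mem_univ,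
      if_true, ← Finset.sum_smul]
    rw [h]
    split_ifs
    · rw [hs.2 g, one_smul]
    · simp

/-- The strong Connes spectrum is contained in the spectrum. -/
lemma strongConnesSpectrum_subset [Nontrivial X] (hF : IsCStarDualPair F)
    (hα : IsFDynamicalSystem F α) : strongConnesSpectrum F α ⊆ spectrumOf F α := by
  intro c hc
  rw [mem_spectrumOf_iff hF hα]
  by_contra! hcon
  have h := (mem_strongArvesonSpectrum_iff hF hα wcl_top_le).1 (hc ⊤ isInvariantHereditary_top)
  -- Without non-zero rows the spectral ideal is zero, whereas the fixed algebra contains s ⊗ 1 for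
  -- a non-zero fixed s.
  have hbot : spectralIdeal α ⊤ c.rep = ⊥ := by
    rw [spectralIdeal_eq_span, Submodule.span_eq_bot]
    rintro _ ⟨a, b, ha, -, -, -, rfl⟩
    ext k l
    simp [outer, hcon a ha]
  rw [hbot, wcl_matDual_bot hF] at h
  obtain ⟨s, hs, hs0⟩ := (isInvariantHereditary_top (F := F) (α := α)).exists_fixedPts_ne_zero hF hα
  have h1 := (Submodule.mem_bot ℂ).1 (h (diagonal_mem_fixedAlgebra hs c.rep))
  let i₀ : Fin c.rep.dim := ⟨0, c.rep.dim_pos⟩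
  exact hs0 (by simpa using congrFun (congrFun h1 i₀) i₀)

end Simplicity

lemma span_ideal {R : Type*} [NonUnitalRing R] [Module ℂ R] [IsScalarTower ℂ R R]
    [SMulCommClass ℂ R R] {A B : Set R}
    (h : ∀ x ∈ A, ∀ b ∈ B, b * x ∈ Submodule.span ℂ A ∧ x * b ∈ Submodule.span ℂ A) :
    ∀ x ∈ Submodule.span ℂ A, ∀ b ∈ B, b * x ∈ Submodule.span ℂ A ∧ x * b ∈ Submodule.span ℂ A := by
  intro x hx b hb
  exact ⟨(Submodule.span_le (p := (Submodule.span ℂ A).comap (LinearMap.mulLeft ℂ b))).2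
      (fun s hs => (h s hs b hb).1) hx,
    (Submodule.span_le (p := (Submodule.span ℂ A).comap (LinearMap.mulRight ℂ b))).2
      (fun s hs => (h s hs b hb).2) hx⟩

/-! ### From simple fixed algebras to the strong Connes spectrum. -/

section Spectrum

variable {X : Type*} [NonUnitalCStarAlgebra X] [PartialOrder X] [StarOrderedRing X]
  {G : Type*} [Group G] [TopologicalSpace G] [IsTopologicalGroup G] [CompactSpace G] [T2Space G]
  [MeasurableSpace G] [BorelSpace G]
  {F : Submodule ℂ (StrongDual ℂ X)} {α : G →* (X ≃⋆ₐ[ℂ] X)}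

/-- The products a b* span a non-zero, hence dense, ideal of X^α. If s killed every row it would
kill X^α, and then s s* = 0. -/
lemma FixSimple.exists_mul_row_ne_zero (hF : IsCStarDualPair F)
    (h : FixSimple F α) {π : IrrRep G} {a₀ : Fin π.dim → X} (ha₀ : IsRow α π a₀) {k₀ : Fin π.dim}
    (hk₀ : a₀ k₀ ≠ 0) {s : X} (hs : s ∈ fixedPts α) (hs0 : s ≠ 0) :
    ∃ a, IsRow α π a ∧ ∃ k, s * a k ≠ 0 := by
  by_contra! hcon
  set A : Set X := {z | ∃ a b : Fin π.dim → X, IsRow α π a ∧ IsRow α π b ∧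
    z = ∑ k, a k * star (b k)}
  have hA : ∀ x ∈ A, ∀ b ∈ (fixedPts α : Set X),
      b * x ∈ Submodule.span ℂ A ∧ x * b ∈ Submodule.span ℂ A := by
    rintro _ ⟨a, b, ha, hb, rfl⟩ y hy
    refine ⟨Submodule.subset_span ⟨_, b, ha.mul_left hy, hb, ?_⟩,
      Submodule.subset_span ⟨a, _, ha, hb.mul_left (star_mem hy), ?_⟩⟩
    · simp only [Finset.mul_sum, mul_assoc]
    · simp only [Finset.sum_mul, mul_assoc, star_mul, star_star]
  have h1 := h (Submodule.span ℂ A) ?_ ?_ (span_ideal hA)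
  · have h2 : s * star s ∈ wcl (xDual F) (⊥ : Submodule ℂ X) := by
      refine (hF.weakCont_mul_left s).map_span_mem ?_ (h1 (star_mem hs : star s ∈ fixedPts α))
      rintro _ ⟨a, b, ha, hb, rfl⟩
      simp only [Finset.mul_sum, ← mul_assoc, hcon a ha, zero_mul, Finset.sum_const_zero]
      exact zero_mem _
    rw [wcl_bot hF, Submodule.mem_bot] at h2
    exact hs0 ((CStarRing.mul_star_self_eq_zero_iff _).1 h2)
  · intro hbot
    refine sum_mul_star_ne_zero hk₀ ((Submodule.mem_bot ℂ).1 (hbot ▸ ?_))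
    exact Submodule.subset_span ⟨a₀, a₀, ha₀, ha₀, rfl⟩
  · rw [Submodule.span_le]
    rintro _ ⟨a, b, ha, hb, rfl⟩
    exact ha.sum_mul_star_mem hb

lemma mul_vecMul {n : ℕ} (u : X) (a : Fin n → X) (c : Matrix (Fin n) (Fin n) X) :
    (fun k => u * a k) ᵥ* c = fun k => u * (a ᵥ* c) k := by
  ext k
  simp [Matrix.vecMul, dotProduct, Finset.mul_sum, mul_assoc]

lemma outer_self_ne_zero {n : ℕ} {a : Fin n → X} {k : Fin n} (hk : a k ≠ 0) : outer a a ≠ 0 :=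
  fun h => hk ((CStarRing.star_mul_self_eq_zero_iff _).1 (congrFun (congrFun h k) k))

lemma weakCont_mul_mul (hF : IsCStarDualPair F) {n : ℕ} (u v : X) :
    WeakCont (matDual F n) (matDual F n)
      (fun a : Matrix (Fin n) (Fin n) X => of fun i j => u * a i j * v) :=
  WeakCont.of_entries fun i j =>
    (hF.weakCont_mul_right v).comp ((hF.weakCont_mul_left u).comp (weakCont_entry i j))

lemma proj_mul_mul (hF : IsCStarDualPair F) (hα : IsFDynamicalSystem F α) (π : IrrRep G)
    (k l : Fin π.dim) {u v : X} (hu : u ∈ fixedPts α) (hv : v ∈ fixedPts α) (x : X) :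
    proj F α π k l (u * x * v) = of fun i j => u * proj F α π k l x i j * v := by
  have hc := continuous_mat_mul_star_mat π
  ext i j
  simp only [proj, of_apply]
  rw [avg_mul hF hα (hc _ _ _ _) hv, mul_avg hF hα (hc _ _ _ _) hu]

/-- The ideal spanned by (ua)*(vb) with u, v in Y^α is dense in the fixed algebra of X ⊗ B(H_π).
Entries in Y are limits of u x v, and `proj` commutes with multiplication by fixed points, so
elements of the fixed algebra of Y are reached from compressions u (·) v of that ideal. -/
lemma FixSimple.mem_strongConnesSpectrum (hF : IsCStarDualPair F) (hα : IsFDynamicalSystem F α)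
    (h : FixSimple F α) {c : DualSet G} (hc : c ∈ spectrumOf F α)
    (hB : IsFSimple F (fixedAlgebra α ⊤ c.rep)) : c ∈ strongConnesSpectrum F α := by
  intro Y hY
  rw [mem_strongArvesonSpectrum_iff hF hα hY.wcl_le]
  set π := c.rep
  obtain ⟨a₀, ha₀, k₀, hk₀⟩ := (mem_spectrumOf_iff hF hα).1 hc
  obtain ⟨s, hs, hs0⟩ := hY.exists_fixedPts_ne_zero hF hα
  obtain ⟨a₁, ha₁, k₁, hk₁⟩ := h.exists_mul_row_ne_zero hF ha₀ hk₀ hs.2 hs0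
  set A : Set (Matrix (Fin π.dim) (Fin π.dim) X) := {z | ∃ a b : Fin π.dim → X, IsRow α π a ∧
    IsRow α π b ∧ ∃ u ∈ Y ⊓ fixedPts α, ∃ v ∈ Y ⊓ fixedPts α,
      z = outer (fun k => u * a k) (fun k => v * b k)}
  have hA : ∀ x ∈ A, ∀ b ∈ (fixedAlgebra α ⊤ π : Set _),
      b * x ∈ Submodule.span ℂ A ∧ x * b ∈ Submodule.span ℂ A := by
    rintro _ ⟨a, b, ha, hb, u, hu, v, hv, rfl⟩ z hz
    rw [mul_outer, outer_mul, mul_vecMul, mul_vecMul]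
    exact ⟨Submodule.subset_span ⟨_, b, ha.vecMul (star_mem hz), hb, u, hu, v, hv, rfl⟩,
      Submodule.subset_span ⟨a, _, ha, hb.vecMul hz, u, hu, v, hv, rfl⟩⟩
  have h1 := hB (Submodule.span ℂ A) ?_ ?_ (span_ideal hA)
  · rw [closure_matTopology] at h1
    intro x hx
    rw [← sum_proj hF hα hx]
    refine sum_mem fun k _ => sum_mem fun l _ => ?_
    have h2 := le_wcl_fixedPts_mul_mul hF hα hY.wcl_le hY.invariant
      ((mem_fixedAlgebra.1 hx).1 k l)
    refine (weakCont_proj hF hα π k l).map_span_mem ?_ h2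
    rintro _ ⟨u, hu, v, hv, x, rfl⟩
    rw [proj_mul_mul hF hα π k l hu.2 hv.2]
    refine (weakCont_mul_mul hF u v).map_span_mem ?_ (h1 (proj_mem hF hα π k l x))
    rintro _ ⟨a, b, ha, hb, y, hy, z, hz, rfl⟩
    -- The compression u (ya)*(zb) v equals (y a u*)*(z b v), whose rows lie in Y because Y X Y ⊆ Y.
    rw [spectralIdeal_eq_span]
    refine le_wcl _ _ (Submodule.subset_span ⟨fun k => y * a k * star u, fun k => z * b k * v,
      (ha.mul_left hy.2).mul_right (star_mem hu.2), (hb.mul_left hz.2).mul_right hv.2,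
      fun k => mul_mul_mem_of_hereditary hY.hereditary hy.1 _ (star_mem hu.1),
      fun k => mul_mul_mem_of_hereditary hY.hereditary hz.1 _ hv.1, ?_⟩)
    ext i j
    simp [outer, mul_assoc]
  · intro hbot
    refine outer_self_ne_zero (a := fun k => s * a₁ k) hk₁ ((Submodule.mem_bot ℂ).1 (hbot ▸ ?_))
    exact Submodule.subset_span ⟨a₁, a₁, ha₁, ha₁, s, hs, s, hs, rfl⟩
  · rintro x hx
    refine (Submodule.span_le (p := (fixedAlgebra α ⊤ π).toSubmodule)).2 ?_ hx
    rintro _ ⟨a, b, ha, hb, u, hu, v, hv, rfl⟩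
    exact (ha.mul_left hu.2).outer_mem (hb.mul_left hv.2) (fun _ => trivial) (fun _ => trivial)

end Spectrum

/-! ### From simplicity of X^α to simplicity of the fixed algebras. -/

section FixedAlgebraSimple

variable {X : Type*} [NonUnitalCStarAlgebra X] [PartialOrder X] [StarOrderedRing X]
  {G : Type*} [Group G] [TopologicalSpace G] [IsTopologicalGroup G] [CompactSpace G] [T2Space G]
  [MeasurableSpace G] [BorelSpace G]
  {F : Submodule ℂ (StrongDual ℂ X)} {α : G →* (X ≃⋆ₐ[ℂ] X)}

lemma outer_mul_outer {n : ℕ} (d a b e : Fin n → X) :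
    outer d a * outer b e = outer d (fun l => (∑ k, a k * star (b k)) * e l) := by
  ext i j
  simp [outer, Matrix.mul_apply, Finset.sum_mul, Finset.mul_sum, mul_assoc]

lemma eq_zero_of_conjTranspose_mul_self {n : ℕ} {m : Matrix (Fin n) (Fin n) X}
    (h : mᴴ * m = 0) : m = 0 := by
  ext k i
  have h1 := congrFun (congrFun h i) i
  simp only [Matrix.mul_apply, conjTranspose_apply, Matrix.zero_apply] at h1
  have h2 := (Finset.sum_eq_zero_iff_of_nonneg fun k _ => star_mul_self_nonneg (m k i)).1 h1 k
    (Finset.mem_univ k)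
  exact (CStarRing.star_mul_self_eq_zero_iff _).1 h2

lemma weakCont_matrix_mul_right (hF : IsCStarDualPair F) {n : ℕ} (m : Matrix (Fin n) (Fin n) X) :
    WeakCont (matDual F n) (matDual F n) (fun a : Matrix (Fin n) (Fin n) X => a * m) :=
  WeakCont.of_entries fun i j => by
    simp only [Matrix.mul_apply]
    exact WeakCont.sum fun k _ => (hF.weakCont_mul_right _).comp (weakCont_entry i k)

lemma weakCont_outer_mul (hF : IsCStarDualPair F) {n : ℕ} (d e : Fin n → X) :
    WeakCont (xDual F) (matDual F n) (fun y => outer d (fun l => y * e l)) :=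
  WeakCont.of_entries fun i j =>
    (hF.weakCont_mul_left (star (d i))).comp ((hF.weakCont_mul_right (e j)).comp weakCont_id)

/-- If every `a m` with a row `a` vanishes, so does `m`. -/
lemma eq_zero_of_vecMul_eq_zero [Nontrivial X] (hF : IsCStarDualPair F)
    (hα : IsFDynamicalSystem F α) {c : DualSet G} (hc : c ∈ strongConnesSpectrum F α)
    {m : Matrix (Fin c.rep.dim) (Fin c.rep.dim) X} (hm : m ∈ fixedAlgebra α ⊤ c.rep)
    (h : ∀ a, IsRow α c.rep a → a ᵥ* m = 0) : m = 0 := by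
  have h1 := (mem_strongArvesonSpectrum_iff hF hα wcl_top_le).1 (hc ⊤ isInvariantHereditary_top)
  rw [spectralIdeal_eq_span] at h1
  have h2 : mᴴ * m ∈ wcl (matDual F _) ⊥ := by
    refine (weakCont_matrix_mul_right hF m).map_span_mem ?_ (h1 (star_mem hm : mᴴ ∈ fixedAlgebra α ⊤ c.rep))
    rintro _ ⟨a, b, -, hb, -, -, rfl⟩
    have : outer a b * m = 0 := by
      rw [outer_mul, h b hb]
      ext i j
      simp [outer]
    rw [this]
    exact zero_mem _
  rw [wcl_matDual_bot hF, Submodule.mem_bot] at h2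
  exact eq_zero_of_conjTranspose_mul_self h2

/-- The elements a m b* with m in J span an ideal of X^α, non-zero because rows separate the fixed
algebra. It is therefore dense in X^α, and multiplying by d* and e returns to J: d* (a m b*) e = (d*
a) m (b* e). -/
lemma FixSimple.isFSimple [Nontrivial X] (hF : IsCStarDualPair F) (hα : IsFDynamicalSystem F α)
    (h : FixSimple F α) {c : DualSet G} (hc : c ∈ strongConnesSpectrum F α) :
    IsFSimple F (fixedAlgebra α ⊤ c.rep) := by
  have hdense := (mem_strongArvesonSpectrum_iff hF hα wcl_top_le).1
    (hc ⊤ isInvariantHereditary_top)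
  have hzero := fun m => eq_zero_of_vecMul_eq_zero (m := m) hF hα hc
  set π := c.rep
  intro J hJ hJB hJmul
  set A : Set X := {z | ∃ a b : Fin π.dim → X, IsRow α π a ∧ IsRow α π b ∧ ∃ m ∈ J,
    z = ∑ k, (a ᵥ* m) k * star (b k)}
  have hA : ∀ x ∈ A, ∀ b ∈ (fixedPts α : Set X),
      b * x ∈ Submodule.span ℂ A ∧ x * b ∈ Submodule.span ℂ A := by
    rintro _ ⟨a, b, ha, hb, m, hm, rfl⟩ y hy
    refine ⟨Submodule.subset_span ⟨_, b, ha.mul_left hy, hb, m, hm, ?_⟩,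
      Submodule.subset_span ⟨a, _, ha, hb.mul_left (star_mem hy), m, hm, ?_⟩⟩
    · simp only [mul_vecMul, Finset.mul_sum, mul_assoc]
    · simp only [Finset.sum_mul, mul_assoc, star_mul, star_star]
  have h1 := h (Submodule.span ℂ A) ?_ ?_ (span_ideal hA)
  · have h2 : ∀ d e, IsRow α π d → IsRow α π e → ∀ y ∈ fixedPts α,
        outer d (fun l => y * e l) ∈ wcl (matDual F π.dim) J := by
      intro d e hd he y hy
      refine (weakCont_outer_mul hF d e).map_span_mem ?_ (h1 hy)
      rintro _ ⟨a, b, ha, hb, m, hm, rfl⟩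
      rw [← outer_mul_outer, ← outer_mul]
      exact le_wcl _ _ (hJmul _ (hJmul _ hm _
        (hd.outer_mem ha (fun _ => trivial) fun _ => trivial)).1 _
        (hb.outer_mem he (fun _ => trivial) fun _ => trivial)).2
    rw [closure_matTopology]
    refine hdense.trans (wcl_le_wcl ?_)
    rw [spectralIdeal_eq_span, Submodule.span_le]
    rintro _ ⟨d, e, hd, he, -, -, rfl⟩
    refine wcl_idem _ _ (mem_wcl_matDual_of_norm_approx fun ε hε => ?_)
    -- d* e is approximated by d* u e with u in X^α. The tolerance is divided by a bound for all
    -- ‖d_i‖, with 1 added to avoid dividing by zero.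
    obtain ⟨u, hu, -, h'⟩ := exists_approx_family (isClosed_of_wcl_le (wcl_fixedPts_le hF hα))
      (he.sum_mul_star_mem he) (ε := ε / (1 + ∑ k, ‖d k‖)) (by positivity)
    refine ⟨_, h2 d e hd he u hu, fun i j => ?_⟩
    have hd1 : ‖d i‖ ≤ 1 + ∑ k, ‖d k‖ := by
      have := Finset.single_le_sum (f := fun k => ‖d k‖) (fun k _ => norm_nonneg _)
        (Finset.mem_univ i)
      linarith
    calc ‖outer d e i j - outer d (fun l => u * e l) i j‖ = ‖star (d i) * (e j - u * e j)‖ := by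
          simp only [outer, of_apply, mul_sub]
      _ ≤ (1 + ∑ k, ‖d k‖) * (ε / (1 + ∑ k, ‖d k‖)) := by
          refine (norm_mul_le _ _).trans ?_
          rw [norm_star]
          exact mul_le_mul hd1 (h' j) (norm_nonneg _) (by positivity)
      _ = ε := mul_div_cancel₀ _ (by positivity)
  · intro hbot
    obtain ⟨m, hm, hm0⟩ := Submodule.exists_mem_ne_zero_of_ne_bot hJ
    refine hm0 (hzero m (hJB m hm) fun a ha => ?_)
    ext k
    by_contra hk
    refine sum_mul_star_ne_zero (a := a ᵥ* m) hk ((Submodule.mem_bot ℂ).1 (hbot ▸ ?_))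
    exact Submodule.subset_span ⟨a, _, ha, ha.vecMul (hJB m hm), m, hm, rfl⟩
  · rw [Submodule.span_le]
    rintro _ ⟨a, b, ha, hb, m, hm, rfl⟩
    exact (ha.vecMul (hJB m hm)).sum_mul_star_mem hb

end FixedAlgebraSimple

/-! ### The hereditary subalgebra generated by an ideal of X^α. -/

section Sandwich

variable {X : Type*} [NonUnitalCStarAlgebra X]
  {G : Type*} [Group G] [TopologicalSpace G] [IsTopologicalGroup G] [CompactSpace G] [T2Space G]
  [MeasurableSpace G] [BorelSpace G]
  {F : Submodule ℂ (StrongDual ℂ X)} {α : G →* (X ≃⋆ₐ[ℂ] X)}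

/-- The products `j₁ x j₂*` with `j₁, j₂ ∈ J` and `x ∈ X`. -/
def sandwichSet (J : Submodule ℂ X) : Set X := {z | ∃ j₁ ∈ J, ∃ j₂ ∈ J, ∃ x, z = j₁ * x * star j₂}

/-- Multiplication is only separately continuous, so generators are replaced by limits in one factor
at a time. -/
lemma mul_mul_mem_wcl_sandwich (hF : IsCStarDualPair F) {J : Submodule ℂ X} {y z : X}
    (hy : y ∈ wcl (xDual F) (Submodule.span ℂ (sandwichSet J))) (x : X)
    (hz : z ∈ wcl (xDual F) (Submodule.span ℂ (sandwichSet J))) :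
    y * x * z ∈ wcl (xDual F) (Submodule.span ℂ (sandwichSet J)) := by
  refine (hF.weakCont_mul_left (y * x)).map_span_mem ?_ hz
  rintro _ ⟨j₃, h₃, j₄, h₄, x', rfl⟩
  rw [mul_assoc y]
  refine (hF.weakCont_mul_right _).map_span_mem ?_ hy
  rintro _ ⟨j₁, h₁, j₂, -, x'', rfl⟩
  exact le_wcl _ _ (Submodule.subset_span
    ⟨j₁, h₁, j₄, h₄, x'' * (star j₂ * (x * (j₃ * x'))), by simp only [mul_assoc]⟩)

/-- The closure of `J X J*`. -/
def sandwich (hF : IsCStarDualPair F) (J : Submodule ℂ X) : NonUnitalStarSubalgebra ℂ X where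
  carrier := wcl (xDual F) (Submodule.span ℂ (sandwichSet J))
  add_mem' ha hb := add_mem ha hb
  zero_mem' := zero_mem _
  smul_mem' c _ hx := Submodule.smul_mem _ c hx
  mul_mem' {y z} hy hz := by
    refine (hF.weakCont_mul_left y).map_span_mem ?_ hz
    rintro _ ⟨j₃, h₃, j₄, h₄, x', rfl⟩
    refine (hF.weakCont_mul_right _).map_span_mem ?_ hy
    rintro _ ⟨j₁, h₁, j₂, -, x'', rfl⟩
    exact le_wcl _ _ (Submodule.subset_span
      ⟨j₁, h₁, j₄, h₄, x'' * (star j₂ * (j₃ * x')), by simp only [mul_assoc]⟩)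
  star_mem' {y} hy := by
    refine hF.star_mem_wcl_span ?_ hy
    rintro _ ⟨j₁, h₁, j₂, h₂, x, rfl⟩
    exact le_wcl _ _ (Submodule.subset_span
      ⟨j₂, h₂, j₁, h₁, star x, by simp only [star_mul, star_star, mul_assoc]⟩)

lemma wcl_sandwich_le (hF : IsCStarDualPair F) (J : Submodule ℂ X) :
    wcl (xDual F) (sandwich hF J).toSubmodule ≤ (sandwich hF J).toSubmodule := wcl_idem _ _

lemma mul_mul_star_mem_sandwich (hF : IsCStarDualPair F) {J : Submodule ℂ X} {j₁ j₂ : X}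
    (h₁ : j₁ ∈ J) (x : X) (h₂ : j₂ ∈ J) : j₁ * x * star j₂ ∈ sandwich hF J :=
  le_wcl _ _ (Submodule.subset_span ⟨j₁, h₁, j₂, h₂, x, rfl⟩)

lemma mul_star_mul_mul_star_ne_zero {j : X} (hj : j ≠ 0) : j * (star j * j) * star j ≠ 0 := by
  have h : j * (star j * j) * star j = (j * star j) * star (j * star j) := by
    simp only [star_mul, star_star, mul_assoc]
  rw [h, Ne, CStarRing.mul_star_self_eq_zero_iff, CStarRing.mul_star_self_eq_zero_iff]
  exact hj

variable [PartialOrder X] [StarOrderedRing X]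

/-- Write Y for the sandwich and x = b b*. Since b b* ≤ y, approximate units put b in the closure of
Y X, so b b* is in the closure of Y X Y ⊆ Y. -/
lemma sandwich_hereditary (hF : IsCStarDualPair F) (J : Submodule ℂ X) {x y : X} (hx : 0 ≤ x)
    (hxy : x ≤ y) (hy : y ∈ sandwich hF J) : x ∈ sandwich hF J := by
  obtain ⟨b, rfl⟩ := CStarAlgebra.nonneg_iff_eq_mul_star_self.1 hx
  have hb : b ∈ wcl (xDual F) (Submodule.span ℂ {z | ∃ u ∈ sandwich hF J, ∃ x, z = u * x}) :=
    mem_wcl_of_norm_approx fun ε hε => by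
      obtain ⟨u, hu, -, h⟩ := exists_approx_unit (sandwich hF J)
        (isClosed_of_wcl_le (wcl_sandwich_le hF J)) (hx.trans hxy) hy hε
      exact ⟨u * b, Submodule.subset_span ⟨u, hu, b, rfl⟩, h b hxy⟩
  have hb' : star b ∈ wcl (xDual F)
      (Submodule.span ℂ {z | ∃ u ∈ sandwich hF J, ∃ x, z = x * u}) := by
    refine hF.star_mem_wcl_span ?_ hb
    rintro _ ⟨u, hu, x, rfl⟩
    exact le_wcl _ _ (Submodule.subset_span ⟨star u, star_mem hu, star x, star_mul _ _⟩)
  refine wcl_sandwich_le hF J ((hF.weakCont_mul_right (star b)).map_span_mem ?_ hb)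
  rintro _ ⟨u, hu, x, rfl⟩
  refine (hF.weakCont_mul_left (u * x)).map_span_mem ?_ hb'
  rintro _ ⟨v, hv, x', rfl⟩
  have h : u * x * (x' * v) = u * (x * x') * v := by simp only [mul_assoc]
  rw [h]
  exact le_wcl _ _ (mul_mul_mem_wcl_sandwich hF hu (x * x') hv)

lemma isInvariantHereditary_sandwich (hF : IsCStarDualPair F) (hα : IsFDynamicalSystem F α)
    {J : Submodule ℂ X} (hJ : J ≠ ⊥) (hJfix : J ≤ (fixedPts α).toSubmodule) :
    IsInvariantHereditary F α (sandwich hF J) where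
  ne_bot := by
    obtain ⟨j, hj, hj0⟩ := Submodule.exists_mem_ne_zero_of_ne_bot hJ
    exact ⟨_, mul_mul_star_mem_sandwich hF hj _ hj, mul_star_mul_mul_star_ne_zero hj0⟩
  isClosed := (isClosed_fTopology_iff (sandwich hF J).toSubmodule).2 (wcl_sandwich_le hF J)
  invariant g y hy := by
    refine (hα.weakCont g).map_span_mem ?_ hy
    rintro _ ⟨j₁, h₁, j₂, h₂, x, rfl⟩
    rw [map_mul, map_mul, map_star, hJfix h₁ g, hJfix h₂ g]
    exact mul_mul_star_mem_sandwich hF h₁ _ h₂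
  hereditary _ _ hx hxy hy := sandwich_hereditary hF J hx hxy hy

end Sandwich

/-! ### From α-simplicity and the strong Connes spectrum to simplicity of X^α. -/

section FixedPointSimple

variable {X : Type*} [NonUnitalCStarAlgebra X]
  {G : Type*} [Group G] [TopologicalSpace G] [IsTopologicalGroup G] [CompactSpace G] [T2Space G]
  [MeasurableSpace G] [BorelSpace G]
  {F : Submodule ℂ (StrongDual ℂ X)} {α : G →* (X ≃⋆ₐ[ℂ] X)}

lemma avg_one_of_mem_fixedPts (hF : IsCStarDualPair F) (hα : IsFDynamicalSystem F α) {z : X}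
    (hz : z ∈ fixedPts α) : avg F α (fun _ => 1) z = z :=
  avg_eq hF hα continuous_const fun φ _ => by simp [hz _]

lemma IsRow.avg_mul (hF : IsCStarDualPair F) (hα : IsFDynamicalSystem F α) {π : IrrRep G}
    {a : Fin π.dim → X} (ha : IsRow α π a) (k : Fin π.dim) (x : X) :
    avg F α (fun _ => 1) (a k * x) = ∑ m, a m * avg F α (fun g => π.mat g m k) x := by
  have hc := continuous_mat π
  refine avg_eq hF hα continuous_const fun φ hφ => ?_
  have h : ∀ m, ∃ ψ ∈ F, ∀ y, ψ y = φ (a m * y) := fun m => by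
    obtain ⟨ψ, hψ, h⟩ := hF.weakCont_mul_left (a m) φ (coe_mem_xDual hφ)
    obtain ⟨ψ', hψ', h'⟩ := mem_xDual.1 hψ
    exact ⟨ψ', hψ', fun y => (h' y).trans (h y)⟩
  choose ψ hψ h using h
  rw [map_sum]
  simp only [← h, avg_spec hF hα (hc _ _) _ (hψ _), one_mul, map_mul, ha _ k, Finset.sum_mul,
    smul_mul_assoc, map_sum, map_smul, smul_eq_mul]
  rw [integral_finsetSum]
  exact fun m _ => integrable_of_continuous ((hc m k).mul (hα.continuous_orbit x _ (hψ m)))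

variable {J : Submodule ℂ X}

/-- For a row `q` in the closure of `J X J*` and a row `b`, the fixed point `∑ qₗ bₗ*` is in the
closure of `J`. -/
lemma sum_mul_star_mem_wcl (hF : IsCStarDualPair F) (hα : IsFDynamicalSystem F α)
    (hJfix : J ≤ (fixedPts α).toSubmodule)
    (hJmul : ∀ x ∈ J, ∀ b ∈ fixedPts α, b * x ∈ J ∧ x * b ∈ J) {π : IrrRep G}
    {q b : Fin π.dim → X} (hq : IsRow α π q) (hqJ : ∀ k, q k ∈ sandwich hF J)
    (hb : IsRow α π b) : ∑ l, q l * star (b l) ∈ wcl (xDual F) J := by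
  have hc : ∀ l k, Continuous fun g => star (π.mat g l k) := fun l k => (continuous_mat π l k).star
  -- Writing q through averages of its entries gives an expression weakly continuous in each entry.
  -- It may then be tested on j₁ x j₂*, where j₁ factors out on the left of a fixed point.
  have h : ∑ l, q l * star (b l) =
      ∑ k, ∑ l, avg F α (fun g => star (π.mat g l k)) (q k) * star (b l) := by
    rw [Finset.sum_comm]
    simp only [← Finset.sum_mul, hq.sum_avg hF hα]
  rw [h]
  refine sum_mem fun k _ => ?_
  have hw : WeakCont (xDual F) (xDual F)
      (fun x => ∑ l, avg F α (fun g => star (π.mat g l k)) x * star (b l)) :=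
    WeakCont.sum fun l _ => (hF.weakCont_mul_right (star (b l))).comp (weakCont_avg hF hα (hc l k))
  refine hw.map_span_mem ?_ (hqJ k)
  rintro _ ⟨j₁, h₁, j₂, h₂, x, rfl⟩
  have h1 : ∑ l, avg F α (fun g => star (π.mat g l k)) (j₁ * x * star j₂) * star (b l) =
      j₁ * ∑ l, avg F α (fun g => star (π.mat g l k)) x * star (b l * j₂) := by
    rw [Finset.mul_sum]
    refine Finset.sum_congr rfl fun l _ => ?_
    rw [FDyn.avg_mul hF hα (hc l k) (star_mem (hJfix h₂) : star j₂ ∈ fixedPts α),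
      mul_avg hF hα (hc l k) (hJfix h₁), star_mul]
    simp only [mul_assoc]
  rw [h1]
  exact le_wcl _ _ (hJmul _ h₁ _
    ((isRow_avg hF hα π k x).sum_mul_star_mem (hb.mul_right (hJfix h₂)))).2

variable [PartialOrder X] [StarOrderedRing X]

/-- A non-zero row a puts π in sp(α), hence in the strong Connes spectrum. So w ⊗ 1 is a limit of
sums of p* q with rows in the sandwich, and a (p* q) b* = (a p*)(q b*) has its second factor in the
closure of J. -/
lemma sum_mul_mul_star_mem_wcl (hF : IsCStarDualPair F) (hα : IsFDynamicalSystem F α)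
    (hsp : spectrumOf F α ⊆ strongConnesSpectrum F α) (hJ : J ≠ ⊥)
    (hJfix : J ≤ (fixedPts α).toSubmodule)
    (hJmul : ∀ x ∈ J, ∀ b ∈ fixedPts α, b * x ∈ J ∧ x * b ∈ J) {c : DualSet G}
    {a b : Fin c.rep.dim → X} (ha : IsRow α c.rep a) (hb : IsRow α c.rep b) {w : X}
    (hw : w ∈ sandwich hF J ⊓ fixedPts α) : ∑ k, a k * w * star (b k) ∈ wcl (xDual F) J := by
  by_cases ha0 : ∀ k, a k = 0
  · simp [ha0]
  push Not at ha0
  have hc := hsp ((mem_spectrumOf_iff hF hα).2 ⟨a, ha, ha0⟩)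
  have hdense := (mem_strongArvesonSpectrum_iff hF hα (wcl_sandwich_le hF J)).1
    (hc _ (isInvariantHereditary_sandwich hF hα hJ hJfix)) (diagonal_mem_fixedAlgebra hw c.rep)
  rw [spectralIdeal_eq_span] at hdense
  have hcont : WeakCont (matDual F c.rep.dim) (xDual F)
      (fun M : Matrix (Fin c.rep.dim) (Fin c.rep.dim) X =>
        ∑ k, ∑ l, a k * M k l * star (b l)) :=
    WeakCont.sum fun k _ => WeakCont.sum fun l _ => (hF.weakCont_mul_right _).comp
      ((hF.weakCont_mul_left _).comp (weakCont_entry k l))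
  have h := hcont.map_span_mem (R := J) ?_ hdense
  · simpa [Matrix.diagonal_apply, mul_ite, ite_mul] using h
  · rintro _ ⟨p, q, hp, hq, -, hqJ, rfl⟩
    have h1 : ∑ k, ∑ l, a k * outer p q k l * star (b l) =
        (∑ k, a k * star (p k)) * ∑ l, q l * star (b l) := by
      simp only [Finset.sum_mul_sum, outer, of_apply, mul_assoc]
    rw [h1]
    exact (hF.wcl_ideal (B := (fixedPts α : Set X)) hJmul _
      (sum_mul_star_mem_wcl hF hα hJfix hJmul hq hqJ hb) _ (ha.sum_mul_star_mem hp)).1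

/-- By density x may be taken to be an entry a_k of a row. Averaging a_k w y then gives ∑ a_m w
b_m*, where b is the row of averages of y*. -/
lemma avg_mul_mul_mem_wcl (hF : IsCStarDualPair F) (hα : IsFDynamicalSystem F α)
    (hsp : spectrumOf F α ⊆ strongConnesSpectrum F α) (hJ : J ≠ ⊥)
    (hJfix : J ≤ (fixedPts α).toSubmodule)
    (hJmul : ∀ x ∈ J, ∀ b ∈ fixedPts α, b * x ∈ J ∧ x * b ∈ J) {w : X}
    (hw : w ∈ sandwich hF J ⊓ fixedPts α) (x y : X) :
    avg F α (fun _ => 1) (x * w * y) ∈ wcl (xDual F) J := by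
  have hx : x ∈ wcl (xDual F) (Submodule.span ℂ {z | ∃ (c : DualSet G) (a : Fin c.rep.dim → X),
      IsRow α c.rep a ∧ ∃ k, z = a k}) := by
    refine mem_wcl_of_rows hF hα (wcl_top_le (X := X)) (fun _ _ _ => trivial)
      (fun c a ha _ k => le_wcl _ _ (Submodule.subset_span ?_)) trivial
    exact ⟨c, a, ha, k, rfl⟩
  rw [mul_assoc]
  refine ((weakCont_avg hF hα continuous_const).comp
    (hF.weakCont_mul_right (w * y))).map_span_mem ?_ hx
  rintro _ ⟨c, a, ha, k, rfl⟩
  have hc := continuous_mat c.rep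
  rw [ha.avg_mul hF hα]
  have h : ∀ m, a m * avg F α (fun g => c.rep.mat g m k) (w * y) =
      a m * w * star (avg F α (fun g => star (c.rep.mat g m k)) (star y)) := fun m => by
    rw [star_avg hF hα (hc m k).star, mul_avg hF hα (hc m k) hw.2]
    simp only [star_star, mul_assoc]
  simp only [h]
  exact sum_mul_mul_star_mem_wcl hF hα hsp hJ hJfix hJmul ha (isRow_avg hF hα _ k _) hw

/-- `α`-simplicity and `sp(α) ⊆ Γ̃(α)` imply simplicity of the fixed point algebra. -/
lemma IsAlphaSimple.fixSimple (hF : IsCStarDualPair F) (hα : IsFDynamicalSystem F α)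
    (hsimple : IsAlphaSimple F α) (hsp : spectrumOf F α ⊆ strongConnesSpectrum F α) :
    FixSimple F α := by
  intro J hJ hJfix hJmul z hz
  set A : Set X := {z | ∃ w ∈ sandwich hF J ⊓ fixedPts α, ∃ x y, z = x * w * y}
  have hA : ∀ s ∈ A, ∀ b ∈ (Set.univ : Set X),
      b * s ∈ Submodule.span ℂ A ∧ s * b ∈ Submodule.span ℂ A := by
    rintro _ ⟨w, hw, x, y, rfl⟩ b -
    exact ⟨Submodule.subset_span ⟨w, hw, b * x, y, by simp only [mul_assoc]⟩,
      Submodule.subset_span ⟨w, hw, x, y * b, by simp only [mul_assoc]⟩⟩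
  -- The invariant ideal X Y^α X is dense in X. Averaging fixes z and sends this ideal into the
  -- closure of J.
  have h := hsimple (Submodule.span ℂ A) ?_ (fun x hx b => span_ideal hA x hx b trivial) ?_
  · rw [closure_fTopology] at h
    have hz1 : z ∈ wcl (xDual F) (Submodule.span ℂ A) := h.ge (Set.mem_univ z)
    rw [← avg_one_of_mem_fixedPts hF hα hz]
    refine (weakCont_avg hF hα continuous_const).map_span_mem ?_ hz1
    rintro _ ⟨w, hw, x, y, rfl⟩
    exact avg_mul_mul_mem_wcl hF hα hsp hJ hJfix hJmul hw x y
  · intro hbot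
    obtain ⟨w, hw, hw0⟩ :=
      (isInvariantHereditary_sandwich hF hα hJ hJfix).exists_fixedPts_ne_zero hF hα
    refine mul_star_mul_mul_star_ne_zero hw0 ((Submodule.mem_bot ℂ).1 (hbot ▸ ?_))
    exact Submodule.subset_span ⟨w, hw, w * star w, star w, by simp only [mul_assoc]⟩
  · intro g x hx
    let T : X →ₗ[ℂ] X := { toFun := α g, map_add' := map_add _, map_smul' := map_smul _ }
    refine (Submodule.span_le (p := (Submodule.span ℂ A).comap T)).2 ?_ hx
    rintro _ ⟨w, hw, x, y, rfl⟩
    refine Submodule.subset_span ⟨w, hw, α g x, α g y, ?_⟩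
    change α g (x * w * y) = _
    rw [map_mul, map_mul, hw.2 g]

lemma exists_mem_spectrumOf_mat_eq_one [Nontrivial X] (hF : IsCStarDualPair F)
    (hα : IsFDynamicalSystem F α) : ∃ c ∈ spectrumOf F α, ∀ g, c.rep.mat g = 1 := by
  obtain ⟨c, hc⟩ := exists_trivial_class G
  obtain ⟨s, hs, hs0⟩ :=
    (isInvariantHereditary_top (F := F) (α := α)).exists_fixedPts_ne_zero hF hα
  exact ⟨c, (mem_spectrumOf_iff hF hα).2 ⟨_, isRow_const hc hs.2, ⟨0, c.rep.dim_pos⟩, hs0⟩, hc⟩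

end FixedPointSimple

end FDyn

end

theorem theorem3p6 {X : Type*} [NonUnitalCStarAlgebra X] [PartialOrder X] [StarOrderedRing X]
    [Nontrivial X]
    {G : Type*} [Group G] [TopologicalSpace G] [IsTopologicalGroup G] [CompactSpace G] [T2Space G]
    [MeasurableSpace G] [BorelSpace G]
    (F : Submodule ℂ (StrongDual ℂ X)) (hF : FDyn.IsCStarDualPair F)
    (α : G →* (X ≃⋆ₐ[ℂ] X)) (hα : FDyn.IsFDynamicalSystem F α) :
    (∀ π ∈ FDyn.spectrumOf F α, FDyn.IsFSimple F (FDyn.fixedAlgebra α ⊤ π.rep)) ↔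
      (FDyn.IsAlphaSimple F α ∧ FDyn.spectrumOf F α = FDyn.strongConnesSpectrum F α) := by
  constructor
  · intro h
    obtain ⟨c, hc, hc1⟩ := FDyn.exists_mem_spectrumOf_mat_eq_one hF hα
    have hfix := FDyn.FixSimple.of_isFSimple hc1 (h c hc)
    exact ⟨hfix.isAlphaSimple hF hα, subset_antisymm
      (fun π hπ => hfix.mem_strongConnesSpectrum hF hα hπ (h π hπ))
      (FDyn.strongConnesSpectrum_subset hF hα)⟩
  · rintro ⟨hsimple, hsp⟩ π hπ
    exact (hsimple.fixSimple hF hα hsp.subset).isFSimple hF hα (hsp ▸ hπ)
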